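/- Let $G$ be a (discrete) group. A family of subgroups of $G$ is a set of subgroups closed under conjugation and under passing to subgroups; $\{1\}$, $\mathcal{FIN}$ and $\mathcal{VCY}$ denote the families consisting of the trivial subgroup, of the finite subgroups and of the virtually cyclic subgroups. A model for the classifying space $E_{\mathcal F}(G)$ of a family $\mathcal F$ is a $G$-CW-complex $X$ whose isotropy groups belong to $\mathcal F$ and such that every $G$-CW-complex whose isotropy groups belong to $\mathcal F$ admits precisely one $G$-map to $X$ up to $G$-homotopy. Write $EG=E_{\{1\}}(G)$, $\underline{E}G=E_{\mathcal{FIN}}(G)$ and $\underline{\underline{E}}G=E_{\mathcal{VCY}}(G)$. For families $\mathcal F\subseteq\mathcal G$, the group $G$ satisfies $(M_{\mathcal F\subseteq\mathcal G})$ if every $H\in\mathcal G\setminus\mathcal F$ is contained in a unique maximal element of $\mathcal G\setminus\mathcal F$. For $H\subseteq G$ let $N_GH$ be the normalizer and $W_GH=N_GH/H$; a model $EW_GH$ is viewed as an $N_GH$-CW-complex by restriction along the projection $N_GH\to W_GH$. (a) Suppose that $G$ satisfies $(M_{\{1\}\subseteq\mathcal{FIN}})$, and let $\mathcal M$ be a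 complete system of representatives of the conjugacy classes of maximal finite subgroups of $G$. Let $EG$, and $EN_GF$ and $EW_GF$ for $F\in\mathcal M$, be any models, let $f_F\colon EN_GF\to EW_GF$ be $N_GF$-maps, and let $$\begin{array}{ccc}\coprod_{F\in\mathcal M}G\times_{N_GF}EN_GF&\xrightarrow{\;i\;}&EG\\ {\scriptstyle\coprod_F \mathrm{id}_G\times f_F}\downarrow&&\downarrow\\ \coprod_{F\in\mathcal M}G\times_{N_GF}EW_GF&\to&X\end{array}$$ be a $G$-pushout in which the two maps starting from the left upper corner are cellular and one of them is an inclusion of $G$-CW-complexes. Then $X$ has a $G$-CW-structure for which the two maps into $X$ are cellular and with which $X$ is a model for $\underline{E}G$. (b) Suppose that $G$ satisfies $(M_{\mathcal{FIN}\subseteq\mathcal{VCY}})$, and let $\mathcal M$ be a complete system of representatives of the conjugacy classes of maximal infinite virtually cyclic subgroups of $G$. Let $\underline{E}G$, and $\underline{E}(N_GV)$ and $EW_GV$ for $V\in\mathcal M$, be any models, let $f_V\colon \underline{E}(N_GV)\to EW_GV$ be $N_GV$-maps, and let $$\begin{array}{ccc}\coprod_{V\in\mathcal M}G\times_{N_GV}\underline{E}(N_GV)&\xrightarrow{\;i\;}&\underline{E}G\\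 {\scriptstyle\coprod_V \mathrm{id}_G\times f_V}\downarrow&&\downarrow\\ \coprod_{V\in\mathcal M}G\times_{N_GV}EW_GV&\to&Y\end{array}$$ be a $G$-pushout in which the two maps starting from the left upper corner are cellular and one of them is an inclusion of $G$-CW-complexes. Then $Y$ has a $G$-CW-structure for which the two maps into $Y$ are cellular and with which $Y$ is a model for $\underline{\underline{E}}G$. -/

import Mathlib

universe u

namespace EquivariantCW

open Set Metric Topology

noncomputable section

/-! ### Families of subgroups -/

/-- The conjugate subgroup `g H g⁻¹`. -/
def conjSubgroup {G : Type u} [Group G] (g : G) (H : Subgroup G) : Subgroup G :=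
  H.map (MulAut.conj g).toMonoidHom

/-- A family of subgroups of `G`: a set of subgroups closed under conjugation and under passing to
subgroups. -/
structure Family (G : Type u) [Group G] where
  carrier : Set (Subgroup G)
  conj_mem : ∀ (g : G) (H : Subgroup G), H ∈ carrier → conjSubgroup g H ∈ carrier
  subgroup_mem : ∀ H K : Subgroup G, H ∈ carrier → K ≤ H → K ∈ carrier

instance (G : Type u) [Group G] : Membership (Subgroup G) (Family G) := ⟨fun F H => H ∈ F.carrier⟩

/-- A group is virtually cyclic if it has a cyclic subgroup of finite index. -/
def VirtuallyCyclic (H : Type u) [Group H] : Prop :=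
  ∃ C : Subgroup H, IsCyclic C ∧ C.FiniteIndex

theorem VirtuallyCyclic.of_injective {H K : Type u} [Group H] [Group K] (hH : VirtuallyCyclic H)
    (φ : K →* H) (hφ : Function.Injective φ) : VirtuallyCyclic K := by
  obtain ⟨C, hC, hfi⟩ := hH
  refine ⟨C.comap φ, ?_, ?_⟩
  · refine isCyclic_of_injective (φ.subgroupComap C) ?_
    intro x y hxy
    exact Subtype.ext (hφ (congrArg Subtype.val hxy))
  · constructor
    rw [Subgroup.index_comap]
    exact (inferInstance : (C.subgroupOf φ.range).FiniteIndex).index_ne_zero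

/-- The family consisting of the trivial subgroup. -/
def trivialFamily (G : Type u) [Group G] : Family G where
  carrier := {H | H = ⊥}
  conj_mem := by
    rintro g H rfl
    exact Subgroup.map_bot _
  subgroup_mem := by
    rintro H K rfl h
    exact le_bot_iff.1 h

/-- The family `FIN` of finite subgroups. -/
def finFamily (G : Type u) [Group G] : Family G where
  carrier := {H | Finite H}
  conj_mem := by
    intro g H h
    have : Finite H := h
    exact Finite.of_equiv H
      (H.equivMapOfInjective (MulAut.conj g).toMonoidHom (MulAut.conj g).injective).toEquiv
  subgroup_mem := by
    intro H K h hK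
    have : Finite H := h
    exact Finite.of_injective (Subgroup.inclusion hK) (Subgroup.inclusion_injective hK)

/-- The family `VCY` of virtually cyclic subgroups. -/
def vcyFamily (G : Type u) [Group G] : Family G where
  carrier := {H | VirtuallyCyclic H}
  conj_mem := by
    intro g H h
    let e := H.equivMapOfInjective (MulAut.conj g).toMonoidHom (MulAut.conj g).injective
    exact VirtuallyCyclic.of_injective (K := conjSubgroup g H) h e.symm.toMonoidHom
      e.symm.injective
  subgroup_mem := by
    intro H K h hK
    exact VirtuallyCyclic.of_injective (K := K) h (Subgroup.inclusion hK)
      (Subgroup.inclusion_injective hK)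

/-- `M` is a maximal element of `𝒢 \ ℱ`. -/
def IsMaximalIn {G : Type u} [Group G] (ℱ 𝒢 : Family G) (M : Subgroup G) : Prop :=
  Maximal (fun K : Subgroup G => K ∈ 𝒢 ∧ K ∉ ℱ) M

/-- The condition `(M_{ℱ ⊆ 𝒢})`: every `H ∈ 𝒢 \ ℱ` is contained in a unique maximal element of
`𝒢 \ ℱ`. -/
def ConditionM {G : Type u} [Group G] (ℱ 𝒢 : Family G) : Prop :=
  ∀ H : Subgroup G, H ∈ 𝒢 → H ∉ ℱ → ∃! M : Subgroup G, H ≤ M ∧ IsMaximalIn ℱ 𝒢 M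

/-- `ℳ` is a complete system of representatives of the conjugacy classes of the subgroups of `G`
satisfying the property `P`. -/
def IsConjugacySystem {G : Type u} [Group G] (P : Subgroup G → Prop) (ℳ : Set (Subgroup G)) :
    Prop :=
  (∀ M ∈ ℳ, P M) ∧
    ∀ H : Subgroup G, P H → ∃! M : Subgroup G, M ∈ ℳ ∧ ∃ g : G, conjSubgroup g H = M

/-- The normalizer `N_G H`. -/
abbrev NG {G : Type u} [Group G] (H : Subgroup G) : Subgroup G :=
  Subgroup.normalizer (H : Set G)

/-- The group `W_G H = N_G H / H`. -/
abbrev WG {G : Type u} [Group G] (H : Subgroup G) : Type u :=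
  NG H ⧸ H.subgroupOf (NG H)

/-- The projection `N_G H → W_G H`. -/
abbrev projWG {G : Type u} [Group G] (H : Subgroup G) : NG H →* WG H :=
  QuotientGroup.mk' (H.subgroupOf (NG H))

/-! ### `G`-CW-complexes for a discrete group `G` -/

/-- A CW structure on the whole space `X`. -/
abbrev CWStructure (X : Type u) [TopologicalSpace X] := CWComplex (univ : Set X)

/-- A `G`-CW-complex for the discrete group `G`: a Hausdorff space with a CW structure and a
continuous `G`-action such that translating the characteristic map of an `n`-cell by `g ∈ G` gives
the characteristic map of an `n`-cell. In particular `g` fixes pointwise every cell that it maps to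
itself, and the orbits of `n`-cells are equivariant cells `G/H × Dⁿ`. -/
class IsGCWComplex (G : Type u) [Group G] (X : Type u) [TopologicalSpace X] [MulAction G X]
    [CWStructure X] : Prop where
  t2 : T2Space X
  continuous_smul : ContinuousConstSMul G X
  exists_smul_cell : ∀ (g : G) (n : ℕ) (e : RelCWComplex.cell (univ : Set X) n),
    ∃ e' : RelCWComplex.cell (univ : Set X) n, ∀ x ∈ closedBall (0 : Fin n → ℝ) 1,
      RelCWComplex.map n e' x = g • (RelCWComplex.map n e x : X)

/-- Continuous `G`-equivariant maps. -/
structure GMap (G : Type u) [Group G] (X Y : Type u) [TopologicalSpace X] [MulAction G X]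
    [TopologicalSpace Y] [MulAction G Y] extends C(X, Y) where
  map_smul : ∀ (g : G) (x : X), toFun (g • x) = g • toFun x

instance {G : Type u} [Group G] {X Y : Type u} [TopologicalSpace X] [MulAction G X]
    [TopologicalSpace Y] [MulAction G Y] : CoeFun (GMap G X Y) (fun _ => X → Y) :=
  ⟨fun f => f.toFun⟩

/-- Two `G`-maps are `G`-homotopic. -/
def GHomotopic {G : Type u} [Group G] {X Y : Type u} [TopologicalSpace X] [MulAction G X]
    [TopologicalSpace Y] [MulAction G Y] (f₀ f₁ : GMap G X Y) : Prop :=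
  ∃ h : ContinuousMap.Homotopy f₀.toContinuousMap f₁.toContinuousMap,
    ∀ (t : unitInterval) (g : G) (x : X), h (t, g • x) = g • h (t, x)

/-- A map of CW complexes is cellular if it maps each `n`-skeleton into the `n`-skeleton. -/
def IsCellular {X Y : Type u} [TopologicalSpace X] [CWStructure X] [TopologicalSpace Y]
    [CWStructure Y] (f : X → Y) : Prop :=
  ∀ n : ℕ,
    MapsTo f (⋃ (m ≤ n) (e : RelCWComplex.cell (univ : Set X) m), RelCWComplex.closedCell m e)
      (⋃ (m ≤ n) (e : RelCWComplex.cell (univ : Set Y) m), RelCWComplex.closedCell m e)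

/-- `f` is the inclusion of a subcomplex: a closed embedding that maps every open `n`-cell onto
an open `n`-cell. -/
structure IsCWInclusion {X Y : Type u} [TopologicalSpace X] [CWStructure X] [TopologicalSpace Y]
    [CWStructure Y] (f : X → Y) : Prop where
  isClosedEmbedding : IsClosedEmbedding f
  exists_cell : ∀ (n : ℕ) (e : RelCWComplex.cell (univ : Set X) n),
    ∃ e' : RelCWComplex.cell (univ : Set Y) n,
      f '' RelCWComplex.openCell n e = RelCWComplex.openCell n e'

/-- The `G`-CW-complex `X` is a model for the classifying space `E_F(G)` of the family `F`: its
isotropy groups lie in `F`, and every `G`-CW-complex with isotropy groups in `F` admits precisely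
one `G`-map to `X` up to `G`-homotopy. -/
structure IsClassifyingSpace {G : Type u} [Group G] (F : Family G) (X : Type u)
    [TopologicalSpace X] [MulAction G X] [CWStructure X] : Prop where
  isGCWComplex : IsGCWComplex G X
  stabilizer_mem : ∀ x : X, MulAction.stabilizer G x ∈ F
  exists_map : ∀ (Y : Type u) [TopologicalSpace Y] [MulAction G Y] [CWStructure Y]
    [IsGCWComplex G Y], (∀ y : Y, MulAction.stabilizer G y ∈ F) → Nonempty (GMap G Y X)
  homotopic : ∀ (Y : Type u) [TopologicalSpace Y] [MulAction G Y] [CWStructure Y]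
    [IsGCWComplex G Y], (∀ y : Y, MulAction.stabilizer G y ∈ F) →
    ∀ f₀ f₁ : GMap G Y X, GHomotopic f₀ f₁

/-! ### Restriction along a homomorphism -/

/-- The `K`-space `Z`, regarded as an `H`-space by restriction along `φ : H → K`. -/
def Restrict {H K : Type u} [Group H] [Group K] (_φ : H →* K) (Z : Type u) : Type u := Z

instance {H K : Type u} [Group H] [Group K] (φ : H →* K) (Z : Type u) [TopologicalSpace Z] :
    TopologicalSpace (Restrict φ Z) := inferInstanceAs (TopologicalSpace Z)

instance {H K : Type u} [Group H] [Group K] (φ : H →* K) (Z : Type u) [MulAction K Z] :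
    MulAction H (Restrict φ Z) := MulAction.compHom Z φ

instance {H K : Type u} [Group H] [Group K] (φ : H →* K) (Z : Type u) [TopologicalSpace Z]
    [MulAction K Z] [ContinuousConstSMul K Z] : ContinuousConstSMul H (Restrict φ Z) :=
  ⟨fun h => continuous_const_smul (T := Z) (φ h)⟩

instance {H K : Type u} [Group H] [Group K] (φ : H →* K) (Z : Type u) [TopologicalSpace Z]
    [CWStructure Z] : CWStructure (Restrict φ Z) := inferInstanceAs (CWStructure Z)

/-! ### CW structures on coproducts and induced spaces -/

/-- If `T` is the coproduct of the spaces `Z j` along the embeddings `φ j`, then CW structures on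
the `Z j` give a CW structure on `T`; its cells are the images of the cells of the `Z j`. -/
abbrev cwOfCoproduct {T J : Type u} [TopologicalSpace T] (Z : J → Type u)
    [∀ j, TopologicalSpace (Z j)] [∀ j, CWStructure (Z j)] (φ : ∀ j, Z j → T)
    (hemb : ∀ j, IsEmbedding (φ j)) (hdisj : ∀ j j' z z', φ j z = φ j' z' → j = j')
    (hsurj : ∀ t, ∃ j z, φ j z = t)
    (htop : ∀ A : Set T, (∀ j, IsClosed (φ j ⁻¹' A)) → IsClosed A) : CWStructure T where
  cell n := Σ j, RelCWComplex.cell (univ : Set (Z j)) n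
  map n e :=
    haveI : Nonempty (Z e.1) := ⟨RelCWComplex.map n e.2 0⟩
    (RelCWComplex.map n e.2).trans ((hemb e.1).injective.injOn.toPartialEquiv (φ e.1) univ)
  source_eq n e := by
    change _ ∩ _ ⁻¹' univ = _
    rw [preimage_univ, inter_univ]
    exact RelCWComplex.source_eq n e.2
  continuousOn n e := (hemb e.1).continuous.comp_continuousOn (RelCWComplex.continuousOn n e.2)
  continuousOn_symm n e := by
    have : Nonempty (Z e.1) := ⟨RelCWComplex.map n e.2 0⟩
    refine ContinuousOn.comp (g := (RelCWComplex.map n e.2).symm)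
      (f := ((hemb e.1).injective.injOn.toPartialEquiv (φ e.1) univ).symm)
      (RelCWComplex.continuousOn_symm n e.2) ?_ (fun x hx => hx.2)
    rw [(hemb e.1).isInducing.continuousOn_iff]
    refine continuousOn_id.congr fun x hx => ?_
    exact ((hemb e.1).injective.injOn.toPartialEquiv (φ e.1) univ).right_inv hx.1
  pairwiseDisjoint' := by
    rintro ⟨n, j, e⟩ - ⟨m, j', e'⟩ - hne
    refine disjoint_left.2 ?_
    rintro _ ⟨x, hx, rfl⟩ ⟨y, hy, hxy⟩
    have hxy' : φ j' (RelCWComplex.map m e' y) = φ j (RelCWComplex.map n e x) := hxy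
    obtain rfl := hdisj _ _ _ _ hxy'
    have hne' : (⟨n, e⟩ : Σ n, RelCWComplex.cell (univ : Set (Z j')) n) ≠ ⟨m, e'⟩ := by
      rintro h
      apply hne
      cases h
      rfl
    exact disjoint_left.1 (RelCWComplex.disjoint_openCell_of_ne hne') ⟨x, hx, rfl⟩
      ⟨y, hy, (hemb j').injective hxy'⟩
  mapsTo' n e := by
    obtain ⟨I, hI⟩ := CWComplex.mapsTo n e.2
    refine ⟨fun m => (I m).map ⟨Sigma.mk e.1, sigma_mk_injective⟩, fun x hx => ?_⟩
    obtain ⟨m, hm, c, hc, y, hy, hyx⟩ := by simpa only [mem_iUnion, exists_prop] using hI hx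
    simp only [mem_iUnion, exists_prop]
    exact ⟨m, hm, ⟨e.1, c⟩, Finset.mem_map.2 ⟨c, hc, rfl⟩, y, hy, congrArg (φ e.1) hyx⟩
  closed' A _ h := by
    refine htop A fun j => CWComplex.closed' (C := univ) _ (subset_univ _) fun n c => ?_
    convert (h n ⟨j, c⟩).preimage (hemb j).continuous using 1
    ext z
    refine and_congr_right fun _ => ⟨?_, ?_⟩
    · rintro ⟨x, hx, rfl⟩
      exact ⟨x, hx, rfl⟩
    · rintro ⟨x, hx, hxz⟩
      exact ⟨x, hx, (hemb j).injective hxz⟩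
  union' := by
    refine eq_univ_of_forall fun t => ?_
    obtain ⟨j, z, rfl⟩ := hsurj t
    have hz : z ∈ ⋃ (n : ℕ) (c : RelCWComplex.cell (univ : Set (Z j)) n),
        RelCWComplex.closedCell n c := by
      rw [CWComplex.union]
      trivial
    obtain ⟨n, c, x, hx, rfl⟩ := by simpa only [mem_iUnion] using hz
    simp only [mem_iUnion]
    exact ⟨n, ⟨j, c⟩, x, hx, rfl⟩

/-- The CW structure on a coproduct of CW complexes. -/
instance {J : Type u} (Z : J → Type u) [∀ j, TopologicalSpace (Z j)] [∀ j, CWStructure (Z j)] :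
    CWStructure (Σ j, Z j) :=
  cwOfCoproduct Z (fun j z => ⟨j, z⟩) (fun _ => IsEmbedding.sigmaMk)
    (fun _ _ _ _ h => congrArg Sigma.fst h) (fun t => ⟨t.1, t.2, rfl⟩)
    (fun _ h => isClosed_sigma_iff.2 h)

/-- The equivalence relation `(g h, z) ∼ (g, h z)` on `G × Z`. -/
def inducedSetoid {G : Type u} [Group G] (H : Subgroup G) (Z : Type u) [MulAction H Z] :
    Setoid (G × Z) where
  r p q := ∃ h : H, p.1 = q.1 * h ∧ q.2 = h • p.2
  iseqv :=
    { refl := fun p => ⟨1, by simp⟩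
      symm := by
        rintro p q ⟨h, h₁, h₂⟩
        exact ⟨h⁻¹, by simp [h₁], by simp [h₂]⟩
      trans := by
        rintro p q r ⟨h, h₁, h₂⟩ ⟨k, k₁, k₂⟩
        exact ⟨k * h, by simp [h₁, k₁, mul_assoc], by simp [h₂, k₂, mul_smul]⟩ }

/-- The induced `G`-space `G ×_H Z` of an `H`-space `Z`. -/
def Induced {G : Type u} [Group G] (H : Subgroup G) (Z : Type u) [MulAction H Z] : Type u :=
  Quotient (inducedSetoid H Z)

/-- The class `[g, z]` in `G ×_H Z`. -/
def Induced.mk {G : Type u} [Group G] (H : Subgroup G) {Z : Type u} [MulAction H Z] (g : G)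
    (z : Z) : Induced H Z :=
  Quotient.mk (inducedSetoid H Z) (g, z)

theorem Induced.mk_eq_iff {G : Type u} [Group G] {H : Subgroup G} {Z : Type u} [MulAction H Z]
    {g g' : G} {z z' : Z} :
    Induced.mk H g z = Induced.mk H g' z' ↔ ∃ h : H, g = g' * h ∧ z' = h • z :=
  Quotient.eq (r := inducedSetoid H Z)

theorem Induced.exists_mk {G : Type u} [Group G] {H : Subgroup G} {Z : Type u} [MulAction H Z]
    (t : Induced H Z) : ∃ g z, Induced.mk H g z = t := by
  obtain ⟨⟨g, z⟩, rfl⟩ := Quotient.exists_rep t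
  exact ⟨g, z, rfl⟩

/-- The quotient topology of the product `G × Z`, where `G` is discrete. -/
instance {G : Type u} [Group G] (H : Subgroup G) (Z : Type u) [MulAction H Z]
    [TopologicalSpace Z] : TopologicalSpace (Induced H Z) :=
  letI : TopologicalSpace G := ⊥
  inferInstanceAs (TopologicalSpace (Quotient (inducedSetoid H Z)))

theorem Induced.isClosed_iff {G : Type u} [Group G] {H : Subgroup G} {Z : Type u} [MulAction H Z]
    [TopologicalSpace Z] {A : Set (Induced H Z)} :
    IsClosed A ↔ ∀ g : G, IsClosed (Induced.mk H g ⁻¹' A) := by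
  let _ : TopologicalSpace G := ⊥
  have : DiscreteTopology G := ⟨rfl⟩
  have h₁ : IsClosed A ↔ IsClosed (Quotient.mk (inducedSetoid H Z) ⁻¹' A) :=
    (isQuotientMap_quotient_mk' (s := inducedSetoid H Z)).isClosed_preimage.symm
  rw [h₁]
  constructor
  · intro h g
    exact h.preimage (Continuous.prodMk_right g)
  · intro h
    rw [← isOpen_compl_iff, isOpen_prod_iff]
    intro g z hgz
    refine ⟨{g}, (Induced.mk H g ⁻¹' A)ᶜ, isOpen_discrete _, (h g).isOpen_compl, rfl, hgz, ?_⟩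
    rintro ⟨g', z'⟩ ⟨rfl, hz'⟩
    exact hz'

/-- The action `g' [g, z] = [g' g, z]`. -/
instance {G : Type u} [Group G] (H : Subgroup G) (Z : Type u) [MulAction H Z] :
    MulAction G (Induced H Z) where
  smul g := Quotient.map' (fun p => (g * p.1, p.2)) (by
    rintro p q ⟨h, h₁, h₂⟩
    exact ⟨h, by simp [h₁, mul_assoc], h₂⟩)
  one_smul t := by
    obtain ⟨g, z, rfl⟩ := t.exists_mk
    exact congrArg (fun g => Induced.mk H g z) (one_mul g)
  mul_smul a b t := by
    obtain ⟨g, z, rfl⟩ := t.exists_mk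
    exact congrArg (fun g => Induced.mk H g z) (mul_assoc a b g)

theorem Induced.smul_mk {G : Type u} [Group G] {H : Subgroup G} {Z : Type u} [MulAction H Z]
    (g g' : G) (z : Z) : g' • Induced.mk H g z = Induced.mk H (g' * g) z := rfl

theorem Induced.isEmbedding_mk {G : Type u} [Group G] {H : Subgroup G} {Z : Type u}
    [MulAction H Z] [TopologicalSpace Z] [ContinuousConstSMul H Z] (g : G) :
    IsEmbedding (Induced.mk H g : Z → Induced H Z) := by
  refine (IsClosedEmbedding.of_continuous_injective_isClosedMap ?_ ?_ ?_).isEmbedding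
  · exact continuous_iff_isClosed.2 fun A hA => Induced.isClosed_iff.1 hA g
  · intro z z' hz
    obtain ⟨h, h₁, h₂⟩ := Induced.mk_eq_iff.1 hz
    have : h = 1 := by simpa using h₁
    simpa [this] using h₂.symm
  · intro A hA
    refine Induced.isClosed_iff.2 fun g' => ?_
    by_cases hg : ∃ h : H, g' = g * h
    · obtain ⟨h, rfl⟩ := hg
      convert hA.preimage (continuous_const_smul (T := Z) h) using 1
      ext z
      constructor
      · rintro ⟨a, ha, haz⟩
        obtain ⟨k, h₁, h₂⟩ := Induced.mk_eq_iff.1 haz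
        have hk : k = h⁻¹ := by
          apply Subtype.ext
          have h₃ : g * 1 = g * (h * k : G) := by rw [← mul_assoc, ← h₁, mul_one]
          rw [Subgroup.coe_inv]
          exact eq_inv_of_mul_eq_one_right (mul_left_cancel h₃).symm
        rw [mem_preimage, h₂, hk, smul_inv_smul]
        exact ha
      · intro hz
        exact ⟨h • z, hz, (Induced.mk_eq_iff.2 ⟨h, rfl, rfl⟩).symm⟩
    · convert isClosed_empty
      refine eq_empty_of_forall_notMem ?_
      rintro z ⟨a, _, haz⟩
      obtain ⟨k, h₁, -⟩ := Induced.mk_eq_iff.1 haz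
      exact hg ⟨k⁻¹, by simp [h₁]⟩

/-- The CW structure on `G ×_H Z`: its cells are the subspaces `[g, e]` for `g ∈ G` and `e` a cell
of `Z`. -/
instance {G : Type u} [Group G] (H : Subgroup G) (Z : Type u) [MulAction H Z]
    [TopologicalSpace Z] [CWStructure Z] [ContinuousConstSMul H Z] :
    CWStructure (Induced H Z) :=
  cwOfCoproduct (J := G ⧸ H) (fun _ => Z) (fun q z => Induced.mk H q.out z)
    (fun q => Induced.isEmbedding_mk q.out)
    (fun q q' _ _ h => by
      obtain ⟨k, h₁, -⟩ := Induced.mk_eq_iff.1 h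
      rw [← q.out_eq', ← q'.out_eq', h₁]
      exact QuotientGroup.mk_mul_of_mem _ k.2)
    (fun t => by
      obtain ⟨g, z, rfl⟩ := t.exists_mk
      obtain ⟨k, hk⟩ := QuotientGroup.mk_out_eq_mul H g
      exact ⟨g, k⁻¹ • z, Induced.mk_eq_iff.2 ⟨k, hk, by simp⟩⟩)
    (fun A h => Induced.isClosed_iff.2 fun g => by
      obtain ⟨k, hk⟩ := QuotientGroup.mk_out_eq_mul H g
      convert (h g).preimage (continuous_const_smul (T := Z) k⁻¹) using 1
      ext z
      have h₁ : Induced.mk H (g : G ⧸ H).out (k⁻¹ • z) = Induced.mk H g z :=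
        Induced.mk_eq_iff.2 ⟨k, hk, by simp⟩
      simp only [mem_preimage, h₁])

/-- The `G`-map `id_G ×_H f : G ×_H Z → G ×_H Z'` induced by an `H`-map `f`. -/
def Induced.map {G : Type u} [Group G] {H : Subgroup G} {Z Z' : Type u} [TopologicalSpace Z]
    [MulAction H Z] [TopologicalSpace Z'] [MulAction H Z'] (f : GMap H Z Z') :
    GMap G (Induced H Z) (Induced H Z') where
  toFun := Quotient.map' (fun p => (p.1, f p.2)) (by
    rintro p q ⟨h, h₁, h₂⟩
    exact ⟨h, h₁, by simp only [h₂, f.map_smul]⟩)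
  continuous_toFun := continuous_iff_isClosed.2 fun A hA => Induced.isClosed_iff.2 fun g =>
    (Induced.isClosed_iff.1 hA g).preimage f.continuous_toFun
  map_smul g t := by
    obtain ⟨g', z, rfl⟩ := t.exists_mk
    rfl

/-- The coproduct of a family of `G`-maps. -/
def sigmaMap {G : Type u} [Group G] {J : Type u} {A B : J → Type u}
    [∀ j, TopologicalSpace (A j)] [∀ j, MulAction G (A j)] [∀ j, TopologicalSpace (B j)]
    [∀ j, MulAction G (B j)] (f : ∀ j, GMap G (A j) (B j)) : GMap G (Σ j, A j) (Σ j, B j) where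
  toFun := Sigma.map id (fun j => f j)
  continuous_toFun := Continuous.sigma_map fun j => (f j).continuous_toFun
  map_smul := by
    rintro g ⟨j, a⟩
    simp [Sigma.map, Sigma.smul_mk, (f j).map_smul]

/-! ### `G`-pushouts -/

/-- The square of `G`-spaces with `top : A → E`, `left : A → B`, `right : E → X`,
`bottom : B → X` is a pushout in the category of `G`-spaces. -/
structure IsGPushout {G : Type u} [Group G] {A B E X : Type u}
    [TopologicalSpace A] [MulAction G A] [TopologicalSpace B] [MulAction G B]
    [TopologicalSpace E] [MulAction G E] [TopologicalSpace X] [MulAction G X]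
    (top : GMap G A E) (left : GMap G A B) (right : GMap G E X) (bottom : GMap G B X) :
    Prop where
  comm : ∀ a, right (top a) = bottom (left a)
  existsUnique_desc : ∀ (Z : Type u) [TopologicalSpace Z] [MulAction G Z]
    [ContinuousConstSMul G Z] (v : GMap G E Z) (w : GMap G B Z),
    (∀ a, v (top a) = w (left a)) →
      ∃! d : GMap G X Z, (∀ e, d (right e) = v e) ∧ ∀ b, d (bottom b) = w b

/-- A cellular `G`-pushout: the maps `top` and `left` starting from the left upper corner are
cellular and one of them is an inclusion of `G`-CW-complexes. -/
structure IsCellularGPushout {G : Type u} [Group G] {A B E X : Type u}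
    [TopologicalSpace A] [MulAction G A] [CWStructure A]
    [TopologicalSpace B] [MulAction G B] [CWStructure B]
    [TopologicalSpace E] [MulAction G E] [CWStructure E] [TopologicalSpace X] [MulAction G X]
    (top : GMap G A E) (left : GMap G A B) (right : GMap G E X) (bottom : GMap G B X) :
    Prop extends IsGPushout top left right bottom where
  cellular_top : IsCellular top
  cellular_left : IsCellular left
  inclusion : IsCWInclusion top ∨ IsCWInclusion left

end

end EquivariantCW

open EquivariantCW

namespace EquivariantCW

open Set Metric Topology

noncomputable section

open RelCWComplex

/-! ### Filling spheres -/

/-! A `G`-CW-complex `Z` with isotropy in a family `𝒢` is a model for its classifying space as soon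
as every fixed set `Z^H`, `H ∈ 𝒢`, is `Fillable`: maps into `Z` and homotopies between them are
built by induction over skeleta, one cell per orbit (`exists_equivariant_selection`,
`isClassifyingSpace_of_fillable`). Conversely, testing the universal property of a classifying space
`E` of `ℱ` on `G/H` and `G ×_H E` shows that `E` is `H`-contractible for `H ∈ ℱ`
(`IsClassifyingSpace.isGContractible`). It remains to inspect the fixed sets of the pushout.

Let `A` and `B` be the upper and lower left corners; both lie over the discrete `G`-set `J = ∐
G/N_GV`. Suppose first that the upper map `A → E` is an inclusion.

If `H ∈ 𝒢 \ ℱ`, then `E^H` is empty and `X^H = B^H`. A point `[g, x]` of `B` is fixed by `H` exactly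
when `g⁻¹Hg ≤ V`, and condition (M) determines `V` and the coset of `g`. So `B^H` is a single copy
of `EW_GV`, which is fillable (`fillable_fixedSet_sigma`).

If `H ∈ ℱ`, then over every point of `J` fixed by a subgroup `K ≤ H` the `K`-fixed sets of `A` and
of `B` are fillable. For `A` this is the universal property of the space over `N_GV`. For `B`, a
fixed point upstairs is sent by `f_V` to a fixed point of `EW_GV`; since `W_GV` acts freely there,
the group in question acts trivially on all of `EW_GV`. Hence `A` and `B` both deform
`H`-equivariantly over `J` to sections, and replacing `A` by `B` inside `E` keeps it
`H`-contractible (`IsAdjunctionSpace.isGContractible`).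

If instead the left map is an inclusion, then `V` fixes `f_V(x)`, hence `x`, so every `V ∈ ℳ` lies
in `ℱ` (`mem_of_injective_left`). In (b) this forces `ℳ = ∅`, and the upper map is an inclusion for
trivial reasons. In (a) it forces `G` to be torsion-free; then `J` is a point and the same pushout
argument applies with the roles of `E` and `B` exchanged. -/

/-- Every map from a sphere of any dimension `≥ -1` to `C` extends to the ball. -/
structure Fillable {Z : Type*} [TopologicalSpace Z] (C : Set Z) : Prop where
  nonempty : C.Nonempty
  exists_extension : ∀ (n : ℕ) (u : (Fin n → ℝ) → Z), ContinuousOn u (sphere 0 1) →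
    MapsTo u (sphere 0 1) C → ∃ v : (Fin n → ℝ) → Z, ContinuousOn v (closedBall 0 1) ∧
      MapsTo v (closedBall 0 1) C ∧ EqOn v u (sphere 0 1)

theorem Fillable.image {Z Z' : Type*} [TopologicalSpace Z] [TopologicalSpace Z'] {C : Set Z}
    (h : Fillable C) {φ : Z → Z'} (hφ : IsEmbedding φ) : Fillable (φ '' C) where
  nonempty := h.nonempty.image φ
  exists_extension n u hu hC := by
    obtain ⟨z₀, -⟩ := h.nonempty
    have : Nonempty Z := ⟨z₀⟩
    have hinv : ∀ x ∈ sphere (0 : Fin n → ℝ) 1,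
        Function.invFun φ (u x) ∈ C ∧ φ (Function.invFun φ (u x)) = u x := by
      intro x hx
      obtain ⟨z, hz, hzx⟩ := hC hx
      rw [← hzx, Function.leftInverse_invFun hφ.injective z]
      exact ⟨hz, rfl⟩
    obtain ⟨v, hv, hvC, hvu⟩ := h.exists_extension n (fun x => Function.invFun φ (u x))
      (hφ.isInducing.continuousOn_iff.2 (hu.congr fun x hx => (hinv x hx).2))
      (fun x hx => (hinv x hx).1)
    exact ⟨fun x => φ (v x), hφ.continuous.comp_continuousOn hv,
      fun x hx => ⟨_, hvC hx, rfl⟩, fun x hx => (congrArg φ (hvu hx)).trans (hinv x hx).2⟩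

/-- A family of paths, continuous in the parameter, given by a map continuous on a product. -/
theorem exists_continuousOn_curry {W Z : Type*} [TopologicalSpace W] [TopologicalSpace Z]
    {S : Set W} (F : W × unitInterval → Z) (hF : ContinuousOn F (S ×ˢ univ))
    (hS : S.Nonempty) :
    ∃ Γ : W → C(unitInterval, Z), ContinuousOn Γ S ∧ ∀ x ∈ S, ∀ t, Γ x t = F (x, t) := by
  classical
  obtain ⟨w₀, hw₀⟩ := hS
  have hcont : Continuous fun p : S × unitInterval => F (p.1, p.2) :=
    hF.comp_continuous (by fun_prop) fun p => ⟨p.1.2, trivial⟩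
  let Γ₀ : C(S, C(unitInterval, Z)) := ContinuousMap.curry ⟨_, hcont⟩
  -- Off `S` the path is irrelevant; the point `w₀` only supplies a default value.
  refine ⟨fun x => if hx : x ∈ S then Γ₀ ⟨x, hx⟩ else Γ₀ ⟨w₀, hw₀⟩, ?_, ?_⟩
  · rw [continuousOn_iff_continuous_domRestrict]
    convert Γ₀.continuous using 1
    ext1 x
    simp
  · intro x hx t
    simp [hx, Γ₀]

theorem continuousOn_uncurry_path {W Z : Type*} [TopologicalSpace W] [TopologicalSpace Z]
    {S : Set W} {Γ : W → C(unitInterval, Z)} (hΓ : ContinuousOn Γ S) :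
    ContinuousOn (fun p : W × unitInterval => Γ p.1 p.2) (S ×ˢ univ) := by
  have h1 : ContinuousOn (fun p : W × unitInterval => Γ p.1) (S ×ˢ univ) :=
    hΓ.comp continuousOn_fst fun p hp => hp.1
  exact fun p hp => (h1 p hp).eval continuousWithinAt_snd

/-- The homotopy extension property of the ball and its boundary sphere, with values in a given
set. -/
theorem exists_ball_homotopy_extension {Z : Type*} [TopologicalSpace Z] {n : ℕ} (C : Set Z)
    (f : (Fin n → ℝ) → Z) (hf : ContinuousOn f (closedBall 0 1)) (hfC : MapsTo f (closedBall 0 1) C)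
    (H : (Fin n → ℝ) → C(unitInterval, Z)) (hH : ContinuousOn H (sphere 0 1))
    (hHC : ∀ x ∈ sphere (0 : Fin n → ℝ) 1, ∀ t, H x t ∈ C)
    (hH0 : ∀ x ∈ sphere (0 : Fin n → ℝ) 1, H x 0 = f x) :
    ∃ F : (Fin n → ℝ) → C(unitInterval, Z), ContinuousOn F (closedBall 0 1) ∧
      (∀ x ∈ closedBall (0 : Fin n → ℝ) 1, F x 0 = f x) ∧
      (∀ x ∈ closedBall (0 : Fin n → ℝ) 1, ∀ t, F x t ∈ C) ∧ EqOn F H (sphere 0 1) := by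
  classical
  let V := Fin n → ℝ
  -- Retraction of ball × interval onto bottom and side by projection from the point `(0, 2)`. The
  -- line through `(x, t)` meets the bottom at `inner` if `2‖x‖ ≤ 2 - t`, and otherwise meets the
  -- side at `outer` and height `time`.
  let inner : V × unitInterval → V := fun p => (2 / (2 - (p.2 : ℝ))) • p.1
  let outer : V × unitInterval → V := fun p => ‖p.1‖⁻¹ • p.1
  let time : V × unitInterval → unitInterval := fun p =>
    Set.projIcc 0 1 zero_le_one (2 - (2 - (p.2 : ℝ)) / ‖p.1‖)
  let T₁ : Set (V × unitInterval) := {p | 2 * ‖p.1‖ ≤ 2 - (p.2 : ℝ)} ∩ closedBall 0 1 ×ˢ univ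
  let T₂ : Set (V × unitInterval) := {p | 2 - (p.2 : ℝ) ≤ 2 * ‖p.1‖} ∩ closedBall 0 1 ×ˢ univ
  have hpos : ∀ p : V × unitInterval, 0 < 2 - (p.2 : ℝ) := fun p => by linarith [p.2.2.2]
  have hpos₂ : ∀ p ∈ T₂, 0 < ‖p.1‖ := fun p hp => by
    have h1 : 2 - (p.2 : ℝ) ≤ 2 * ‖p.1‖ := hp.1
    linarith [hpos p]
  have hin : MapsTo inner T₁ (closedBall 0 1) := by
    intro p hp
    have h1 : 2 * ‖p.1‖ ≤ 2 - (p.2 : ℝ) := hp.1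
    have h2 := hpos p
    rw [mem_closedBall_zero_iff, norm_smul, Real.norm_of_nonneg (by positivity), div_mul_eq_mul_div,
      div_le_one h2]
    exact h1
  have hout : MapsTo outer T₂ (sphere 0 1) := by
    intro p hp
    have h2 := hpos₂ p hp
    rw [mem_sphere_zero_iff_norm, norm_smul, norm_inv, norm_norm, inv_mul_cancel₀ h2.ne']
  let F₀ : V × unitInterval → Z := fun p =>
    if 2 * ‖p.1‖ ≤ 2 - (p.2 : ℝ) then f (inner p) else H (outer p) (time p)
  have hF₁ : EqOn F₀ (fun p => f (inner p)) T₁ := fun p hp => if_pos hp.1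
  have hF₂ : EqOn F₀ (fun p => H (outer p) (time p)) T₂ := by
    intro p hp
    by_cases h : 2 * ‖p.1‖ ≤ 2 - (p.2 : ℝ)
    · have h1 : 2 - (p.2 : ℝ) = 2 * ‖p.1‖ := le_antisymm hp.1 h
      have h2 := hpos₂ p hp
      have h3 : time p = 0 := by
        have h4 : (2 * ‖p.1‖) / ‖p.1‖ = 2 := by field_simp
        simp only [time, h1, h4, sub_self]
        exact Set.projIcc_left zero_le_one
      have h5 : inner p = outer p := by
        simp only [inner, outer, h1]
        congr 1
        field_simp
      change ite _ _ _ = _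
      simp only [if_pos h, h3, hH0 _ (hout hp), h5]
    · exact if_neg h
  have hcov : closedBall (0 : V) 1 ×ˢ (univ : Set unitInterval) = T₁ ∪ T₂ := by
    rw [← union_inter_distrib_right]
    refine (inter_eq_right.2 fun p _ => ?_).symm
    exact le_total (2 * ‖p.1‖) (2 - (p.2 : ℝ))
  have hcl : IsClosed (closedBall (0 : V) 1 ×ˢ (univ : Set unitInterval)) :=
    isClosed_closedBall.prod isClosed_univ
  have hT₁ : IsClosed T₁ := (isClosed_le (by fun_prop) (by fun_prop)).inter hcl
  have hT₂ : IsClosed T₂ := (isClosed_le (by fun_prop) (by fun_prop)).inter hcl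
  have hcont : ContinuousOn F₀ (closedBall 0 1 ×ˢ univ) := by
    rw [hcov]
    refine ContinuousOn.union_of_isClosed ?_ ?_ hT₁ hT₂
    · refine ContinuousOn.congr (hf.comp ?_ hin) hF₁
      refine Continuous.continuousOn ?_
      refine Continuous.smul (continuous_const.div (by fun_prop) fun p => (hpos p).ne') (by fun_prop)
    · refine ContinuousOn.congr ?_ hF₂
      have h1 : ContinuousOn outer T₂ :=
        ContinuousOn.smul (ContinuousOn.inv₀ (by fun_prop) fun p hp => (hpos₂ p hp).ne')
          (by fun_prop)
      have h2 : ContinuousOn time T₂ :=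
        continuous_projIcc.comp_continuousOn
          (continuousOn_const.sub (ContinuousOn.div (by fun_prop) (by fun_prop)
            fun p hp => (hpos₂ p hp).ne'))
      exact (continuousOn_uncurry_path hH).comp (h1.prodMk h2) fun p hp => ⟨hout hp, trivial⟩
  obtain ⟨F, hF, hFF⟩ := exists_continuousOn_curry F₀ hcont ⟨0, by simp⟩
  refine ⟨F, hF, ?_, ?_, ?_⟩
  · intro x hx
    have hx' : ‖x‖ ≤ 1 := by simpa using hx
    rw [hFF x hx, hF₁ ⟨?_, hx, trivial⟩]
    · simp [inner]
    · simpa using hx'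
  · intro x hx t
    rw [hFF x hx]
    have hm : (x, t) ∈ T₁ ∪ T₂ := hcov ▸ ⟨hx, trivial⟩
    rcases hm with h | h
    · rw [hF₁ h]
      exact hfC (hin h)
    · rw [hF₂ h]
      exact hHC _ (hout h) _
  · intro x hx
    have hx' : ‖x‖ = 1 := by simpa using hx
    ext t
    rw [hFF x (sphere_subset_closedBall hx), hF₂ ⟨?_, sphere_subset_closedBall hx, trivial⟩]
    · simp only [outer, time, hx', inv_one, one_smul, div_one, sub_sub_cancel]
      rw [Set.projIcc_of_mem _ t.2]
    · simp only [mem_ofPred_eq, hx']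
      linarith [t.2.1]

/-- A set all of whose points can be contracted within the set to one point is fillable. -/
theorem fillable_of_contraction {Z : Type*} [TopologicalSpace Z] {C : Set Z} {z₀ : Z}
    (hz₀ : z₀ ∈ C) (h : Z → C(unitInterval, Z)) (hh : Continuous h) (h0 : ∀ z, h z 0 = z₀)
    (h1 : ∀ z, h z 1 = z) (hC : ∀ z ∈ C, ∀ t, h z t ∈ C) : Fillable C where
  nonempty := ⟨z₀, hz₀⟩
  exists_extension n u hu huC := by
    -- Start with the constant map at `z₀` on the ball and move it along the contraction over the
    -- sphere; the end of the extended homotopy fills `u`.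
    obtain ⟨F, hF, -, hFC, hFu⟩ := exists_ball_homotopy_extension C (fun _ : Fin n → ℝ => z₀)
      continuousOn_const (fun _ _ => hz₀) (fun x => h (u x)) (hh.comp_continuousOn hu)
      (fun x hx => hC _ (huC hx)) (fun x _ => h0 _)
    refine ⟨fun x => F x 1, fun x hx => (hF x hx).eval continuousWithinAt_const, fun x hx => hFC x hx 1,
      fun x hx => ?_⟩
    simp only [hFu hx, h1]

/-- Paths over the boundary sphere between the values of two maps on a ball extend to paths over the
ball, in a fillable set. -/
theorem Fillable.exists_path_extension {Z : Type*} [TopologicalSpace Z] {C : Set Z}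
    (hC : Fillable C) {n : ℕ} (f₀ f₁ : (Fin n → ℝ) → Z) (hf₀ : ContinuousOn f₀ (closedBall 0 1))
    (hf₁ : ContinuousOn f₁ (closedBall 0 1)) (hf₀C : MapsTo f₀ (closedBall 0 1) C)
    (hf₁C : MapsTo f₁ (closedBall 0 1) C)
    (H : (Fin n → ℝ) → C(unitInterval, Z)) (hH : ContinuousOn H (sphere 0 1))
    (hHC : ∀ x ∈ sphere (0 : Fin n → ℝ) 1, ∀ t, H x t ∈ C)
    (hH0 : ∀ x ∈ sphere (0 : Fin n → ℝ) 1, H x 0 = f₀ x)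
    (hH1 : ∀ x ∈ sphere (0 : Fin n → ℝ) 1, H x 1 = f₁ x) :
    ∃ F : (Fin n → ℝ) → C(unitInterval, Z), ContinuousOn F (closedBall 0 1) ∧
      (∀ x ∈ closedBall (0 : Fin n → ℝ) 1, F x 0 = f₀ x) ∧
      (∀ x ∈ closedBall (0 : Fin n → ℝ) 1, F x 1 = f₁ x) ∧
      (∀ x ∈ closedBall (0 : Fin n → ℝ) 1, ∀ t, F x t ∈ C) ∧ EqOn F H (sphere 0 1) := by
  classical
  -- In the sup norm, ball × interval is the ball of one dimension more, with coordinate `0` equal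
  -- to `2t - 1`. Its boundary consists of the bottom `T₀`, the top `T₁` and the side `T₂`, on which
  -- `f₀`, `f₁` and `H` are prescribed; filling this sphere gives the paths.
  let W := Fin (n + 1) → ℝ
  let time : W → unitInterval := fun y => Set.projIcc 0 1 zero_le_one ((1 + y 0) / 2)
  have htime : Continuous time := continuous_projIcc.comp (by fun_prop)
  have htail : Continuous fun y : W => Fin.tail y := by
    unfold Fin.tail
    fun_prop
  let B : Set W := {y | Fin.tail y ∈ closedBall (0 : Fin n → ℝ) 1}
  have hB : IsClosed B := isClosed_closedBall.preimage htail
  let T₀ : Set W := {y | y 0 = -1} ∩ B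
  let T₁ : Set W := {y | y 0 = 1} ∩ B
  let T₂ : Set W := {y | Fin.tail y ∈ sphere (0 : Fin n → ℝ) 1}
  have hT₀ : IsClosed T₀ := (isClosed_eq (by fun_prop) (by fun_prop)).inter hB
  have hT₁ : IsClosed T₁ := (isClosed_eq (by fun_prop) (by fun_prop)).inter hB
  have hT₂ : IsClosed T₂ := isClosed_sphere.preimage htail
  let u : W → Z := fun y => if y 0 = -1 then f₀ (Fin.tail y) else if y 0 = 1 then f₁ (Fin.tail y)
    else H (Fin.tail y) (time y)
  have htime0 : ∀ y : W, y 0 = -1 → time y = 0 := by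
    intro y hy
    simp only [time, hy]
    norm_num
  have htime1 : ∀ y : W, y 0 = 1 → time y = 1 := by
    intro y hy
    simp only [time, hy]
    norm_num
  have hu₀ : EqOn u (fun y => f₀ (Fin.tail y)) T₀ := fun y hy => if_pos hy.1
  have hu₁ : EqOn u (fun y => f₁ (Fin.tail y)) T₁ := fun y hy => by
    have h1 : y 0 = 1 := hy.1
    have h2 : ¬ y 0 = -1 := by rw [h1]; norm_num
    simp only [u, if_neg h2, if_pos h1]
  have hu₂ : EqOn u (fun y => H (Fin.tail y) (time y)) T₂ := fun y hy => by
    simp only [u]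
    split_ifs with h1 h2
    · rw [htime0 y h1, hH0 _ hy]
    · rw [htime1 y h2, hH1 _ hy]
    · rfl
  have hsph : sphere (0 : W) 1 ⊆ T₀ ∪ T₁ ∪ T₂ := by
    intro y hy
    have hy' : ‖y‖ = 1 := by simpa using hy
    have hall : ∀ i, |y i| ≤ 1 := fun i => hy' ▸ norm_le_pi_norm y i
    have hyB : y ∈ B := by
      change Fin.tail y ∈ closedBall 0 1
      rw [mem_closedBall_zero_iff, pi_norm_le_iff_of_nonneg zero_le_one]
      exact fun i => hall i.succ
    by_cases h0 : |y 0| = 1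
    · rcases eq_or_eq_neg_of_abs_eq h0 with h | h
      · exact Or.inl (Or.inr ⟨h, hyB⟩)
      · exact Or.inl (Or.inl ⟨h, hyB⟩)
    · refine Or.inr ?_
      change Fin.tail y ∈ sphere 0 1
      rw [mem_sphere_zero_iff_norm]
      refine le_antisymm (by simpa [B] using hyB) ?_
      by_contra hlt
      push Not at hlt
      have : ‖y‖ < 1 := by
        rw [pi_norm_lt_iff one_pos]
        refine Fin.cases (lt_of_le_of_ne (hall 0) h0) fun i => ?_
        exact (norm_le_pi_norm (Fin.tail y) i).trans_lt hlt
      exact this.ne hy'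
  have hucont : ContinuousOn u (T₀ ∪ T₁ ∪ T₂) := by
    refine ContinuousOn.union_of_isClosed (ContinuousOn.union_of_isClosed ?_ ?_ hT₀ hT₁) ?_
      (hT₀.union hT₁) hT₂
    · exact (hf₀.comp htail.continuousOn fun y hy => hy.2).congr hu₀
    · exact (hf₁.comp htail.continuousOn fun y hy => hy.2).congr hu₁
    · refine ContinuousOn.congr ?_ hu₂
      exact (continuousOn_uncurry_path hH).comp (htail.continuousOn.prodMk htime.continuousOn)
        fun y hy => ⟨hy, trivial⟩
  have huC : MapsTo u (T₀ ∪ T₁ ∪ T₂) C := by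
    rintro y ((hy | hy) | hy)
    · rw [hu₀ hy]
      exact hf₀C hy.2
    · rw [hu₁ hy]
      exact hf₁C hy.2
    · rw [hu₂ hy]
      exact hHC _ hy _
  obtain ⟨v, hv, hvC, hvu⟩ := hC.exists_extension (n + 1) u (hucont.mono hsph)
    (huC.mono_left hsph)
  let c : (Fin n → ℝ) × unitInterval → W := fun p => Fin.cons (2 * (p.2 : ℝ) - 1) p.1
  have hc : Continuous c := by
    refine continuous_pi fun i => ?_
    refine Fin.cases ?_ (fun i => ?_) i
    · simp only [c, Fin.cons_zero]
      fun_prop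
    · simp only [c, Fin.cons_succ]
      fun_prop
  have habs : ∀ t : unitInterval, |2 * (t : ℝ) - 1| ≤ 1 := fun t =>
    abs_le.2 ⟨by linarith [t.2.1], by linarith [t.2.2]⟩
  have hcB : MapsTo c (closedBall 0 1 ×ˢ univ) (closedBall 0 1) := by
    rintro ⟨x, t⟩ ⟨hx, -⟩
    have hx' : ‖x‖ ≤ 1 := by simpa using hx
    rw [mem_closedBall_zero_iff, pi_norm_le_iff_of_nonneg zero_le_one]
    refine Fin.cases ?_ fun i => ?_
    · simpa [c] using habs t
    · simpa only [c, Fin.cons_succ] using (norm_le_pi_norm x i).trans hx'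
  have hcS : ∀ x ∈ closedBall (0 : Fin n → ℝ) 1, ∀ t : unitInterval, (|2 * (t : ℝ) - 1| = 1 ∨ ‖x‖ = 1) →
      c (x, t) ∈ sphere (0 : W) 1 := by
    intro x hx t h
    rw [mem_sphere_zero_iff_norm]
    refine le_antisymm (by simpa using hcB (show (x, t) ∈ closedBall 0 1 ×ˢ univ from ⟨hx, trivial⟩)) ?_
    rcases h with h | h
    · have := norm_le_pi_norm (c (x, t)) 0
      simpa [c, h] using this
    · rw [← h, pi_norm_le_iff_of_nonneg (norm_nonneg _)]
      intro i
      have := norm_le_pi_norm (c (x, t)) i.succ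
      simpa only [c, Fin.cons_succ] using this
  obtain ⟨F, hF, hFF⟩ := exists_continuousOn_curry (fun p => v (c p))
    (hv.comp hc.continuousOn hcB) ⟨0, by simp⟩
  refine ⟨F, hF, ?_, ?_, ?_, ?_⟩
  · intro x hx
    rw [hFF x hx]
    rw [hvu (hcS x hx 0 (by norm_num)), hu₀ ⟨by simp [c], ?_⟩]
    · simp [c]
    · simpa [B, c] using hx
  · intro x hx
    rw [hFF x hx]
    rw [hvu (hcS x hx 1 (by norm_num)), hu₁ ⟨by simp [c]; norm_num, ?_⟩]
    · simp [c]
    · simpa [B, c] using hx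
  · intro x hx t
    rw [hFF x hx]
    exact hvC (hcB ⟨hx, trivial⟩)
  · intro x hx
    ext t
    have hx' : ‖x‖ = 1 := by simpa using hx
    rw [hFF x (sphere_subset_closedBall hx)]
    change v (c (x, t)) = _
    rw [hvu (hcS x (sphere_subset_closedBall hx) t (Or.inr hx')), hu₂ (by simpa [T₂, c] using hx')]
    have h1 : time (c (x, t)) = t := by
      have : (1 + (2 * (t : ℝ) - 1)) / 2 = t := by ring
      simp only [time, c, Fin.cons_zero, this]
      exact Set.projIcc_of_mem _ t.2
    simp only [h1]
    simp [c]

/-! ### Cells -/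

/-- The `n`-cells of a CW complex. -/
abbrev Cell (X : Type u) [TopologicalSpace X] [CWStructure X] (n : ℕ) : Type u :=
  cell (univ : Set X) n

section Cells

variable {X : Type u} [TopologicalSpace X] [CWStructure X]

theorem exists_mem_openCell (x : X) : ∃ (n : ℕ) (e : Cell X n), x ∈ openCell n e := by
  have h : x ∈ ⋃ (n : ℕ) (e : Cell X n), openCell n e := by
    rw [CWComplex.iUnion_openCell_eq_complex]
    trivial
  simpa only [mem_iUnion] using h

theorem sigma_eq_of_mem_openCell {n m : ℕ} {e : Cell X n} {e' : Cell X m} {x : X}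
    (h : x ∈ openCell n e) (h' : x ∈ openCell m e') :
    (⟨n, e⟩ : Σ n, Cell X n) = ⟨m, e'⟩ :=
  eq_of_not_disjoint_openCell (not_disjoint_iff.2 ⟨x, h, h'⟩)

theorem eq_of_mem_openCell {n : ℕ} {e e' : Cell X n} {x : X}
    (h : x ∈ openCell n e) (h' : x ∈ openCell n e') : e = e' :=
  eq_of_heq (Sigma.mk.inj (sigma_eq_of_mem_openCell h h')).2

theorem injOn_map {n : ℕ} (e : Cell X n) : InjOn (map n e) (ball 0 1) := by
  rw [← source_eq n e]
  exact (map n e).injOn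

theorem map_mem_closedCell {n : ℕ} (e : Cell X n) {x : Fin n → ℝ} (hx : x ∈ closedBall 0 1) :
    map n e x ∈ closedCell n e := ⟨x, hx, rfl⟩

theorem map_mem_openCell {n : ℕ} (e : Cell X n) {x : Fin n → ℝ} (hx : x ∈ ball 0 1) :
    map n e x ∈ openCell n e := ⟨x, hx, rfl⟩

variable (X) in
/-- The union of the open cells of dimension less than `n`. -/
def cellsLT (n : ℕ) : Set X := {x | ∃ m < n, ∃ e : Cell X m, x ∈ openCell m e}

theorem cellFrontier_subset_cellsLT {n : ℕ} (e : Cell X n) : cellFrontier n e ⊆ cellsLT X n := by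
  obtain ⟨I, hI⟩ := CWComplex.cellFrontier_subset_finite_openCell n e
  intro x hx
  obtain ⟨m, hm, c, -, hc⟩ := by simpa only [mem_iUnion, exists_prop] using hI hx
  exact ⟨m, hm, c, hc⟩

theorem map_mem_cellsLT {n : ℕ} (e : Cell X n) {x : Fin n → ℝ} (hx : x ∈ sphere 0 1) :
    map n e x ∈ cellsLT X n :=
  cellFrontier_subset_cellsLT e ⟨x, hx, rfl⟩

theorem cellsLT_mono {n m : ℕ} (h : n ≤ m) : cellsLT X n ⊆ cellsLT X m :=
  fun _ ⟨k, hk, e, he⟩ => ⟨k, hk.trans_le h, e, he⟩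

theorem notMem_cellsLT {n : ℕ} (e : Cell X n) {x : X} (hx : x ∈ openCell n e) :
    x ∉ cellsLT X n := by
  rintro ⟨m, hm, e', he'⟩
  exact hm.ne (congrArg Sigma.fst (sigma_eq_of_mem_openCell he' hx))

theorem closedCell_subset_cellsLT {n m : ℕ} (h : m < n) (e : Cell X m) :
    closedCell m e ⊆ cellsLT X n := by
  rw [← cellFrontier_union_openCell_eq_closedCell]
  exact union_subset ((cellFrontier_subset_cellsLT e).trans (cellsLT_mono h.le))
    fun x hx => ⟨m, h, e, hx⟩

variable [T2Space X]

theorem isClosed_of_forall_closedCell {A : Set X}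
    (h : ∀ n (e : Cell X n), IsClosed (A ∩ closedCell n e)) : IsClosed A :=
  (CWComplex.closed univ A (subset_univ A)).2 h

/-- The closed cell carries the quotient topology of the ball, because the characteristic map goes
from a compact space to a Hausdorff space. -/
theorem continuousOn_closedCell {Z : Type*} [TopologicalSpace Z] {n : ℕ} (e : Cell X n)
    {u : X → Z} (h : ContinuousOn (fun x => u (map n e x)) (closedBall 0 1)) :
    ContinuousOn u (closedCell n e) := by
  refine continuousOn_iff_isClosed.2 fun S hS => ?_
  obtain ⟨T, hT, hTS⟩ := continuousOn_iff_isClosed.1 h S hS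
  refine ⟨map n e '' (T ∩ closedBall 0 1), ?_, ?_⟩
  · exact (((isCompact_closedBall _ _).inter_left hT).image_of_continuousOn
      ((RelCWComplex.continuousOn n e).mono inter_subset_right)).isClosed
  · rw [← hTS]
    ext y
    constructor
    · rintro ⟨hy, x, hx, rfl⟩
      exact ⟨⟨x, ⟨hy, hx⟩, rfl⟩, x, hx, rfl⟩
    · rintro ⟨⟨x, ⟨hy, hx⟩, rfl⟩, -⟩
      exact ⟨hy, x, hx, rfl⟩

theorem continuous_of_closedCell {Z : Type*} [TopologicalSpace Z] {u : X → Z}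
    (h : ∀ n (e : Cell X n), ContinuousOn u (closedCell n e)) : Continuous u := by
  refine continuous_iff_isClosed.2 fun S hS => isClosed_of_forall_closedCell fun n e => ?_
  obtain ⟨T, hT, hTS⟩ := continuousOn_iff_isClosed.1 (h n e) S hS
  rw [hTS]
  exact hT.inter isClosed_closedCell

/-- The frontier lies in finitely many closed cells of smaller dimension, so the pasting lemma for
finite closed covers applies. -/
theorem continuousOn_cellFrontier {Z : Type*} [TopologicalSpace Z] {n : ℕ} (e : Cell X n)
    {u : X → Z} (h : ∀ m < n, ∀ e' : Cell X m, ContinuousOn u (closedCell m e')) :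
    ContinuousOn u (cellFrontier n e) := by
  obtain ⟨I, hI⟩ := CWComplex.cellFrontier_subset_finite_closedCell n e
  have hfin : ContinuousOn u (⋃ c : Σ m : Fin n, I m, closedCell (c.1 : ℕ) (c.2 : Cell X c.1)) :=
    (locallyFinite_of_finite _).continuousOn_iUnion (fun c => isClosed_closedCell)
      fun c => h c.1 c.1.2 c.2
  refine hfin.mono fun x hx => ?_
  obtain ⟨m, hm, c, hcI, hc⟩ := by simpa only [mem_iUnion, exists_prop] using hI hx
  exact mem_iUnion.2 ⟨⟨⟨m, hm⟩, ⟨c, hcI⟩⟩, hc⟩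

end Cells

theorem IsGCWComplex.t2Space (G : Type u) [Group G] (X : Type u) [TopologicalSpace X]
    [MulAction G X] [CWStructure X] [h : IsGCWComplex G X] : T2Space X := h.t2

/-! ### The action on the cells -/

section Action

variable {G : Type u} [Group G] {X : Type u} [TopologicalSpace X] [MulAction G X] [CWStructure X]
  [IsGCWComplex G X]

/-- The translate of a cell by a group element. -/
def smulCell (g : G) {n : ℕ} (e : Cell X n) : Cell X n :=
  (IsGCWComplex.exists_smul_cell g n e).choose

theorem map_smulCell (g : G) {n : ℕ} (e : Cell X n) {x : Fin n → ℝ} (hx : x ∈ closedBall 0 1) :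
    map n (smulCell g e) x = g • map n e x :=
  (IsGCWComplex.exists_smul_cell g n e).choose_spec x hx

theorem smul_mem_openCell (g : G) {n : ℕ} {e : Cell X n} {x : X} (h : x ∈ openCell n e) :
    g • x ∈ openCell n (smulCell g e) := by
  obtain ⟨y, hy, rfl⟩ := h
  exact ⟨y, hy, map_smulCell g e (ball_subset_closedBall hy)⟩

variable (G X) in
/-- The action on the set of `n`-cells. -/
@[reducible]
def cellAction (n : ℕ) : MulAction G (Cell X n) where
  smul g e := smulCell g e
  one_smul e := by
    refine eq_of_mem_openCell (smul_mem_openCell (1 : G) (map_zero_mem_openCell n e)) ?_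
    rw [one_smul]
    exact map_zero_mem_openCell n e
  mul_smul g h e := by
    refine eq_of_mem_openCell (smul_mem_openCell (g * h) (map_zero_mem_openCell n e)) ?_
    rw [mul_smul]
    exact smul_mem_openCell g (smul_mem_openCell h (map_zero_mem_openCell n e))

theorem smulCell_eq_self {g : G} {n : ℕ} {e : Cell X n} {x : X} (hx : x ∈ openCell n e)
    (hg : g • x = x) : smulCell g e = e :=
  eq_of_mem_openCell (hg ▸ smul_mem_openCell g hx) hx

/-- Cells are translated together with their characteristic maps. Consequently the stabilizer of the
centre `map n e 0` fixes the whole closed cell, and the later conditions on a cell need to mention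
only this stabilizer. -/
theorem smul_map_of_smulCell_eq {g : G} {n : ℕ} {e : Cell X n} (h : smulCell g e = e)
    {x : Fin n → ℝ} (hx : x ∈ closedBall 0 1) : g • map n e x = map n e x := by
  rw [← map_smulCell g e hx, h]

theorem smul_mem_cellsLT (g : G) {n : ℕ} {x : X} (h : x ∈ cellsLT X n) : g • x ∈ cellsLT X n := by
  obtain ⟨m, hm, e, he⟩ := h
  exact ⟨m, hm, smulCell g e, smul_mem_openCell g he⟩

end Action

/-- Choosing elements equivariantly. -/
theorem exists_equivariant_choice {G J W : Type*} [Group G] [MulAction G J] [MulAction G W]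
    (S : J → Set W) (hS : ∀ (g : G) z w, w ∈ S z → g • w ∈ S (g • z))
    (h : ∀ z, ∃ w ∈ S z, ∀ g : G, g • z = z → g • w = w) :
    ∃ σ : J → W, (∀ z, σ z ∈ S z) ∧ ∀ (g : G) z, σ (g • z) = g • σ z := by
  choose w hw hfix using h
  let q : J → MulAction.orbitRel.Quotient G J := fun z => Quotient.mk'' z
  let r : J → J := fun z => (q z).out
  have hr : ∀ z, ∃ g : G, g • r z = z := by
    intro z
    have h1 : (MulAction.orbitRel G J).r z (r z) := by
      refine Quotient.exact ?_
      exact (Quotient.out_eq (q z)).symm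
    exact h1
  choose γ hγ using hr
  -- The choice at the orbit representative is transported; it does not depend on the transporting
  -- element because the chosen value is fixed by the stabilizer.
  refine ⟨fun z => γ z • w (r z), fun z => ?_, fun g z => ?_⟩
  · have := hS (γ z) _ _ (hw (r z))
    rwa [hγ] at this
  · have hrz : r (g • z) = r z := by
      have : q (g • z) = q z := Quotient.sound (s := MulAction.orbitRel G J) ⟨g, rfl⟩
      simp only [r, this]
    have h1 : ((g * γ z)⁻¹ * γ (g • z)) • r z = r z := by
      rw [mul_smul, inv_smul_eq_iff, mul_smul, hγ z, ← hrz, hγ]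
    have h2 := hfix _ _ h1
    rw [mul_smul, inv_smul_eq_iff, mul_smul] at h2
    simp only [hrz, h2]

/-! ### Equivariant selections -/

section Selection

variable {G : Type u} [Group G] {Y : Type u} [TopologicalSpace Y] [MulAction G Y] [CWStructure Y]
  {P : Type*} [TopologicalSpace P] [MulAction G P]

/-- `u` is an equivariant continuous selection of `R` on the union of `D` and the cells of
dimension less than `n`. -/
structure IsPartialSelection (G : Type u) [Group G] [MulAction G Y] [MulAction G P] (D : Set Y)
    (R : Y → P → Prop) (n : ℕ) (u : Y → P) : Prop where
  continuousOn_base : ContinuousOn u D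
  continuousOn_cell : ∀ m < n, ∀ e : Cell Y m, ContinuousOn u (closedCell m e)
  map_smul : ∀ y ∈ D ∪ cellsLT Y n, ∀ g : G, u (g • y) = g • u y
  rel : ∀ y ∈ D ∪ cellsLT Y n, R y (u y)

/-- Equivariant selections can be extended over the characteristic maps of the cells not in `D`. -/
def HasCellSelections (G : Type u) [Group G] [MulAction G Y] [MulAction G P] (D : Set Y)
    (R : Y → P → Prop) : Prop :=
  ∀ (n : ℕ) (e : Cell Y n), Disjoint (openCell n e) D → ∀ u : (Fin n → ℝ) → P,
    ContinuousOn u (sphere 0 1) → (∀ x ∈ sphere (0 : Fin n → ℝ) 1, R (map n e x) (u x)) →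
    (∀ x ∈ sphere (0 : Fin n → ℝ) 1, ∀ g : G, g • map n e 0 = map n e 0 → g • u x = u x) →
    ∃ v : (Fin n → ℝ) → P, ContinuousOn v (closedBall 0 1) ∧
      (∀ x ∈ closedBall (0 : Fin n → ℝ) 1, R (map n e x) (v x)) ∧
      (∀ x ∈ closedBall (0 : Fin n → ℝ) 1, ∀ g : G, g • map n e 0 = map n e 0 → g • v x = v x) ∧
      EqOn v u (sphere 0 1)

variable [IsGCWComplex G Y] [ContinuousConstSMul G P] {D : Set Y} {R : Y → P → Prop}

/-- It is enough to extend over one `n`-cell from each orbit, compatibly with its stabilizer, and to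
translate. Cells inside `D` keep the given values. -/
theorem IsPartialSelection.exists_succ
    (hDG : ∀ (g : G), ∀ y ∈ D, g • y ∈ D)
    (hDc : ∀ n (e : Cell Y n), openCell n e ⊆ D ∨ Disjoint (openCell n e) D) (hD : IsClosed D)
    (hR : ∀ (g : G) y p, R y p → R (g • y) (g • p)) (hfill : HasCellSelections G D R)
    {n : ℕ} {u : Y → P} (hu : IsPartialSelection G D R n u) :
    ∃ u' : Y → P, IsPartialSelection G D R (n + 1) u' ∧ EqOn u' u (D ∪ cellsLT Y n) := by
  classical
  have : T2Space Y := IsGCWComplex.t2Space G Y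
  let _ : MulAction G (Cell Y n) := cellAction G Y n
  have hsph : ∀ e : Cell Y n, ContinuousOn (fun x => u (map n e x)) (sphere 0 1) := fun e =>
    (continuousOn_cellFrontier e hu.continuousOn_cell).comp
      ((RelCWComplex.continuousOn n e).mono sphere_subset_closedBall) fun x hx => ⟨x, hx, rfl⟩
  -- Candidates for the composite of the new selection with the characteristic map of `e`. As
  -- functions on one fixed ball they carry a pointwise action of `G`, so they can be chosen
  -- equivariantly in `e`. The last condition pins them down where `u` is already given by `D`.
  let S : Cell Y n → Set (closedBall (0 : Fin n → ℝ) 1 → P) := fun e =>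
    {w | Continuous w ∧
      (∀ x : closedBall (0 : Fin n → ℝ) 1, R (map n e x) (w x)) ∧
      (∀ x : closedBall (0 : Fin n → ℝ) 1, (x : Fin n → ℝ) ∈ sphere 0 1 → w x = u (map n e x)) ∧
      ∀ x : closedBall (0 : Fin n → ℝ) 1, map n e x ∈ D → w x = u (map n e x)}
  obtain ⟨σ, hσS, hσ⟩ : ∃ σ : Cell Y n → (closedBall (0 : Fin n → ℝ) 1 → P), (∀ e, σ e ∈ S e) ∧
      ∀ (g : G) e, σ (g • e) = g • σ e := by
    refine exists_equivariant_choice S ?_ ?_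
    · rintro g e w ⟨h1, h2, h3, h4⟩
      have hge : ∀ x : closedBall (0 : Fin n → ℝ) 1, map n (g • e) x = g • map n e x :=
        fun x => map_smulCell g e x.2
      refine ⟨h1.const_smul g, fun x => ?_, fun x hx => ?_, fun x hx => ?_⟩
      · rw [hge]
        exact hR g _ _ (h2 x)
      · rw [hge, hu.map_smul _ (Or.inr (map_mem_cellsLT e hx)), ← h3 x hx]
        rfl
      · rw [hge] at hx ⊢
        have hx' : map n e x ∈ D := by simpa using hDG g⁻¹ _ hx
        rw [hu.map_smul _ (Or.inl hx'), ← h4 x hx']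
        rfl
    · intro e
      rcases hDc n e with he | he
      · have hcl : closedCell n e ⊆ D := by
          rw [← closure_openCell_eq_closedCell]
          exact closure_minimal he hD
        have hmem : ∀ x : closedBall (0 : Fin n → ℝ) 1, map n e x ∈ D :=
          fun x => hcl (map_mem_closedCell e x.2)
        refine ⟨fun x => u (map n e x), ⟨?_, fun x => hu.rel _ (Or.inl (hmem x)), fun _ _ => rfl,
          fun _ _ => rfl⟩, fun g hg => ?_⟩
        · exact hu.continuousOn_base.comp_continuous
            ((RelCWComplex.continuousOn n e).comp_continuous continuous_subtype_val fun x => x.2)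
            hmem
        · ext x
          change g • u (map n e x) = _
          rw [← hu.map_smul _ (Or.inl (hmem x)), smul_map_of_smulCell_eq hg x.2]
      · obtain ⟨v, hv, hvR, hvG, hvu⟩ := hfill n e he _ (hsph e)
          (fun x hx => hu.rel _ (Or.inr (map_mem_cellsLT e hx))) (fun x hx g hg => by
            have h1 : smulCell g e = e := smulCell_eq_self (map_zero_mem_openCell n e) hg
            rw [← hu.map_smul _ (Or.inr (map_mem_cellsLT e hx)),
              smul_map_of_smulCell_eq h1 (sphere_subset_closedBall hx)])
        refine ⟨fun x => v x, ⟨hv.comp_continuous continuous_subtype_val fun x => x.2,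
          fun x => hvR x x.2, fun x hx => hvu hx, fun x hx => ?_⟩, fun g hg => ?_⟩
        · have hx2 : (x : Fin n → ℝ) ∈ ball 0 1 ∪ sphere 0 1 := by rw [ball_union_sphere]; exact x.2
          rcases hx2 with h | h
          · exact (disjoint_left.1 he (map_mem_openCell e h) hx).elim
          · exact hvu h
        · ext x
          have h0 : (0 : Fin n → ℝ) ∈ closedBall 0 1 := mem_closedBall_self zero_le_one
          exact hvG x x.2 g (smul_map_of_smulCell_eq (e := e) hg h0)
  -- A point of an open `n`-cell has unique coordinates, so the new values are defined there; on the
  -- frontier they agree with `u` by the third condition in `S`.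
  let u' : Y → P := fun y =>
    if h : ∃ (e : Cell Y n) (x : Fin n → ℝ), x ∈ ball 0 1 ∧ map n e x = y then
      σ h.choose ⟨h.choose_spec.choose, ball_subset_closedBall h.choose_spec.choose_spec.1⟩
    else u y
  have hu'ball : ∀ (e : Cell Y n) (x : Fin n → ℝ) (hx : x ∈ ball 0 1),
      u' (map n e x) = σ e ⟨x, ball_subset_closedBall hx⟩ := by
    intro e x hx
    have h : ∃ (e' : Cell Y n) (x' : Fin n → ℝ), x' ∈ ball 0 1 ∧ map n e' x' = map n e x :=
      ⟨e, x, hx, rfl⟩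
    simp only [u', dif_pos h]
    have key : ∀ (e' : Cell Y n) (x' : Fin n → ℝ) (hx' : x' ∈ ball 0 1),
        map n e' x' = map n e x → σ e' ⟨x', ball_subset_closedBall hx'⟩ =
          σ e ⟨x, ball_subset_closedBall hx⟩ := by
      intro e' x' hx' heq
      obtain rfl : e' = e := eq_of_mem_openCell (map_mem_openCell e' hx')
        (heq ▸ map_mem_openCell e hx)
      obtain rfl : x' = x := injOn_map e' hx' hx heq
      rfl
    exact key _ _ h.choose_spec.choose_spec.1 h.choose_spec.choose_spec.2
  have hu'lt : EqOn u' u (D ∪ cellsLT Y n) := by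
    intro y hy
    by_cases h : ∃ (e : Cell Y n) (x : Fin n → ℝ), x ∈ ball 0 1 ∧ map n e x = y
    · obtain ⟨e, x, hx, rfl⟩ := h
      rcases hy with hy | hy
      · rw [hu'ball e x hx]
        exact (hσS e).2.2.2 _ hy
      · exact (notMem_cellsLT e (map_mem_openCell e hx) hy).elim
    · exact dif_neg h
  have hu'closed : ∀ (e : Cell Y n) (x : closedBall (0 : Fin n → ℝ) 1),
      u' (map n e x) = σ e x := by
    intro e x
    have hx2 : (x : Fin n → ℝ) ∈ ball 0 1 ∪ sphere 0 1 := by rw [ball_union_sphere]; exact x.2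
    rcases hx2 with h | h
    · exact hu'ball e x h
    · rw [hu'lt (Or.inr (map_mem_cellsLT e h)), (hσS e).2.2.1 x h]
  have hcases : ∀ y ∈ D ∪ cellsLT Y (n + 1), y ∈ D ∪ cellsLT Y n ∨
      ∃ (e : Cell Y n) (x : closedBall (0 : Fin n → ℝ) 1), map n e x = y := by
    rintro y (hy | ⟨m, hm, e, he⟩)
    · exact Or.inl (Or.inl hy)
    · rcases Nat.lt_succ_iff_lt_or_eq.1 hm with h | rfl
      · exact Or.inl (Or.inr ⟨m, h, e, he⟩)
      · obtain ⟨x, hx, rfl⟩ := he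
        exact Or.inr ⟨e, ⟨x, ball_subset_closedBall hx⟩, rfl⟩
  refine ⟨u', ⟨?_, fun m hm e => ?_, fun y hy g => ?_, fun y hy => ?_⟩, hu'lt⟩
  · exact hu.continuousOn_base.congr fun y hy => hu'lt (Or.inl hy)
  · rcases Nat.lt_succ_iff_lt_or_eq.1 hm with h | rfl
    · exact (hu.continuousOn_cell m h e).congr fun y hy =>
        hu'lt (Or.inr (closedCell_subset_cellsLT h e hy))
    · refine continuousOn_closedCell e ?_
      rw [continuousOn_iff_continuous_domRestrict]
      convert (hσS e).1 using 1
      ext x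
      exact hu'closed e x
  · rcases hcases y hy with h | ⟨e, x, rfl⟩
    · have h' : g • y ∈ D ∪ cellsLT Y n := h.imp (hDG g y) (smul_mem_cellsLT g)
      rw [hu'lt h, hu'lt h', hu.map_smul y h]
    · rw [hu'closed, ← map_smulCell g e x.2, hu'closed]
      exact congrFun (hσ g e) x
  · rcases hcases y hy with h | ⟨e, x, rfl⟩
    · rw [hu'lt h]
      exact hu.rel y h
    · rw [hu'closed]
      exact (hσS e).2.1 x

/-- An equivariant selection on an invariant subcomplex `D` extends to the whole complex. -/
theorem exists_equivariant_selection (hDG : ∀ (g : G), ∀ y ∈ D, g • y ∈ D)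
    (hDc : ∀ n (e : Cell Y n), openCell n e ⊆ D ∨ Disjoint (openCell n e) D) (hD : IsClosed D)
    (hR : ∀ (g : G) y p, R y p → R (g • y) (g • p)) (hfill : HasCellSelections G D R)
    (u₀ : Y → P) (hu₀ : ContinuousOn u₀ D) (hu₀G : ∀ y ∈ D, ∀ g : G, u₀ (g • y) = g • u₀ y)
    (hu₀R : ∀ y ∈ D, R y (u₀ y)) :
    ∃ u : Y → P, Continuous u ∧ (∀ (g : G) y, u (g • y) = g • u y) ∧ (∀ y, R y (u y)) ∧
      EqOn u u₀ D := by
  have : T2Space Y := IsGCWComplex.t2Space G Y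
  have hempty : ∀ y, y ∉ cellsLT Y 0 := by
    rintro y ⟨m, hm, -⟩
    exact Nat.not_lt_zero m hm
  have h₀ : IsPartialSelection G D R 0 u₀ :=
    ⟨hu₀, fun m hm => (Nat.not_lt_zero m hm).elim,
      fun y hy => hu₀G y (hy.resolve_right (hempty y)),
      fun y hy => hu₀R y (hy.resolve_right (hempty y))⟩
  choose next hnext hnext_eq using fun (n : ℕ) (u : {u // IsPartialSelection G D R n u}) =>
    IsPartialSelection.exists_succ hDG hDc hD hR hfill u.2
  let s : ∀ n, {u // IsPartialSelection G D R n u} := fun n =>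
    Nat.rec ⟨u₀, h₀⟩ (fun n u => ⟨next n u, hnext n u⟩) n
  have hs : ∀ n, EqOn (s (n + 1)).1 (s n).1 (D ∪ cellsLT Y n) := fun n => hnext_eq n (s n)
  have hs' : ∀ n m, n ≤ m → EqOn (s m).1 (s n).1 (D ∪ cellsLT Y n) := by
    intro n m hnm
    induction m, hnm using Nat.le_induction with
    | base => exact fun _ _ => rfl
    | succ m hnm ih =>
      exact fun y hy => (hs m (hy.imp_right fun h => cellsLT_mono hnm h)).trans (ih hy)
  choose d hd using fun y : Y => exists_mem_openCell y
  have hdim : ∀ y, y ∈ D ∪ cellsLT Y (d y + 1) := fun y =>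
    Or.inr ⟨d y, Nat.lt_succ_self _, (hd y).choose, (hd y).choose_spec⟩
  -- At `y` the stages no longer change once the open cell containing `y`, of dimension `d y`, has
  -- been treated, that is from stage `d y + 1` on.
  let u : Y → P := fun y => (s (d y + 1)).1 y
  have hu : ∀ n, EqOn u (s n).1 (D ∪ cellsLT Y n) := by
    intro n y hy
    rcases le_total n (d y + 1) with h | h
    · exact hs' _ _ h hy
    · exact (hs' _ _ h (hdim y)).symm
  refine ⟨u, ?_, fun g y => ?_, fun y => ?_, fun y hy => hu 0 (Or.inl hy)⟩
  · refine continuous_of_closedCell fun n e => ?_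
    exact ((s (n + 1)).2.continuousOn_cell n (Nat.lt_succ_self n) e).congr fun y hy =>
      hu (n + 1) (Or.inr (closedCell_subset_cellsLT (Nat.lt_succ_self n) e hy))
  · have h1 : g • y ∈ D ∪ cellsLT Y (d y + 1) := (hdim y).imp (hDG g y) (smul_mem_cellsLT g)
    rw [hu _ h1, (s (d y + 1)).2.map_smul y (hdim y) g]
  · exact (s (d y + 1)).2.rel y (hdim y)

end Selection

/-! ### Equivariant homotopies as maps into path spaces -/

section Homotopy

variable {G : Type u} [Group G] {X Y Z : Type u} [TopologicalSpace X] [MulAction G X]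
  [TopologicalSpace Y] [MulAction G Y] [TopologicalSpace Z] [MulAction G Z]

theorem GMap.continuous (f : GMap G X Y) : Continuous f := f.continuous_toFun

/-- The identity as a `G`-map. -/
def GMap.id (G : Type u) [Group G] (X : Type u) [TopologicalSpace X] [MulAction G X] :
    GMap G X X where
  toFun := _root_.id
  continuous_toFun := continuous_id
  map_smul _ _ := rfl

/-- The composition of `G`-maps. -/
def GMap.comp (f : GMap G Y Z) (f' : GMap G X Y) : GMap G X Z where
  toFun := f ∘ f'
  continuous_toFun := f.continuous.comp f'.continuous
  map_smul g x := by
    change f (f' (g • x)) = _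
    rw [f'.map_smul, f.map_smul]
    rfl

/-- The constant `G`-map at a fixed point. -/
def GMap.const (X : Type u) [TopologicalSpace X] [MulAction G X] (y : Y) (hy : ∀ g : G, g • y = y) :
    GMap G X Y where
  toFun _ := y
  continuous_toFun := continuous_const
  map_smul g _ := (hy g).symm

/-- The restriction of a `G`-map to a subgroup. -/
def GMap.restrict (f : GMap G X Y) (H : Subgroup G) : GMap H X Y where
  toFun := f
  continuous_toFun := f.continuous
  map_smul h x := f.map_smul h x

/-- Homotopies are handled as equivariant maps into the path space. A homotopy on `Y` is then a
selection over `Y` itself, and no cell structure on `Y × [0, 1]` has to be constructed. -/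
theorem gHomotopic_of_path {f₀ f₁ : GMap G X Y} (γ : X → C(unitInterval, Y)) (hγ : Continuous γ)
    (h0 : ∀ x, γ x 0 = f₀ x) (h1 : ∀ x, γ x 1 = f₁ x)
    (hG : ∀ (g : G) x t, γ (g • x) t = g • γ x t) : GHomotopic f₀ f₁ :=
  ⟨{ toFun := fun p => γ p.2 p.1
     continuous_toFun := (hγ.comp continuous_snd).eval continuous_fst
     map_zero_left := h0
     map_one_left := h1 }, fun t g x => hG g x t⟩

theorem GHomotopic.exists_path {f₀ f₁ : GMap G X Y} (h : GHomotopic f₀ f₁) :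
    ∃ γ : X → C(unitInterval, Y), Continuous γ ∧ (∀ x, γ x 0 = f₀ x) ∧ (∀ x, γ x 1 = f₁ x) ∧
      ∀ (g : G) x t, γ (g • x) t = g • γ x t := by
  obtain ⟨h, hG⟩ := h
  let c : C(X × unitInterval, Y) := ⟨fun p => h (p.2, p.1), by fun_prop⟩
  exact ⟨c.curry, c.curry.continuous, fun x => h.apply_zero x, fun x => h.apply_one x,
    fun g x t => hG t g x⟩

theorem GHomotopic.symm {f₀ f₁ : GMap G X Y} (h : GHomotopic f₀ f₁) : GHomotopic f₁ f₀ := by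
  obtain ⟨h, hG⟩ := h
  exact ⟨h.symm, fun t g x => hG _ g x⟩

theorem GHomotopic.trans {f₀ f₁ f₂ : GMap G X Y} (h : GHomotopic f₀ f₁) (h' : GHomotopic f₁ f₂) :
    GHomotopic f₀ f₂ := by
  obtain ⟨h, hG⟩ := h
  obtain ⟨h', hG'⟩ := h'
  refine ⟨h.trans h', fun t g x => ?_⟩
  rw [ContinuousMap.Homotopy.trans_apply, ContinuousMap.Homotopy.trans_apply]
  split_ifs
  · exact hG _ g x
  · exact hG' _ g x

theorem GHomotopic.comp_left {f₀ f₁ : GMap G X Y} (h : GHomotopic f₀ f₁) (f : GMap G Y Z) :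
    GHomotopic (f.comp f₀) (f.comp f₁) := by
  obtain ⟨γ, hγ, h0, h1, hG⟩ := h.exists_path
  refine gHomotopic_of_path (fun x => f.toContinuousMap.comp (γ x))
    ((ContinuousMap.continuous_postcomp f.toContinuousMap).comp hγ) (fun x => congrArg f (h0 x))
    (fun x => congrArg f (h1 x)) fun g x t => ?_
  change f (γ (g • x) t) = g • f (γ x t)
  rw [hG, f.map_smul]

theorem GHomotopic.comp_right {f₀ f₁ : GMap G Y Z} (h : GHomotopic f₀ f₁) (f : GMap G X Y) :
    GHomotopic (f₀.comp f) (f₁.comp f) := by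
  obtain ⟨γ, hγ, h0, h1, hG⟩ := h.exists_path
  refine gHomotopic_of_path (fun x => γ (f x)) (hγ.comp f.continuous) (fun x => h0 _)
    (fun x => h1 _) fun g x t => ?_
  rw [f.map_smul, hG]

end Homotopy

/-! ### Existence and uniqueness of equivariant maps into spaces with fillable fixed sets. -/

section Lifting

variable {G : Type u} [Group G]

/-- The set of points of `X` fixed by the subgroup `H`. -/
def fixedSet {G : Type*} [Group G] (H : Subgroup G) (X : Type*) [MulAction G X] : Set X :=
  {x | ∀ h ∈ H, h • x = x}

variable {Y : Type u} [TopologicalSpace Y] [MulAction G Y] [CWStructure Y] [IsGCWComplex G Y]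
  {Z : Type u} [TopologicalSpace Z] [MulAction G Z] [ContinuousConstSMul G Z]

/-- Selection with no constraint and nothing prescribed: on each cell, a sphere in the fixed set of
the stabilizer of the centre has to be filled within that set. -/
theorem exists_gMap (h : ∀ y : Y, Fillable (fixedSet (MulAction.stabilizer G y) Z)) :
    Nonempty (GMap G Y Z) := by
  obtain ⟨u, hu, huG, -, -⟩ := exists_equivariant_selection (G := G) (Y := Y) (P := Z) (D := ∅)
    (R := fun _ _ => True) (by simp) (by simp) isClosed_empty (by simp)
    (fun n e _ u hu _ hG => by
      obtain ⟨v, hv, hvC, hvu⟩ := (h (map n e 0)).exists_extension n u hu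
        fun x hx g hg => hG x hx g hg
      exact ⟨v, hv, fun _ _ => trivial, fun x hx g hg => hvC hx g hg, hvu⟩)
    (fun y => (h y).nonempty.some) (continuousOn_empty _) (by simp) (by simp)
  exact ⟨⟨⟨u, hu⟩, huG⟩⟩

theorem map_smul_path {g : G} (γ : C(unitInterval, Z)) (t : unitInterval) :
    (g • γ) t = g • γ t := rfl

/-- Two equivariant maps that agree over the `G`-set `J` are homotopic over `J` if the fixed sets in
the fibres of the target are fillable. -/
theorem exists_homotopy_over {J : Type*} [MulAction G J] (π : Z → J) (hπ : IsLocallyConstant π)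
    (hπG : ∀ (g : G) z, π (g • z) = g • π z) (f₀ f₁ : GMap G Y Z)
    (hf : ∀ y, π (f₁ y) = π (f₀ y))
    (hfill : ∀ y : Y, Fillable (fixedSet (MulAction.stabilizer G y) Z ∩ {z | π z = π (f₀ y)})) :
    ∃ γ : Y → C(unitInterval, Z), Continuous γ ∧ (∀ y, γ y 0 = f₀ y) ∧ (∀ y, γ y 1 = f₁ y) ∧
      (∀ (g : G) y t, γ (g • y) t = g • γ y t) ∧ ∀ y t, π (γ y t) = π (f₀ y) := by
  let R : Y → C(unitInterval, Z) → Prop := fun y γ =>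
    γ 0 = f₀ y ∧ γ 1 = f₁ y ∧ ∀ t, π (γ t) = π (f₀ y)
  suffices h : ∃ u : Y → C(unitInterval, Z), Continuous u ∧ (∀ (g : G) y, u (g • y) = g • u y) ∧
      (∀ y, R y (u y)) ∧ EqOn u (fun y => ContinuousMap.const _ (f₀ y)) ∅ by
    obtain ⟨u, hu, huG, huR, -⟩ := h
    exact ⟨u, hu, fun y => (huR y).1, fun y => (huR y).2.1, fun g y t => congrArg (· t) (huG g y),
      fun y => (huR y).2.2⟩
  refine exists_equivariant_selection (by simp) (by simp) isClosed_empty ?_ ?_ _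
    (continuousOn_empty _) (by simp) (by simp)
  · rintro g y γ ⟨h0, h1, h⟩
    simp only [R, map_smul_path, f₀.map_smul, f₁.map_smul, h0, h1, hπG, h, implies_true, and_self]
  · intro n e _ u hu huR huG
    have hcomp : ∀ f : GMap G Y Z, ContinuousOn (fun x => f (map n e x)) (closedBall 0 1) :=
      fun f => f.continuous.comp_continuousOn (RelCWComplex.continuousOn n e)
    -- The ball is connected and `π` is locally constant, so a whole closed cell maps to one fibre.
    have hconst : ∀ x ∈ closedBall (0 : Fin n → ℝ) 1, π (f₀ (map n e x)) = π (f₀ (map n e 0)) := by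
      intro x hx
      refine hπ.apply_eq_of_isPreconnected (s := (fun x => f₀ (map n e x)) '' closedBall 0 1) ?_
        ⟨x, hx, rfl⟩ ⟨0, mem_closedBall_self zero_le_one, rfl⟩
      exact (convex_closedBall (0 : Fin n → ℝ) 1).isPreconnected.image _ (hcomp f₀)
    have hfix : ∀ (f : GMap G Y Z), ∀ x ∈ closedBall (0 : Fin n → ℝ) 1,
        f (map n e x) ∈ fixedSet (MulAction.stabilizer G (map n e 0)) Z := by
      intro f x hx g hg
      have h1 : smulCell g e = e := smulCell_eq_self (map_zero_mem_openCell n e) hg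
      rw [← f.map_smul, smul_map_of_smulCell_eq h1 hx]
    obtain ⟨F, hF, hF0, hF1, hFC, hFu⟩ := (hfill (map n e 0)).exists_path_extension
      (fun x => f₀ (map n e x)) (fun x => f₁ (map n e x)) (hcomp f₀) (hcomp f₁)
      (fun x hx => ⟨hfix f₀ x hx, hconst x hx⟩)
      (fun x hx => ⟨hfix f₁ x hx, (hf _).trans (hconst x hx)⟩) u hu
      (fun x hx t => ⟨fun g hg => by rw [← map_smul_path, huG x hx g hg],
        ((huR x hx).2.2 t).trans (hconst x (sphere_subset_closedBall hx))⟩)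
      (fun x hx => (huR x hx).1) (fun x hx => (huR x hx).2.1)
    refine ⟨F, hF, fun x hx => ⟨hF0 x hx, hF1 x hx, fun t => ?_⟩, fun x hx g hg => ?_, hFu⟩
    · exact (hFC x hx t).2.trans (hconst x hx).symm
    · ext t
      exact (hFC x hx t).1 g hg

/-- The case of `exists_homotopy_over` in which `J` is a point. -/
theorem gHomotopic_of_fillable (f₀ f₁ : GMap G Y Z)
    (hfill : ∀ y : Y, Fillable (fixedSet (MulAction.stabilizer G y) Z)) : GHomotopic f₀ f₁ := by
  obtain ⟨γ, hγ, h0, h1, hG, -⟩ := exists_homotopy_over (J := Unit) (fun _ : Z => ())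
    (IsLocallyConstant.const ()) (fun _ _ => rfl) f₀ f₁ (fun _ => rfl)
    (fun y => by simpa using hfill y)
  exact gHomotopic_of_path γ hγ h0 h1 hG

/-- A `G`-CW-complex with isotropy groups in `F` whose fixed sets under the elements of `F` are
fillable is a classifying space. -/
theorem isClassifyingSpace_of_fillable {F : Family G} [CWStructure Z] (hZ : IsGCWComplex G Z)
    (hstab : ∀ z : Z, MulAction.stabilizer G z ∈ F) (hfill : ∀ H ∈ F, Fillable (fixedSet H Z)) :
    IsClassifyingSpace F Z where
  isGCWComplex := hZ
  stabilizer_mem := hstab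
  exists_map _ _ _ _ _ h := exists_gMap fun y => hfill _ (h y)
  homotopic _ _ _ _ _ h f₀ f₁ := gHomotopic_of_fillable f₀ f₁ fun y => hfill _ (h y)

end Lifting

/-! ### The equivariant homotopy extension property. -/

section Extension

variable {G : Type u} [Group G] {A E : Type u} [TopologicalSpace A] [MulAction G A]
  [CWStructure A] [TopologicalSpace E] [MulAction G E] [CWStructure E]

theorem IsCWInclusion.exists_image_eq {i : A → E} (hi : IsCWInclusion i) {n : ℕ} (e : Cell E n)
    {a : A} (ha : i a ∈ openCell n e) : ∃ c : Cell A n, i '' openCell n c = openCell n e := by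
  obtain ⟨m, c, hc⟩ := exists_mem_openCell a
  obtain ⟨e', he'⟩ := hi.exists_cell m c
  have h := sigma_eq_of_mem_openCell ha (he' ▸ ⟨a, hc, rfl⟩ : i a ∈ openCell m e')
  cases h
  exact ⟨c, he'⟩

theorem IsCWInclusion.subset_or_disjoint {i : A → E} (hi : IsCWInclusion i) {n : ℕ}
    (e : Cell E n) : openCell n e ⊆ range i ∨ Disjoint (openCell n e) (range i) := by
  refine or_iff_not_imp_right.2 fun h => ?_
  obtain ⟨_, hx, a, rfl⟩ := not_disjoint_iff.1 h
  obtain ⟨c, hc⟩ := hi.exists_image_eq e hx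
  rw [← hc]
  exact image_subset_range _ _

variable [IsGCWComplex G E] {Z : Type u} [TopologicalSpace Z] [MulAction G Z]
  [ContinuousConstSMul G Z]

/-- The equivariant homotopy extension property of the inclusion of a `G`-subcomplex, with values in
an invariant set. -/
theorem exists_homotopy_extension (i : GMap G A E) (hi : IsCWInclusion i) (C : Set Z)
    (hC : ∀ (g : G), ∀ z ∈ C, g • z ∈ C) (f : GMap G E Z) (hfC : ∀ e, f e ∈ C)
    (h : A → C(unitInterval, Z)) (hh : Continuous h) (hG : ∀ (g : G) a t, h (g • a) t = g • h a t)
    (hhC : ∀ a t, h a t ∈ C) (h0 : ∀ a, h a 0 = f (i a)) :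
    ∃ γ : E → C(unitInterval, Z), Continuous γ ∧ (∀ (g : G) e t, γ (g • e) t = g • γ e t) ∧
      (∀ e, γ e 0 = f e) ∧ (∀ e t, γ e t ∈ C) ∧ ∀ a, γ (i a) = h a := by
  classical
  have hinj : Function.Injective i := hi.isClosedEmbedding.injective
  -- Only the values on the range of `i` matter; the constant paths elsewhere are a default.
  let u₀ : E → C(unitInterval, Z) := Function.extend i h fun e => ContinuousMap.const _ (f e)
  have hu₀ : ∀ a, u₀ (i a) = h a := fun a => hinj.extend_apply _ _ a
  let R : E → C(unitInterval, Z) → Prop := fun e γ => γ 0 = f e ∧ ∀ t, γ t ∈ C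
  suffices h : ∃ u : E → C(unitInterval, Z), Continuous u ∧ (∀ (g : G) y, u (g • y) = g • u y) ∧
      (∀ y, R y (u y)) ∧ EqOn u u₀ (range i) by
    obtain ⟨u, hu, huG, huR, huD⟩ := h
    refine ⟨u, hu, fun g e t => congrArg (· t) (huG g e), fun e => (huR e).1,
      fun e => (huR e).2, fun a => ?_⟩
    rw [huD ⟨a, rfl⟩, hu₀]
  refine exists_equivariant_selection ?_ (fun n e => hi.subset_or_disjoint e)
    hi.isClosedEmbedding.isClosed_range ?_ ?_ u₀ ?_ ?_ ?_
  · rintro g _ ⟨a, rfl⟩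
    exact ⟨g • a, i.map_smul g a⟩
  · rintro g e γ ⟨h1, h2⟩
    exact ⟨by rw [map_smul_path, h1, f.map_smul], fun t => hC g _ (h2 t)⟩
  · intro n e _ u hu huR huG
    -- Here the end of the paths is free, so the retraction of ball × interval suffices and no
    -- fillability is needed. Taking values in the fixed set makes the extension compatible with the
    -- stabilizer.
    obtain ⟨F, hF, hF0, hFC, hFu⟩ := exists_ball_homotopy_extension
      (C ∩ fixedSet (MulAction.stabilizer G (map n e 0)) Z) (fun x => f (map n e x))
      (f.continuous.comp_continuousOn (RelCWComplex.continuousOn n e))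
      (fun x hx => ⟨hfC _, fun g hg => by
        have h1 : smulCell g e = e := smulCell_eq_self (map_zero_mem_openCell n e) hg
        simp only [← f.map_smul, smul_map_of_smulCell_eq h1 hx]⟩) u hu
      (fun x hx t => ⟨(huR x hx).2 t, fun g hg => by rw [← map_smul_path, huG x hx g hg]⟩)
      (fun x hx => (huR x hx).1)
    refine ⟨F, hF, fun x hx => ⟨hF0 x hx, fun t => (hFC x hx t).1⟩, fun x hx g hg => ?_, hFu⟩
    ext t
    exact (hFC x hx t).2 g hg
  · rw [continuousOn_iff_continuous_domRestrict]
    have : (range i).domRestrict u₀ = h ∘ (hi.isClosedEmbedding.isEmbedding.toHomeomorph).symm := by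
      ext1 ⟨_, a, rfl⟩
      have h1 : hi.isClosedEmbedding.isEmbedding.toHomeomorph a = ⟨i a, a, rfl⟩ := rfl
      rw [Function.comp_apply, ← h1, Homeomorph.symm_apply_apply]
      exact hu₀ a
    rw [this]
    exact hh.comp (Homeomorph.continuous _)
  · rintro _ ⟨a, rfl⟩ g
    ext t
    rw [← i.map_smul]
    change u₀ (i (g • a)) t = (g • u₀ (i a)) t
    rw [hu₀, hu₀, hG]
    rfl
  · rintro _ ⟨a, rfl⟩
    simp only [hu₀]
    exact ⟨h0 a, hhC a⟩

end Extension

/-! ### Pushouts -/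

/-- `X` is the topological pushout of `E` and `B` along the injective map `i` and `f`. -/
structure IsAdjunctionSpace {A B E X : Type u} [TopologicalSpace A] [TopologicalSpace B]
    [TopologicalSpace E] [TopologicalSpace X] (i : A → E) (f : A → B) (j : E → X) (k : B → X) :
    Prop where
  continuous_left : Continuous j
  continuous_right : Continuous k
  comm : ∀ a, j (i a) = k (f a)
  exists_eq : ∀ x, (∃ e, j e = x) ∨ ∃ b, k b = x
  eq_of_left : ∀ e e', e ∉ range i → j e = j e' → e = e'
  injective_right : Function.Injective k
  mem_range : ∀ e b, j e = k b → e ∈ range i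
  isClosed : ∀ S : Set X, IsClosed (j ⁻¹' S) → IsClosed (k ⁻¹' S) → IsClosed S

section GPushout

variable {G : Type u} [Group G] {A B E X : Type u} [TopologicalSpace A] [MulAction G A]
  [TopologicalSpace B] [MulAction G B] [TopologicalSpace E] [MulAction G E]
  [TopologicalSpace X] [MulAction G X]

theorem IsGPushout.symm {i : GMap G A E} {f : GMap G A B} {j : GMap G E X} {k : GMap G B X}
    (h : IsGPushout i f j k) : IsGPushout f i k j where
  comm a := (h.comm a).symm
  existsUnique_desc Z _ _ _ v w hvw := by
    obtain ⟨d, hd, hd'⟩ := h.existsUnique_desc Z w v fun a => (hvw a).symm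
    exact ⟨d, hd.symm, fun d' hd'' => hd' d' hd''.symm⟩

/-- The relation that glues `E` and `B` along `A`. -/
def glueRel (i : GMap G A E) (f : GMap G A B) (x y : E ⊕ B) : Prop :=
  ∃ a, x = Sum.inl (i a) ∧ y = Sum.inr (f a)

/-- The space glued from `E` and `B` along `A`. -/
def Glue (i : GMap G A E) (f : GMap G A B) : Type u := Quot (glueRel i f)

instance (i : GMap G A E) (f : GMap G A B) : TopologicalSpace (Glue i f) :=
  inferInstanceAs (TopologicalSpace (Quot (glueRel i f)))

instance (i : GMap G A E) (f : GMap G A B) : MulAction G (Glue i f) where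
  smul g := Quot.map (g • ·) (by
    rintro _ _ ⟨a, rfl, rfl⟩
    exact ⟨g • a, congrArg Sum.inl (i.map_smul g a).symm, congrArg Sum.inr (f.map_smul g a).symm⟩)
  one_smul := by
    rintro ⟨x⟩
    exact congrArg (Quot.mk _) (one_smul G x)
  mul_smul g h := by
    rintro ⟨x⟩
    exact congrArg (Quot.mk _) (mul_smul g h x)

instance (i : GMap G A E) (f : GMap G A B) [ContinuousConstSMul G E] [ContinuousConstSMul G B] :
    ContinuousConstSMul G (Glue i f) where
  continuous_const_smul g := by
    refine continuous_quot_lift _ (continuous_quot_mk.comp ?_)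
    exact (continuous_const_smul g).sumMap (continuous_const_smul g)

/-- The map from `E` to the glued space. -/
def Glue.inl (i : GMap G A E) (f : GMap G A B) : GMap G E (Glue i f) where
  toFun e := Quot.mk _ (Sum.inl e)
  continuous_toFun := continuous_quot_mk.comp continuous_inl
  map_smul _ _ := rfl

/-- The map from `B` to the glued space. -/
def Glue.inr (i : GMap G A E) (f : GMap G A B) : GMap G B (Glue i f) where
  toFun b := Quot.mk _ (Sum.inr b)
  continuous_toFun := continuous_quot_mk.comp continuous_inr
  map_smul _ _ := rfl

/-- Computes the equivalence relation generated by `glueRel`: distinct equivalent representatives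
both collapse to the same point of `B`. Injectivity of `i` makes this relation transitive. -/
theorem Glue.normal_form_eq {i : GMap G A E} {f : GMap G A B} (hi : Function.Injective i)
    {x y : E ⊕ B} (h : (Quot.mk _ x : Glue i f) = Quot.mk _ y) :
    x = y ∨ ∃ b, (x = Sum.inr b ∨ ∃ a, x = Sum.inl (i a) ∧ f a = b) ∧
      (y = Sum.inr b ∨ ∃ a, y = Sum.inl (i a) ∧ f a = b) := by
  rw [Quot.eq] at h
  induction h with
  | rel x y h =>
    obtain ⟨a, rfl, rfl⟩ := h
    exact Or.inr ⟨f a, Or.inr ⟨a, rfl, rfl⟩, Or.inl rfl⟩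
  | refl x => exact Or.inl rfl
  | symm x y _ ih =>
    rcases ih with rfl | ⟨b, h1, h2⟩
    · exact Or.inl rfl
    · exact Or.inr ⟨b, h2, h1⟩
  | trans x y z _ _ ih ih' =>
    rcases ih with rfl | ⟨b, h1, h2⟩
    · exact ih'
    rcases ih' with rfl | ⟨b', h1', h2'⟩
    · exact Or.inr ⟨b, h1, h2⟩
    have hb : b = b' := by
      rcases h2 with rfl | ⟨a, rfl, rfl⟩ <;> rcases h1' with h | ⟨a', h, rfl⟩
      · exact Sum.inr_injective h
      · cases h
      · cases h
      · rw [hi (Sum.inl_injective h)]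
    subst hb
    exact Or.inr ⟨b, h1, h2'⟩

/-- By the universal property `X` is homeomorphic to the explicit quotient `Glue i f`, where points
and closed sets can be read off. -/
theorem IsGPushout.isAdjunctionSpace [ContinuousConstSMul G E] [ContinuousConstSMul G B]
    [ContinuousConstSMul G X] {i : GMap G A E} {f : GMap G A B} {j : GMap G E X}
    {k : GMap G B X} (h : IsGPushout i f j k) (hi : Function.Injective i) :
    IsAdjunctionSpace i f j k := by
  obtain ⟨d, ⟨hdj, hdk⟩, -⟩ := h.existsUnique_desc (Glue i f) (Glue.inl i f) (Glue.inr i f)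
    fun a => Quot.sound ⟨a, rfl, rfl⟩
  let c : GMap G (Glue i f) X :=
    { toFun := Quot.lift (Sum.elim j k) (by
        rintro _ _ ⟨a, rfl, rfl⟩
        exact h.comm a)
      continuous_toFun := continuous_quot_lift _ (j.continuous.sumElim k.continuous)
      map_smul := by
        rintro g ⟨e | b⟩
        · exact j.map_smul g e
        · exact k.map_smul g b }
  have hcd : ∀ x, c (d x) = x := by
    have hu := (h.existsUnique_desc X j k h.comm).unique (y₁ := c.comp d) (y₂ := GMap.id G X)
      ⟨fun e => congrArg c (hdj e), fun b => congrArg c (hdk b)⟩ ⟨fun e => rfl, fun b => rfl⟩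
    exact fun x => congrArg (fun m : GMap G X X => m x) hu
  have hdc : ∀ q, d (c q) = q := by
    rintro ⟨e | b⟩
    · exact hdj e
    · exact hdk b
  have hdj' : ∀ e, d (j e) = Quot.mk _ (Sum.inl e) := hdj
  have hdk' : ∀ b, d (k b) = Quot.mk _ (Sum.inr b) := hdk
  refine ⟨j.continuous, k.continuous, h.comm, fun x => ?_, fun e e' he hee' => ?_, fun b b' hb => ?_,
    fun e b heb => ?_, fun S hS hS' => ?_⟩
  · rw [← hcd x]
    rcases d x with ⟨e | b⟩
    · exact Or.inl ⟨e, rfl⟩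
    · exact Or.inr ⟨b, rfl⟩
  · have h1 := congrArg d hee'
    rw [hdj', hdj'] at h1
    rcases Glue.normal_form_eq hi h1 with h2 | ⟨b, h2 | ⟨a, h2, -⟩, -⟩
    · exact Sum.inl_injective h2
    · cases h2
    · exact (he ⟨a, (Sum.inl_injective h2).symm⟩).elim
  · have h1 := congrArg d hb
    rw [hdk', hdk'] at h1
    rcases Glue.normal_form_eq hi h1 with h2 | ⟨c, h2 | ⟨a, h2, -⟩, h3 | ⟨a', h3, -⟩⟩
    · exact Sum.inr_injective h2
    · exact (Sum.inr_injective h2).trans (Sum.inr_injective h3).symm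
    · cases h3
    · cases h2
    · cases h2
  · have h1 := congrArg d heb
    rw [hdj', hdk'] at h1
    rcases Glue.normal_form_eq hi h1 with h2 | ⟨b, h2 | ⟨a, h2, -⟩, -⟩
    · cases h2
    · cases h2
    · exact ⟨a, (Sum.inl_injective h2).symm⟩
  · have h1 : IsClosed (c ⁻¹' S) := by
      refine (isQuotientMap_quot_mk (r := glueRel i f)).isClosed_preimage.1 ?_
      exact isClosed_sum_iff.2 ⟨hS, hS'⟩
    have h2 : S = d ⁻¹' (c ⁻¹' S) := by
      ext x
      rw [mem_preimage, mem_preimage, hcd]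
    rw [h2]
    exact h1.preimage d.continuous

end GPushout

namespace IsAdjunctionSpace

variable {A B E X : Type u} [TopologicalSpace A] [TopologicalSpace B] [TopologicalSpace E]
  [TopologicalSpace X] {i : A → E} {f : A → B} {j : E → X} {k : B → X}

theorem exists_eq' (h : IsAdjunctionSpace i f j k) (x : X) :
    (∃ e, e ∉ range i ∧ j e = x) ∨ ∃ b, k b = x := by
  rcases h.exists_eq x with ⟨e, rfl⟩ | hx
  · by_cases he : e ∈ range i
    · obtain ⟨a, rfl⟩ := he
      exact Or.inr ⟨f a, (h.comm a).symm⟩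
    · exact Or.inl ⟨e, he, rfl⟩
  · exact Or.inr hx

theorem exists_desc (h : IsAdjunctionSpace i f j k) {Z : Type*} (v : E → Z) (w : B → Z)
    (hvw : ∀ a, v (i a) = w (f a)) : ∃ d : X → Z, (∀ e, d (j e) = v e) ∧ ∀ b, d (k b) = w b := by
  have key : ∀ x, ∃ z, (∀ e, j e = x → v e = z) ∧ ∀ b, k b = x → w b = z := by
    intro x
    rcases h.exists_eq' x with ⟨e, he, rfl⟩ | ⟨b, rfl⟩
    · exact ⟨v e, fun e' he' => by rw [h.eq_of_left e e' he he'.symm],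
        fun b hb => (he (h.mem_range e b hb.symm)).elim⟩
    · refine ⟨w b, fun e he => ?_, fun b' hb' => by rw [h.injective_right hb']⟩
      obtain ⟨a, rfl⟩ := h.mem_range e b he
      rw [h.comm] at he
      rw [hvw, h.injective_right he]
  choose d hd using key
  exact ⟨d, fun e => ((hd _).1 e rfl).symm, fun b => ((hd _).2 b rfl).symm⟩

theorem continuous_of_comp (h : IsAdjunctionSpace i f j k) {Z : Type*} [TopologicalSpace Z]
    {d : X → Z} (hj : Continuous (d ∘ j)) (hk : Continuous (d ∘ k)) : Continuous d :=
  continuous_iff_isClosed.2 fun _ hS => h.isClosed _ (hS.preimage hj) (hS.preimage hk)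

theorem isOpen (h : IsAdjunctionSpace i f j k) {S : Set X} (hj : IsOpen (j ⁻¹' S))
    (hk : IsOpen (k ⁻¹' S)) : IsOpen S :=
  isClosed_compl_iff.1 (h.isClosed _ hj.isClosed_compl hk.isClosed_compl)

/-- The trace on `E` of the image of a closed set `S` of `B` is `i(f⁻¹ S)`, again closed. -/
theorem isClosedEmbedding_right (h : IsAdjunctionSpace i f j k) (hi : IsClosedEmbedding i)
    (hf : Continuous f) : IsClosedEmbedding k := by
  refine .of_continuous_injective_isClosedMap h.continuous_right h.injective_right fun S hS => ?_
  refine h.isClosed _ ?_ ?_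
  · have : j ⁻¹' (k '' S) = i '' (f ⁻¹' S) := by
      ext e
      constructor
      · rintro ⟨b, hb, hbe⟩
        obtain ⟨a, rfl⟩ := h.mem_range e b hbe.symm
        rw [h.comm] at hbe
        exact ⟨a, by rwa [mem_preimage, ← h.injective_right hbe], rfl⟩
      · rintro ⟨a, ha, rfl⟩
        exact ⟨f a, ha, (h.comm a).symm⟩
    rw [this]
    exact hi.isClosedMap _ (hS.preimage hf)
  · rwa [h.injective_right.preimage_image]

/-- A set in the complement of the range of `i` that is open in `E` has open image. -/
theorem isOpen_image_left (h : IsAdjunctionSpace i f j k) {U : Set E} (hU : IsOpen U)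
    (hUi : Disjoint U (range i)) : IsOpen (j '' U) := by
  refine h.isOpen ?_ ?_
  · convert hU using 1
    ext e
    constructor
    · rintro ⟨e', he', heq⟩
      rwa [← h.eq_of_left e' e (disjoint_left.1 hUi he') heq]
    · exact fun he => ⟨e, he, rfl⟩
  · convert isOpen_empty
    refine eq_empty_of_forall_notMem ?_
    rintro b ⟨e, he, heb⟩
    exact disjoint_left.1 hUi he (h.mem_range e b heb)

end IsAdjunctionSpace

/-! ### Compact subsets of CW complexes -/

section Compact

variable {X : Type u} [TopologicalSpace X] [CWStructure X]

theorem exists_finite_closedCell_subset {n : ℕ} (e : Cell X n) :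
    ∃ F : Set (Σ m, Cell X m), F.Finite ∧ closedCell n e ⊆ ⋃ c ∈ F, openCell c.1 c.2 := by
  obtain ⟨I, hI⟩ := CWComplex.cellFrontier_subset_finite_openCell n e
  refine ⟨insert ⟨n, e⟩ (⋃ m : Fin n, Sigma.mk (m : ℕ) '' (I m : Set (Cell X m))), ?_, ?_⟩
  · exact (finite_iUnion (ι := Fin n) fun m => (I m).finite_toSet.image _).insert _
  · rw [← cellFrontier_union_openCell_eq_closedCell]
    rintro x (hx | hx)
    · obtain ⟨m, hm, c, hc, hxc⟩ := by simpa only [mem_iUnion, exists_prop] using hI hx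
      exact mem_biUnion (Or.inr (mem_iUnion.2 ⟨⟨m, hm⟩, c, hc, rfl⟩)) hxc
    · exact mem_biUnion (Or.inl rfl) hx

variable [T2Space X]

/-- A compact subset meets only finitely many open cells. -/
theorem finite_setOf_openCell_inter_nonempty {K : Set X} (hK : IsCompact K) :
    {c : Σ n, Cell X n | (openCell c.1 c.2 ∩ K).Nonempty}.Finite := by
  set T := {c : Σ n, Cell X n | (openCell c.1 c.2 ∩ K).Nonempty} with hT
  rcases isEmpty_or_nonempty X with hX | hX
  · convert finite_empty
    exact eq_empty_of_forall_notMem fun c hc => hX.elim hc.some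
  have hTK : ∀ c ∈ T, ∃ x, x ∈ openCell c.1 c.2 ∧ x ∈ K := fun c hc => hc
  choose! p hp hpK using hTK
  have hpinj : InjOn p T := fun c hc c' hc' h =>
    sigma_eq_of_mem_openCell (hp c hc) (h ▸ hp c' hc')
  -- One point is picked in every open cell that meets `K`. Any set of such points meets each closed
  -- cell in finitely many points, so it is closed; an infinite set of them would have an
  -- accumulation point in `K`, which is then impossible.
  have hclosed : ∀ S ⊆ p '' T, IsClosed S := by
    intro S hS
    refine isClosed_of_forall_closedCell fun n e => ?_
    obtain ⟨F, hF, hFe⟩ := exists_finite_closedCell_subset e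
    refine ((hF.image p).subset ?_).isClosed
    rintro x ⟨hx, hxe⟩
    obtain ⟨c, hc, rfl⟩ := hS hx
    obtain ⟨c', hc', hxc'⟩ := by simpa only [mem_iUnion, exists_prop] using hFe hxe
    have hcc : c = c' := sigma_eq_of_mem_openCell (hp c hc) hxc'
    exact ⟨c, hcc ▸ hc', rfl⟩
  by_contra hinf
  obtain ⟨x, -, hx⟩ := (Set.Infinite.image hpinj hinf).exists_accPt_of_subset_isCompact hK
    (by rintro _ ⟨c, hc, rfl⟩; exact hpK c hc)
  rw [accPt_principal_iff_clusterPt, ← mem_closure_iff_clusterPt,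
    (hclosed _ sdiff_subset).closure_eq] at hx
  exact hx.2 rfl

theorem exists_finset_closedCell {K : Set X} (hK : IsCompact K) {n : ℕ} (hn : K ⊆ cellsLT X n) :
    ∃ I : ∀ m, Finset (Cell X m), K ⊆ ⋃ (m < n) (c ∈ I m), closedCell m c := by
  have hfin := finite_setOf_openCell_inter_nonempty hK
  refine ⟨fun m => (hfin.preimage (f := Sigma.mk m) sigma_mk_injective.injOn).toFinset,
    fun x hx => ?_⟩
  obtain ⟨m, hm, c, hc⟩ := hn hx
  simp only [mem_iUnion, exists_prop]
  exact ⟨m, hm, c, by simpa using ⟨x, hc, hx⟩, openCell_subset_closedCell _ _ hc⟩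

end Compact

theorem IsCellular.image_closedCell_subset {X Y : Type u} [TopologicalSpace X] [CWStructure X]
    [TopologicalSpace Y] [CWStructure Y] {f : X → Y} (hf : IsCellular f) {n : ℕ} (e : Cell X n) :
    f '' closedCell n e ⊆ cellsLT Y (n + 1) := by
  rintro _ ⟨x, hx, rfl⟩
  have h1 : x ∈ ⋃ (m ≤ n) (c : Cell X m), closedCell m c := by
    simp only [mem_iUnion, exists_prop]
    exact ⟨n, le_rfl, e, hx⟩
  obtain ⟨m, hm, c, hc⟩ := by simpa only [mem_iUnion, exists_prop] using hf n h1
  exact closedCell_subset_cellsLT (Nat.lt_succ_of_le hm) c hc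

theorem IsCWInclusion.exists_closedCell_eq {A E : Type u} [TopologicalSpace A] [CWStructure A]
    [TopologicalSpace E] [CWStructure E] [T2Space A] [T2Space E] {i : A → E} (hi : IsCWInclusion i)
    {n : ℕ} (e : Cell E n) (he : ¬ Disjoint (openCell n e) (range i)) :
    ∃ c : Cell A n, i '' closedCell n c = closedCell n e := by
  obtain ⟨_, hx, a, rfl⟩ := not_disjoint_iff.1 he
  obtain ⟨c, hc⟩ := hi.exists_image_eq e hx
  refine ⟨c, ?_⟩
  rw [← closure_openCell_eq_closedCell, ← closure_openCell_eq_closedCell, ← hc,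
    hi.isClosedEmbedding.closure_image_eq]

/-! ### The CW structure of a pushout -/

section PushoutCW

variable {A B E X : Type u} [TopologicalSpace A] [TopologicalSpace B] [TopologicalSpace E]
  [TopologicalSpace X] {i : A → E} {f : A → B} {j : E → X} {k : B → X}

theorem IsAdjunctionSpace.injOn_left (h : IsAdjunctionSpace i f j k) : InjOn j (range i)ᶜ :=
  fun e he e' _ hee' => h.eq_of_left e e' he hee'

/-- The partial inverse of the map from `E` to the pushout. -/
def IsAdjunctionSpace.leftEquiv [Nonempty E] (h : IsAdjunctionSpace i f j k) :
    PartialEquiv E X :=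
  h.injOn_left.toPartialEquiv j (range i)ᶜ

theorem IsAdjunctionSpace.continuousOn_leftEquiv_symm [Nonempty E] (h : IsAdjunctionSpace i f j k)
    (hi : IsClosed (range i)) : ContinuousOn h.leftEquiv.symm h.leftEquiv.target := by
  have htarget : h.leftEquiv.target = j '' (range i)ᶜ := rfl
  have hopen : IsOpen h.leftEquiv.target := by
    rw [htarget]
    exact h.isOpen_image_left hi.isOpen_compl disjoint_compl_left
  rw [continuousOn_open_iff hopen]
  intro V hV
  have : h.leftEquiv.target ∩ h.leftEquiv.symm ⁻¹' V = j '' ((range i)ᶜ ∩ V) := by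
    ext x
    constructor
    · rintro ⟨hx, hxV⟩
      exact ⟨h.leftEquiv.symm x, ⟨h.leftEquiv.map_target hx, hxV⟩, h.leftEquiv.right_inv hx⟩
    · rintro ⟨e, ⟨he, heV⟩, rfl⟩
      refine ⟨⟨e, he, rfl⟩, ?_⟩
      have h1 : h.leftEquiv.symm (j e) = e := h.leftEquiv.left_inv he
      rwa [mem_preimage, h1]
  rw [this]
  exact h.isOpen_image_left (hi.isOpen_compl.inter hV)
    (disjoint_compl_left.mono_left inter_subset_left)

variable [CWStructure B] [CWStructure E]

/-- The cells of a pushout: the cells of `E` outside the image of `A` and the cells of `B`. -/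
abbrev AdjunctionCell (B : Type u) [TopologicalSpace B] [CWStructure B] (i : A → E) (n : ℕ) :
    Type u :=
  {e : Cell E n // Disjoint (openCell n e) (range i)} ⊕ Cell B n

/-- The characteristic maps of the cells of a pushout. -/
def IsAdjunctionSpace.cellMap (h : IsAdjunctionSpace i f j k) (n : ℕ) :
    AdjunctionCell B i n → PartialEquiv (Fin n → ℝ) X
  | Sum.inl e =>
    haveI : Nonempty E := ⟨map n e.1 0⟩
    (map n e.1).trans h.leftEquiv
  | Sum.inr b =>
    haveI : Nonempty B := ⟨map n b 0⟩
    (map n b).trans (h.injective_right.injOn.toPartialEquiv k univ)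

theorem IsAdjunctionSpace.cellMap_inl (h : IsAdjunctionSpace i f j k) {n : ℕ}
    (e : {e : Cell E n // Disjoint (openCell n e) (range i)}) (x : Fin n → ℝ) :
    h.cellMap n (Sum.inl e) x = j (map n e.1 x) := rfl

theorem IsAdjunctionSpace.cellMap_inr (h : IsAdjunctionSpace i f j k) {n : ℕ}
    (b : Cell B n) (x : Fin n → ℝ) : h.cellMap n (Sum.inr b) x = k (map n b x) := rfl

theorem IsAdjunctionSpace.cellMap_inl_image (h : IsAdjunctionSpace i f j k) {n : ℕ}
    (e : {e : Cell E n // Disjoint (openCell n e) (range i)}) (S : Set (Fin n → ℝ)) :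
    h.cellMap n (Sum.inl e) '' S = j '' (map n e.1 '' S) := by
  rw [image_image]
  rfl

theorem IsAdjunctionSpace.cellMap_inr_image (h : IsAdjunctionSpace i f j k) {n : ℕ}
    (b : Cell B n) (S : Set (Fin n → ℝ)) :
    h.cellMap n (Sum.inr b) '' S = k '' (map n b '' S) := by
  rw [image_image]
  rfl

theorem IsAdjunctionSpace.pairwiseDisjoint_cellMap (h : IsAdjunctionSpace i f j k) :
    (univ : Set (Σ n, AdjunctionCell B i n)).PairwiseDisjoint
      fun c => h.cellMap c.1 c.2 '' ball 0 1 := by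
  have hmix : ∀ n m (e : {e : Cell E n // Disjoint (openCell n e) (range i)}) (b : Cell B m),
      Disjoint (j '' (map n e.1 '' ball 0 1)) (k '' (map m b '' ball 0 1)) := by
    intro n m e b
    refine disjoint_left.2 ?_
    rintro _ ⟨y, hy, rfl⟩ ⟨z, -, hz⟩
    exact disjoint_left.1 e.2 hy (h.mem_range y z hz.symm)
  rintro ⟨n, e | b⟩ - ⟨m, e' | b'⟩ - hne
  · refine disjoint_left.2 ?_
    rintro _ ⟨x, hx, rfl⟩ ⟨y, hy, hxy⟩
    rw [h.cellMap_inl, h.cellMap_inl] at hxy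
    have h1 := h.eq_of_left _ _ (disjoint_left.1 e'.2 (map_mem_openCell e'.1 hy)) hxy
    have h2 := sigma_eq_of_mem_openCell (map_mem_openCell e.1 hx)
      (h1 ▸ map_mem_openCell e'.1 hy)
    obtain ⟨e, he⟩ := e
    obtain ⟨e', he'⟩ := e'
    cases h2
    exact hne rfl
  · simp only [Function.onFun, h.cellMap_inl_image, h.cellMap_inr_image]
    exact hmix n m e b'
  · simp only [Function.onFun, h.cellMap_inl_image, h.cellMap_inr_image]
    exact (hmix m n e' b).symm
  · refine disjoint_left.2 ?_
    rintro _ ⟨x, hx, rfl⟩ ⟨y, hy, hxy⟩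
    rw [h.cellMap_inr, h.cellMap_inr] at hxy
    have h2 := sigma_eq_of_mem_openCell (map_mem_openCell b hx)
      (h.injective_right hxy ▸ map_mem_openCell b' hy)
    cases h2
    exact hne rfl

variable [CWStructure A] [T2Space A] [T2Space B] [T2Space E]

/-- A cell outside `A` survives as a cell of the pushout. A cell of `A` is sent through `f` to a
compact subset of the `n`-skeleton of `B`, by cellularity, and a compact set meets only finitely
many open cells. -/
theorem IsAdjunctionSpace.exists_finset_image_closedCell (h : IsAdjunctionSpace i f j k)
    (hi : IsCWInclusion i) (hf : IsCellular f) (hfc : Continuous f) {n : ℕ} (e : Cell E n) :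
    ∃ I : ∀ m, Finset (AdjunctionCell B i m), j '' closedCell n e ⊆
      ⋃ (m < n + 1) (c ∈ I m), h.cellMap m c '' closedBall 0 1 := by
  classical
  by_cases he : Disjoint (openCell n e) (range i)
  · refine ⟨fun m => if hm : m = n then {hm ▸ Sum.inl ⟨e, he⟩} else ∅, fun x hx => ?_⟩
    simp only [mem_iUnion, exists_prop]
    refine ⟨n, Nat.lt_succ_self n, Sum.inl ⟨e, he⟩, by simp, ?_⟩
    rwa [h.cellMap_inl_image]
  · obtain ⟨c, hc⟩ := hi.exists_closedCell_eq e he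
    obtain ⟨I, hI⟩ := exists_finset_closedCell
      ((isCompact_closedCell (i := c)).image hfc) (hf.image_closedCell_subset c)
    refine ⟨fun m => (I m).map ⟨Sum.inr, Sum.inr_injective⟩, ?_⟩
    rw [← hc]
    rintro _ ⟨_, ⟨a, ha, rfl⟩, rfl⟩
    obtain ⟨m, hm, b, hb, y, hy, hyb⟩ := by
      simpa only [mem_iUnion, exists_prop] using hI ⟨a, ha, rfl⟩
    simp only [mem_iUnion, exists_prop]
    refine ⟨m, hm, Sum.inr b, Finset.mem_map.2 ⟨b, hb, rfl⟩, y, hy, ?_⟩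
    rw [h.cellMap_inr, hyb, h.comm]

theorem IsAdjunctionSpace.exists_finset_cellFrontier (h : IsAdjunctionSpace i f j k)
    (hi : IsCWInclusion i) (hf : IsCellular f) (hfc : Continuous f) {n : ℕ}
    (c : AdjunctionCell B i n) :
    ∃ I : ∀ m, Finset (AdjunctionCell B i m), MapsTo (h.cellMap n c) (sphere 0 1)
      (⋃ (m < n) (c ∈ I m), h.cellMap m c '' closedBall 0 1) := by
  classical
  rcases c with e | b
  · obtain ⟨I, hI⟩ := CWComplex.mapsTo n e.1
    choose J hJ using fun (m : ℕ) (c : Cell E m) =>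
      h.exists_finset_image_closedCell hi hf hfc c
    refine ⟨fun m' => (Finset.range n).biUnion fun m => (I m).biUnion fun c => J m c m',
      fun x hx => ?_⟩
    obtain ⟨m, hm, c, hc, hxc⟩ := by simpa only [mem_iUnion, exists_prop] using hI hx
    obtain ⟨m', hm', c', hc', hxc'⟩ := by
      simpa only [mem_iUnion, exists_prop] using hJ m c ⟨_, hxc, rfl⟩
    simp only [mem_iUnion, exists_prop]
    -- From `m < n` and `m' < m + 1` one gets `m' < n`: passing through a cellular map does not
    -- raise dimensions.
    refine ⟨m', by omega, c', ?_, hxc'⟩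
    exact Finset.mem_biUnion.2 ⟨m, Finset.mem_range.2 hm, Finset.mem_biUnion.2 ⟨c, hc, hc'⟩⟩
  · obtain ⟨I, hI⟩ := CWComplex.mapsTo n b
    refine ⟨fun m => (I m).map ⟨Sum.inr, Sum.inr_injective⟩, fun x hx => ?_⟩
    obtain ⟨m, hm, c, hc, y, hy, hyx⟩ := by simpa only [mem_iUnion, exists_prop] using hI hx
    simp only [mem_iUnion, exists_prop]
    exact ⟨m, hm, Sum.inr c, Finset.mem_map.2 ⟨c, hc, rfl⟩, y, hy, congrArg k hyx⟩

/-- The cells of `B` show that `k⁻¹ S` is closed. This settles the cells of `E` lying in `A`, where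
`j⁻¹ S` is `i(f⁻¹(k⁻¹ S))`; the other cells of `E` are cells of the pushout. -/
theorem IsAdjunctionSpace.isClosed_of_cellMap (h : IsAdjunctionSpace i f j k)
    (hi : IsCWInclusion i) (hfc : Continuous f) {S : Set X}
    (hS : ∀ n (c : AdjunctionCell B i n), IsClosed (S ∩ h.cellMap n c '' closedBall 0 1)) :
    IsClosed S := by
  have hk : IsClosed (k ⁻¹' S) := by
    refine isClosed_of_forall_closedCell fun n b => ?_
    convert (hS n (Sum.inr b)).preimage h.continuous_right using 1
    rw [h.cellMap_inr_image, preimage_inter, h.injective_right.preimage_image]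
    rfl
  refine h.isClosed S (isClosed_of_forall_closedCell fun n e => ?_) hk
  by_cases he : Disjoint (openCell n e) (range i)
  · convert ((hS n (Sum.inl ⟨e, he⟩)).preimage h.continuous_left).inter
      (isClosed_closedCell (i := e)) using 1
    rw [h.cellMap_inl_image]
    ext y
    constructor
    · rintro ⟨hy, hye⟩
      exact ⟨⟨hy, y, hye, rfl⟩, hye⟩
    · rintro ⟨⟨hy, -⟩, hye⟩
      exact ⟨hy, hye⟩
  · obtain ⟨c, hc⟩ := hi.exists_closedCell_eq e he
    have h1 : j ⁻¹' S ∩ closedCell n e = i '' (f ⁻¹' (k ⁻¹' S)) ∩ closedCell n e := by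
      rw [← hc]
      ext y
      constructor
      · rintro ⟨hy, a, ha, rfl⟩
        rw [mem_preimage, h.comm] at hy
        exact ⟨⟨a, hy, rfl⟩, a, ha, rfl⟩
      · rintro ⟨⟨a, ha, rfl⟩, hy⟩
        refine ⟨?_, hy⟩
        rw [mem_preimage, h.comm]
        exact ha
    rw [h1]
    exact (hi.isClosedEmbedding.isClosedMap _ (hk.preimage hfc)).inter isClosed_closedCell

/-- The CW structure of a pushout along the inclusion of a subcomplex and a cellular map. -/
abbrev IsAdjunctionSpace.cwStructure (h : IsAdjunctionSpace i f j k) (hi : IsCWInclusion i)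
    (hf : IsCellular f) (hfc : Continuous f) : CWStructure X where
  cell := AdjunctionCell B i
  map := h.cellMap
  source_eq n c := by
    rcases c with e | b
    · change (map n e.1).source ∩ map n e.1 ⁻¹' (range i)ᶜ = _
      rw [RelCWComplex.source_eq, inter_eq_left]
      exact fun x hx => disjoint_left.1 e.2 (map_mem_openCell e.1 hx)
    · change _ ∩ _ ⁻¹' univ = _
      rw [preimage_univ, inter_univ]
      exact RelCWComplex.source_eq n b
  continuousOn n c := by
    rcases c with e | b
    · exact h.continuous_left.comp_continuousOn (RelCWComplex.continuousOn n e.1)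
    · exact h.continuous_right.comp_continuousOn (RelCWComplex.continuousOn n b)
  continuousOn_symm n c := by
    rcases c with e | b
    · have : Nonempty E := ⟨map n e.1 0⟩
      exact ContinuousOn.comp (g := (map n e.1).symm) (f := h.leftEquiv.symm)
        (RelCWComplex.continuousOn_symm n e.1)
        ((h.continuousOn_leftEquiv_symm hi.isClosedEmbedding.isClosed_range).mono fun x hx => hx.1)
        fun x hx => hx.2
    · have : Nonempty B := ⟨map n b 0⟩
      have hk := h.isClosedEmbedding_right hi.isClosedEmbedding hfc
      refine ContinuousOn.comp (g := (map n b).symm)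
        (f := (h.injective_right.injOn.toPartialEquiv k univ).symm)
        (RelCWComplex.continuousOn_symm n b) ?_ fun x hx => hx.2
      rw [hk.isEmbedding.isInducing.continuousOn_iff]
      refine continuousOn_id.congr fun x hx => ?_
      exact (h.injective_right.injOn.toPartialEquiv k univ).right_inv hx.1
  pairwiseDisjoint' := h.pairwiseDisjoint_cellMap
  mapsTo' _ c := h.exists_finset_cellFrontier hi hf hfc c
  closed' _ _ hS := h.isClosed_of_cellMap hi hfc hS
  union' := by
    refine eq_univ_of_forall fun x => ?_
    simp only [mem_iUnion]
    rcases h.exists_eq' x with ⟨y, hy, rfl⟩ | ⟨y, rfl⟩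
    · obtain ⟨n, e, he⟩ := exists_mem_openCell y
      refine ⟨n, Sum.inl ⟨e, (hi.subset_or_disjoint e).resolve_left fun h' => hy (h' he)⟩, ?_⟩
      rw [h.cellMap_inl_image]
      exact ⟨y, openCell_subset_closedCell _ _ he, rfl⟩
    · obtain ⟨n, e, he⟩ := exists_mem_openCell y
      refine ⟨n, Sum.inr e, ?_⟩
      rw [h.cellMap_inr_image]
      exact ⟨y, openCell_subset_closedCell _ _ he, rfl⟩

theorem IsAdjunctionSpace.isCellular_right (h : IsAdjunctionSpace i f j k) (hi : IsCWInclusion i)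
    (hf : IsCellular f) (hfc : Continuous f) :
    @IsCellular B X _ _ _ (h.cwStructure hi hf hfc) k := by
  let _ := h.cwStructure hi hf hfc
  intro n y hy
  obtain ⟨m, hm, b, x, hx, rfl⟩ := by simpa only [mem_iUnion, exists_prop] using hy
  simp only [mem_iUnion, exists_prop]
  exact ⟨m, hm, Sum.inr b, x, hx, rfl⟩

theorem IsAdjunctionSpace.isCellular_left (h : IsAdjunctionSpace i f j k) (hi : IsCWInclusion i)
    (hf : IsCellular f) (hfc : Continuous f) :
    @IsCellular E X _ _ _ (h.cwStructure hi hf hfc) j := by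
  let _ := h.cwStructure hi hf hfc
  intro n y hy
  obtain ⟨m, hm, e, hye⟩ := by simpa only [mem_iUnion, exists_prop] using hy
  obtain ⟨I, hI⟩ := h.exists_finset_image_closedCell hi hf hfc e
  obtain ⟨m', hm', c, -, hc⟩ := by simpa only [mem_iUnion, exists_prop] using hI ⟨y, hye, rfl⟩
  simp only [mem_iUnion, exists_prop]
  exact ⟨m', by omega, c, hc⟩

end PushoutCW

/-! ### Pushouts of CW complexes are Hausdorff -/

section Hausdorff

/-- The trivial action. -/
@[reducible]
def trivialAction (G X : Type*) [Group G] : MulAction G X where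
  smul _ x := x
  one_smul _ := rfl
  mul_smul _ _ _ := rfl

/-- The homotopy extension property of the inclusion of a subcomplex, with values in a given
set. -/
theorem IsCWInclusion.exists_homotopy_extension {A E Z : Type u} [TopologicalSpace A]
    [CWStructure A] [TopologicalSpace E] [CWStructure E] [T2Space E] [TopologicalSpace Z]
    {i : A → E} (hi : IsCWInclusion i) (C : Set Z) (f : E → Z) (hf : Continuous f)
    (hfC : ∀ e, f e ∈ C) (h : A → C(unitInterval, Z)) (hh : Continuous h)
    (hhC : ∀ a t, h a t ∈ C) (h0 : ∀ a, h a 0 = f (i a)) :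
    ∃ γ : E → C(unitInterval, Z), Continuous γ ∧ (∀ e, γ e 0 = f e) ∧ (∀ e t, γ e t ∈ C) ∧
      ∀ a, γ (i a) = h a := by
  -- The non-equivariant statement is the equivariant one for the trivial group.
  let _ : MulAction PUnit.{u + 1} A := trivialAction _ _
  let _ : MulAction PUnit.{u + 1} E := trivialAction _ _
  let _ : MulAction PUnit.{u + 1} Z := trivialAction _ _
  have : ContinuousConstSMul PUnit.{u + 1} Z := ⟨fun _ => continuous_id⟩
  have : IsGCWComplex PUnit.{u + 1} E :=
    ⟨inferInstance, ⟨fun _ => continuous_id⟩, fun _ _ e => ⟨e, fun _ _ => rfl⟩⟩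
  let i' : GMap PUnit.{u + 1} A E := ⟨⟨i, hi.isClosedEmbedding.continuous⟩, fun _ _ => rfl⟩
  obtain ⟨γ, hγ, -, hγ0, hγC, hγi⟩ := EquivariantCW.exists_homotopy_extension i' hi C
    (fun _ _ hz => hz) ⟨⟨f, hf⟩, fun _ _ => rfl⟩ hfC h hh (fun _ _ _ => rfl) hhC h0
  exact ⟨γ, hγ, hγ0, hγC, hγi⟩

variable {A B E X : Type u} [TopologicalSpace A] [TopologicalSpace B] [TopologicalSpace E]
  [TopologicalSpace X] {i : A → E} {f : A → B} {j : E → X} {k : B → X}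

/-- Compatible open subsets of `E` and `B` are the traces of an open subset of the pushout. -/
theorem IsAdjunctionSpace.exists_isOpen (h : IsAdjunctionSpace i f j k) {V : Set E} {U : Set B}
    (hV : IsOpen V) (hU : IsOpen U) (hVU : ∀ a, i a ∈ V ↔ f a ∈ U) :
    ∃ W : Set X, IsOpen W ∧ (∀ e, j e ∈ W ↔ e ∈ V) ∧ ∀ b, k b ∈ W ↔ b ∈ U := by
  obtain ⟨d, hd, hd'⟩ := h.exists_desc (fun e => e ∈ V) (fun b => b ∈ U)
    fun a => propext (hVU a)
  have h1 : ∀ e, j e ∈ {x | d x} ↔ e ∈ V := fun e => iff_of_eq (hd e)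
  have h2 : ∀ b, k b ∈ {x | d x} ↔ b ∈ U := fun b => iff_of_eq (hd' b)
  refine ⟨{x | d x}, h.isOpen ?_ ?_, h1, h2⟩
  · convert hV using 1
    exact Set.ext h1
  · convert hU using 1
    exact Set.ext h2

/-- Homotopy extension yields a map from `E × [0, 1]` to the union of `E × 0` and `A × [0, 1]` that
restricts to the identity there. Its height coordinate measures closeness to `A`, and its first
coordinate retracts the points of positive height to `A`; together they spread open sets of `B` to
open sets of `X`. -/
theorem IsAdjunctionSpace.t2Space [CWStructure A] [CWStructure E] [T2Space E] [T2Space B]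
    (h : IsAdjunctionSpace i f j k) (hi : IsCWInclusion i) (hf : Continuous f) : T2Space X := by
  have hicl : IsClosed (range i) := hi.isClosedEmbedding.isClosed_range
  obtain ⟨γ, hγ, hγ0, hγC, hγi⟩ := hi.exists_homotopy_extension
    (Z := E × unitInterval) {p | p.2 = 0 ∨ p.1 ∈ range i} (fun e => (e, 0)) (by fun_prop)
    (fun e => Or.inl rfl)
    (fun a => ⟨fun t => (i a, t), by fun_prop⟩)
    (ContinuousMap.curry ⟨fun p : A × unitInterval => (i p.1, p.2),
      (hi.isClosedEmbedding.continuous.comp continuous_fst).prodMk continuous_snd⟩).continuous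
    (fun a t => Or.inr ⟨a, rfl⟩) (fun a => rfl)
  have hγi' : ∀ a t, γ (i a) t = (i a, t) := fun a t => by rw [hγi]; rfl
  have hev : ∀ t, Continuous fun e => γ e t := fun t => hγ.eval_const t
  have key : ∀ e ∉ range i, ∀ b, ∃ W W' : Set X, IsOpen W ∧ IsOpen W' ∧ j e ∈ W ∧ k b ∈ W' ∧
      Disjoint W W' := by
    intro e he b
    -- Otherwise the path of `e` stays in the closed set `i(A)` at all positive times, hence also at
    -- time `0`, where it is at `e`.
    obtain ⟨t, ht, hte⟩ : ∃ t : unitInterval, 0 < t ∧ (γ e t).2 = 0 := by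
      by_contra! hne
      have h1 : IsClosed {t : unitInterval | (γ e t).1 ∈ range i} :=
        hicl.preimage (continuous_fst.comp (γ e).continuous)
      have h2 : Ioi (0 : unitInterval) ⊆ {t | (γ e t).1 ∈ range i} := fun t ht =>
        (hγC e t).resolve_left (hne t ht)
      have h3 : (0 : unitInterval) ∈ closure (Ioi 0) := by
        rw [closure_Ioi' ⟨1, zero_lt_one⟩]
        exact self_mem_Ici
      have h4 := h1.closure_subset_iff.2 h2 h3
      rw [mem_ofPred_eq, hγ0] at h4
      exact he h4
    obtain ⟨s, hs0, hst⟩ := exists_between ht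
    -- At time `t` the height is `0` at `e` and `t` on all of `i(A)`, so any level `s` strictly in
    -- between separates `e` from `B`.
    obtain ⟨W', hW', hjW', hkW'⟩ := h.exists_isOpen (V := {e' | s < (γ e' t).2}) (U := univ)
      (isOpen_lt continuous_const (continuous_snd.comp (hev t))) isOpen_univ fun a => by
        simp only [mem_ofPred_eq, hγi', hst, mem_univ]
    refine ⟨j '' ({e' | (γ e' t).2 < s} ∩ (range i)ᶜ), W', ?_, hW', ⟨e, ⟨?_, he⟩, rfl⟩,
      (hkW' b).2 trivial, ?_⟩
    · exact h.isOpen_image_left ((isOpen_lt (continuous_snd.comp (hev t)) continuous_const).inter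
        hicl.isOpen_compl) (disjoint_compl_left.mono_left inter_subset_right)
    · simpa only [mem_ofPred_eq, hte] using hs0
    · refine disjoint_left.2 ?_
      rintro _ ⟨e', ⟨he', -⟩, rfl⟩ hW
      have h1 : s < (γ e' t).2 := (hjW' e').1 hW
      exact lt_asymm h1 he'
  refine ⟨fun x y hxy => ?_⟩
  rcases h.exists_eq' x with ⟨e, he, rfl⟩ | ⟨b, rfl⟩ <;>
    rcases h.exists_eq' y with ⟨e', he', rfl⟩ | ⟨b', rfl⟩
  · have hne : e ≠ e' := fun h' => hxy (congrArg j h')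
    obtain ⟨U, U', hU, hU', heU, heU', hd⟩ := t2_separation hne
    refine ⟨j '' (U ∩ (range i)ᶜ), j '' (U' ∩ (range i)ᶜ),
      h.isOpen_image_left (hU.inter hicl.isOpen_compl)
        (disjoint_compl_left.mono_left inter_subset_right),
      h.isOpen_image_left (hU'.inter hicl.isOpen_compl)
        (disjoint_compl_left.mono_left inter_subset_right),
      ⟨e, ⟨heU, he⟩, rfl⟩, ⟨e', ⟨heU', he'⟩, rfl⟩, disjoint_left.2 ?_⟩
    rintro _ ⟨y, ⟨hy, hyi⟩, rfl⟩ ⟨y', ⟨hy', -⟩, hyy⟩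
    rw [← h.eq_of_left _ _ hyi hyy.symm] at hy'
    exact disjoint_left.1 hd hy hy'
  · exact key e he b'
  · obtain ⟨W, W', hW, hW', h1, h2, hd⟩ := key e' he' b
    exact ⟨W', W, hW', hW, h2, h1, hd.symm⟩
  · have hne : b ≠ b' := fun h' => hxy (congrArg k h')
    obtain ⟨U, U', hU, hU', hbU, hbU', hd⟩ := t2_separation hne
    have hO : ∀ U : Set B, IsOpen U → ∃ O : Set E, IsOpen O ∧ ∀ a, i a ∈ O ↔ f a ∈ U := by
      intro U hU
      obtain ⟨O, hO, hOU⟩ := hi.isClosedEmbedding.isInducing.isOpen_iff.1 (hU.preimage hf)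
      exact ⟨O, hO, fun a => Set.ext_iff.1 hOU a⟩
    obtain ⟨O, hO₁, hO₂⟩ := hO U hU
    obtain ⟨O', hO₁', hO₂'⟩ := hO U' hU'
    -- Positive height at time `1` forces the first coordinate into `i(A)`, so the disjointness of
    -- two such sets can be checked in `B`.
    have hW : ∀ (O : Set E) (U : Set B), IsOpen O → IsOpen U → (∀ a, i a ∈ O ↔ f a ∈ U) →
        ∃ W : Set X, IsOpen W ∧ (∀ e, j e ∈ W ↔ 0 < (γ e 1).2 ∧ (γ e 1).1 ∈ O) ∧
          ∀ b, k b ∈ W ↔ b ∈ U := by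
      intro O U hO hU hOU
      refine h.exists_isOpen (V := {e | 0 < (γ e 1).2 ∧ (γ e 1).1 ∈ O}) ?_ hU fun a => ?_
      · exact (isOpen_lt continuous_const (continuous_snd.comp (hev 1))).inter
          (hO.preimage (continuous_fst.comp (hev 1)))
      · simp only [mem_ofPred_eq, hγi', zero_lt_one, true_and, hOU]
    obtain ⟨W, hW₁, hWj, hWk⟩ := hW O U hO₁ hU hO₂
    obtain ⟨W', hW₁', hWj', hWk'⟩ := hW O' U' hO₁' hU' hO₂'
    refine ⟨W, W', hW₁, hW₁', (hWk b).2 hbU, (hWk' b').2 hbU', disjoint_left.2 fun x hx hx' => ?_⟩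
    rcases h.exists_eq x with ⟨e, rfl⟩ | ⟨b, rfl⟩
    · obtain ⟨h1, h2⟩ := (hWj e).1 hx
      obtain ⟨-, h3⟩ := (hWj' e).1 hx'
      obtain ⟨a, ha⟩ := (hγC e 1).resolve_left h1.ne'
      rw [← ha] at h2 h3
      exact disjoint_left.1 hd ((hO₂ a).1 h2) ((hO₂' a).1 h3)
    · exact disjoint_left.1 hd ((hWk b).1 hx) ((hWk' b).1 hx')

end Hausdorff

/-! ### The pushout as a `G`-CW-complex. -/

section GPushoutCW

variable {G : Type u} [Group G] {A B E X : Type u} [TopologicalSpace A] [MulAction G A]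
  [TopologicalSpace B] [MulAction G B] [TopologicalSpace E] [MulAction G E] [TopologicalSpace X]
  [MulAction G X]

theorem GMap.smul_mem_range (i : GMap G A E) {g : G} {e : E} (h : e ∈ range i) :
    g • e ∈ range i := by
  obtain ⟨a, rfl⟩ := h
  exact ⟨g • a, i.map_smul g a⟩

variable [CWStructure A] [CWStructure B] [CWStructure E]

theorem IsAdjunctionSpace.isGCWComplex [IsGCWComplex G B]
    [IsGCWComplex G E] [ContinuousConstSMul G X] [T2Space A] [T2Space B] [T2Space E]
    {i : GMap G A E} {f : GMap G A B} {j : GMap G E X} {k : GMap G B X}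
    (h : IsAdjunctionSpace i f j k) (hi : IsCWInclusion i) (hf : IsCellular f) :
    @IsGCWComplex G _ X _ _ (h.cwStructure hi hf f.continuous) := by
  let _ := h.cwStructure hi hf f.continuous
  refine ⟨h.t2Space hi f.continuous, inferInstance, fun g n c => ?_⟩
  rcases c with ⟨e, he⟩ | b
  · have he' : Disjoint (openCell n (smulCell g e)) (range i) := by
      refine disjoint_left.2 fun y hy hyi => ?_
      obtain ⟨x, hx, rfl⟩ := hy
      rw [map_smulCell g e (ball_subset_closedBall hx)] at hyi
      have h1 := i.smul_mem_range (g := g⁻¹) hyi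
      rw [inv_smul_smul] at h1
      exact disjoint_left.1 he (map_mem_openCell e hx) h1
    refine ⟨Sum.inl ⟨smulCell g e, he'⟩, fun x hx => ?_⟩
    change j (map n (smulCell g e) x) = g • j (map n e x)
    rw [map_smulCell g e hx, j.map_smul]
  · refine ⟨Sum.inr (smulCell g b), fun x hx => ?_⟩
    change k (map n (smulCell g b) x) = g • k (map n b x)
    rw [map_smulCell g b hx, k.map_smul]

end GPushoutCW

/-! ### Contractibility of pushouts -/

section Contractible

variable {G : Type u} [Group G]

theorem IsGCWComplex.restrict {Y : Type u} [TopologicalSpace Y] [MulAction G Y] [CWStructure Y]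
    (h : IsGCWComplex G Y) (H : Subgroup G) : IsGCWComplex H Y where
  t2 := h.t2
  continuous_smul := ⟨fun g => h.continuous_smul.continuous_const_smul (g : G)⟩
  exists_smul_cell g n e := h.exists_smul_cell (g : G) n e

/-- A `G`-space is `G`-contractible if the identity is `G`-homotopic to a constant map. -/
def IsGContractible (G : Type u) [Group G] (X : Type u) [TopologicalSpace X] [MulAction G X] :
    Prop :=
  ∃ (x : X) (hx : ∀ g : G, g • x = x), GHomotopic (GMap.id G X) (GMap.const X x hx)

/-- An equivariant homotopy preserves fixed points, so it contracts the fixed set within itself. -/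
theorem IsGContractible.fillable {X : Type u} [TopologicalSpace X] [MulAction G X]
    (h : IsGContractible G X) : Fillable {x : X | ∀ g : G, g • x = x} := by
  obtain ⟨x, hx, h⟩ := h
  obtain ⟨γ, hγ, h0, h1, hG⟩ := h.symm.exists_path
  exact fillable_of_contraction hx γ hγ h0 h1 fun z hz t g => by rw [← hG, hz]

theorem IsGContractible.fillable_fixedSet {X : Type u} [TopologicalSpace X] [MulAction G X]
    {H : Subgroup G} (h : IsGContractible H X) : Fillable (fixedSet H X) := by
  convert h.fillable using 1
  ext x
  exact ⟨fun hx g => hx g g.2, fun hx g hg => hx ⟨g, hg⟩⟩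

/-- A `G`-CW-complex over a discrete `G`-set `J` whose fibres have fillable fixed sets deforms
over `J` to a section. -/
theorem exists_deformation_to_section {A : Type u} [TopologicalSpace A] [MulAction G A]
    [CWStructure A] [IsGCWComplex G A] {J : Type*} [MulAction G J] (π : A → J)
    (hπ : IsLocallyConstant π) (hπG : ∀ (g : G) a, π (g • a) = g • π a)
    (hfill : ∀ (K : Subgroup G) (z : J), (∀ g ∈ K, g • z = z) →
      Fillable (fixedSet K A ∩ {a | π a = z})) :
    ∃ (σ : J → A) (γ : A → C(unitInterval, A)), (∀ z, π (σ z) = z) ∧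
      (∀ (g : G) z, σ (g • z) = g • σ z) ∧ Continuous γ ∧ (∀ a, γ a 0 = a) ∧
      (∀ a, γ a 1 = σ (π a)) ∧ (∀ (g : G) a t, γ (g • a) t = g • γ a t) ∧
      ∀ a t, π (γ a t) = π a := by
  have : ContinuousConstSMul G A := IsGCWComplex.continuous_smul
  -- The point over `z` can be taken fixed by the stabilizer of `z`, because the corresponding fixed
  -- set of the fibre is nonempty; this makes the section equivariant.
  obtain ⟨σ, hσ, hσG⟩ := exists_equivariant_choice (G := G) (fun z : J => {a : A | π a = z})
    (fun g z a ha => by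
      change π (g • a) = g • z
      rw [hπG]
      exact congrArg _ ha)
    (fun z => by
      obtain ⟨a, ha, haz⟩ := (hfill (MulAction.stabilizer G z) z fun g hg => hg).nonempty
      exact ⟨a, haz, fun g hg => ha g hg⟩)
  let s : GMap G A A :=
    { toFun := fun a => σ (π a)
      continuous_toFun := (hπ.comp σ).continuous
      map_smul := fun g a => by rw [hπG, hσG] }
  obtain ⟨γ, hγ, h0, h1, hG, hγπ⟩ := exists_homotopy_over π hπ hπG (GMap.id G A) s
    (fun a => hσ (π a)) fun a => hfill (MulAction.stabilizer G a) (π a) fun g hg => by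
      rw [← hπG, MulAction.mem_stabilizer_iff.1 hg]
  exact ⟨σ, γ, hσ, hσG, hγ, h0, h1, hG, hγπ⟩

variable {A B E X : Type u} [TopologicalSpace A] [MulAction G A] [TopologicalSpace B]
  [MulAction G B] [TopologicalSpace E] [MulAction G E] [TopologicalSpace X] [MulAction G X]

/-- The equivariant map on a pushout given by compatible equivariant maps. -/
theorem IsAdjunctionSpace.exists_equivariant_desc {i : GMap G A E} {f : GMap G A B}
    {j : GMap G E X} {k : GMap G B X} (h : IsAdjunctionSpace i f j k) {Z : Type u}
    [TopologicalSpace Z] [SMul G Z] (v : E → Z) (w : B → Z) (hv : Continuous v)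
    (hw : Continuous w) (hvG : ∀ (g : G) e, v (g • e) = g • v e)
    (hwG : ∀ (g : G) b, w (g • b) = g • w b) (hvw : ∀ a, v (i a) = w (f a)) :
    ∃ d : X → Z, Continuous d ∧ (∀ (g : G) x, d (g • x) = g • d x) ∧ (∀ e, d (j e) = v e) ∧
      ∀ b, d (k b) = w b := by
  obtain ⟨d, hd, hd'⟩ := h.exists_desc v w hvw
  refine ⟨d, h.continuous_of_comp ?_ ?_, fun g x => ?_, hd, hd'⟩
  · exact hv.congr fun e => (hd e).symm
  · exact hw.congr fun b => (hd' b).symm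
  · rcases h.exists_eq x with ⟨e, rfl⟩ | ⟨b, rfl⟩
    · rw [← j.map_smul]
      exact (hd _).trans ((hvG g e).trans (congrArg _ (hd e).symm))
    · rw [← k.map_smul]
      exact (hd' _).trans ((hwG g b).trans (congrArg _ (hd' b).symm))

variable [CWStructure A] [IsGCWComplex G A] [CWStructure B] [IsGCWComplex G B] [CWStructure E]
  [IsGCWComplex G E] [ContinuousConstSMul G X]

/-- The pushout of a contractible complex `E` along the inclusion of a subcomplex `A` and a map
`A → B` is contractible if `A` and `B` both deform over a discrete set `J` to a section. -/
theorem IsAdjunctionSpace.isGContractible {i : GMap G A E} {f : GMap G A B}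
    {j : GMap G E X} {k : GMap G B X} (h : IsAdjunctionSpace i f j k) (hi : IsCWInclusion i)
    (hE : IsGContractible G E) {J : Type*} [MulAction G J] (π : B → J)
    (hπ : IsLocallyConstant π) (hπG : ∀ (g : G) b, π (g • b) = g • π b)
    (hA : ∀ (K : Subgroup G) (z : J), (∀ g ∈ K, g • z = z) →
      Fillable (fixedSet K A ∩ {a | π (f a) = z}))
    (hB : ∀ (K : Subgroup G) (z : J), (∀ g ∈ K, g • z = z) →
      Fillable (fixedSet K B ∩ {b | π b = z})) : IsGContractible G X := by
  have : ContinuousConstSMul G E := IsGCWComplex.continuous_smul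
  obtain ⟨σA, γA, hσA, hσAG, hγA, hγA0, hγA1, hγAG, hγAπ⟩ :=
    exists_deformation_to_section (fun a => π (f a)) (hπ.comp_continuous f.continuous)
      (fun g a => by rw [f.map_smul, hπG]) hA
  obtain ⟨σB, γB, hσB, hσBG, hγB, hγB0, hγB1, hγBG, hγBπ⟩ :=
    exists_deformation_to_section π hπ hπG hB
  -- a deformation of `X` that contracts the fibres of `B`
  have hkc : Continuous fun b => k.toContinuousMap.comp (γB b) :=
    (ContinuousMap.continuous_postcomp k.toContinuousMap).comp hγB
  obtain ⟨R₁, hR₁, hR₁G, hR₁0, -, hR₁i⟩ := exists_homotopy_extension i hi univ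
    (fun _ _ _ => trivial) j (fun _ => trivial) (fun a => k.toContinuousMap.comp (γB (f a)))
    (hkc.comp f.continuous) (fun g a t => by
      change k (γB (f (g • a)) t) = g • k (γB (f a) t)
      rw [f.map_smul, hγBG, k.map_smul]) (fun _ _ => trivial) (fun a => by
      change k (γB (f a) 0) = _
      rw [hγB0, h.comm])
  obtain ⟨R, hR, hRG, hRj, hRk⟩ := h.exists_equivariant_desc R₁
    (fun b => k.toContinuousMap.comp (γB b)) hR₁ hkc
    (fun g e => by ext t; exact hR₁G g e t)
    (fun g b => by
      ext t
      change k (γB (g • b) t) = g • k (γB b t)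
      rw [hγBG, k.map_smul]) hR₁i
  have hR0 : ∀ x, R x 0 = x := by
    intro x
    rcases h.exists_eq x with ⟨e, rfl⟩ | ⟨b, rfl⟩
    · exact (congrArg (· 0) (hRj e)).trans (hR₁0 e)
    · refine (congrArg (· 0) (hRk b)).trans ?_
      change k (γB b 0) = _
      rw [hγB0]
  let r : GMap G X X := ⟨⟨fun x => R x 1, hR.eval_const 1⟩, fun g x => by
    change R (g • x) 1 = g • R x 1
    rw [hRG]
    rfl⟩
  have hr : GHomotopic (GMap.id G X) r :=
    gHomotopic_of_path R hR hR0 (fun _ => rfl) fun g x t => congrArg (· t) (hRG g x)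
  have hrk : ∀ b, r (k b) = k (σB (π b)) := by
    intro b
    refine (congrArg (· 1) (hRk b)).trans ?_
    change k (γB b 1) = _
    rw [hγB1]
  -- a deformation of `E` that contracts the fibres of `A`
  obtain ⟨S, hS, hSG, hS0, -, hSi⟩ := exists_homotopy_extension i hi univ
    (fun _ _ _ => trivial) (GMap.id G E) (fun _ => trivial)
    (fun a => i.toContinuousMap.comp (γA a))
    ((ContinuousMap.continuous_postcomp i.toContinuousMap).comp hγA) (fun g a t => by
      change i (γA (g • a) t) = g • i (γA a t)
      rw [hγAG, i.map_smul]) (fun _ _ => trivial) (fun a => by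
      change i (γA a 0) = i a
      rw [hγA0])
  have hSi' : ∀ a t, S (i a) t = i (γA a t) := fun a t => by rw [hSi]; rfl
  obtain ⟨s', hs', hs'G, hs'j, hs'k⟩ := h.exists_equivariant_desc (fun e => S e 1)
    (fun b => i (σA (π b))) (hS.eval_const 1) (hπ.comp fun z => i (σA z)).continuous
    (fun g e => hSG g e 1) (fun g b => by rw [hπG, hσAG, i.map_smul])
    (fun a => by rw [hSi', hγA1])
  let s : GMap G X E := ⟨⟨s', hs'⟩, hs'G⟩
  -- After `r`, a point of `A` is remembered only through its image in `J`, so moving it along `γA`,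
  -- which preserves the fibres, is invisible. This lets the homotopy `K` below be constant on `B`.
  have hconst : ∀ a, r (j (i a)) = r (j (i (σA (π (f a))))) := by
    intro a
    rw [h.comm, h.comm, hrk, hrk, hσA]
  -- the deformation of `r` to a map that factors through `E`
  let rj : C(E, X) := ⟨fun e => r (j e), r.continuous.comp j.continuous⟩
  have hrjG : ∀ (g : G) e, r (j (g • e)) = g • r (j e) := fun g e => by
    rw [j.map_smul, r.map_smul]
  obtain ⟨K, hK, hKG, hKj, hKk⟩ := h.exists_equivariant_desc (fun e => rj.comp (S e))
    (fun b => ContinuousMap.const unitInterval (r (k b)))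
    ((ContinuousMap.continuous_postcomp rj).comp hS)
    (ContinuousMap.continuous_const'.comp (r.continuous.comp k.continuous))
    (fun g e => by
      ext t
      change r (j (S (g • e) t)) = g • r (j (S e t))
      rw [hSG, hrjG])
    (fun g b => by
      ext t
      change r (k (g • b)) = g • r (k b)
      rw [k.map_smul, r.map_smul])
    (fun a => by
      ext t
      change r (j (S (i a) t)) = r (k (f a))
      rw [hSi', hconst, hγAπ, ← h.comm, ← hconst])
  have hrs : GHomotopic r ((r.comp j).comp s) := by
    refine gHomotopic_of_path K hK (fun x => ?_) (fun x => ?_) fun g x t => congrArg (· t) (hKG g x)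
    · rcases h.exists_eq x with ⟨e, rfl⟩ | ⟨b, rfl⟩
      · refine (congrArg (· 0) (hKj e)).trans ?_
        change r (j (S e 0)) = _
        rw [hS0]
        rfl
      · exact congrArg (· 0) (hKk b)
    · rcases h.exists_eq x with ⟨e, rfl⟩ | ⟨b, rfl⟩
      · refine (congrArg (· 1) (hKj e)).trans ?_
        change r (j (S e 1)) = r (j (s' (j e)))
        rw [hs'j]
      · refine (congrArg (· 1) (hKk b)).trans ?_
        change r (k b) = r (j (s' (k b)))
        rw [hs'k, h.comm, hrk, hrk, hσA]
  obtain ⟨e₀, he₀, hE⟩ := hE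
  refine ⟨r (j e₀), fun g => by rw [← hrjG, he₀], ?_⟩
  -- The identity is homotopic to `r`, then to a map factoring through `E`, and contracting `E`
  -- makes it constant.
  exact hr.trans (hrs.trans ((hE.comp_left (r.comp j)).comp_right s))

end Contractible

/-! ### Restricted and induced complexes, coproducts -/

section Induced

variable {G : Type u} [Group G]

theorem IsGCWComplex.restrictHom {H K : Type u} [Group H] [Group K] (φ : H →* K) {Z : Type u}
    [TopologicalSpace Z] [MulAction K Z] [CWStructure Z] (h : IsGCWComplex K Z) :
    IsGCWComplex H (Restrict φ Z) where
  t2 := h.t2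
  continuous_smul := ⟨fun g => h.continuous_smul.continuous_const_smul (φ g)⟩
  exists_smul_cell g n e := h.exists_smul_cell (φ g) n e

theorem IsGCWComplex.sigma {J : Type u} {Z : J → Type u} [∀ j, TopologicalSpace (Z j)]
    [∀ j, MulAction G (Z j)] [∀ j, CWStructure (Z j)] (h : ∀ j, IsGCWComplex G (Z j)) :
    IsGCWComplex G (Σ j, Z j) where
  t2 := by
    have := fun j => (h j).t2
    infer_instance
  continuous_smul := ⟨fun g => continuous_sigma fun j =>
    continuous_sigmaMk.comp ((h j).continuous_smul.continuous_const_smul g)⟩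
  exists_smul_cell g n e := by
    obtain ⟨e', he'⟩ := (h e.1).exists_smul_cell g n e.2
    refine ⟨⟨e.1, e'⟩, fun x hx => ?_⟩
    exact congrArg (Sigma.mk e.1) (he' x hx)

namespace Induced

variable {H : Subgroup G} {Z : Type u} [MulAction H Z]

/-- The projection of `G ×_H Z` to `G / H`. -/
def coset (t : Induced H Z) : G ⧸ H :=
  Quotient.lift (s := inducedSetoid H Z) (fun p => (p.1 : G ⧸ H)) (by
    rintro p q ⟨h, h₁, -⟩
    rw [h₁]
    exact QuotientGroup.mk_mul_of_mem _ h.2) t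

theorem coset_mk (g : G) (z : Z) : (mk H g z).coset = (g : G ⧸ H) := rfl

theorem coset_smul (g : G) (t : Induced H Z) : (g • t).coset = g • t.coset := by
  obtain ⟨g', z, rfl⟩ := t.exists_mk
  rfl

theorem smul_mk_eq_of_mem (g : G) (h : H) (z : Z) : mk H (g * h) z = mk H g (h • z) :=
  mk_eq_iff.2 ⟨h, rfl, rfl⟩

theorem exists_mk_of_coset_eq {t : Induced H Z} {g : G} (h : t.coset = g) :
    ∃ z, mk H g z = t := by
  obtain ⟨g', z, rfl⟩ := t.exists_mk
  rw [coset_mk, QuotientGroup.eq] at h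
  refine ⟨(⟨g'⁻¹ * g, h⟩ : H)⁻¹ • z, ?_⟩
  rw [← smul_mk_eq_of_mem]
  congr 1
  simp

theorem mk_injective (g : G) : Function.Injective (mk H g : Z → Induced H Z) := by
  intro z z' hz
  obtain ⟨h, h₁, h₂⟩ := mk_eq_iff.1 hz
  have : h = 1 := by simpa using h₁
  simpa [this] using h₂.symm

theorem stabilizer_le (g : G) (z : Z) : MulAction.stabilizer G (mk H g z) ≤
    conjSubgroup g ((MulAction.stabilizer H z).map H.subtype) := by
  intro g' hg'
  obtain ⟨h, h₁, h₂⟩ := mk_eq_iff.1 (MulAction.mem_stabilizer_iff.1 hg' : mk H (g' * g) z = _)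
  refine ⟨h, ⟨h, h₂.symm, rfl⟩, ?_⟩
  change g * (h : G) * g⁻¹ = g'
  rw [← h₁, mul_inv_cancel_right]

theorem stabilizer_mem (F : Family G) (hF : ∀ z : Z, (MulAction.stabilizer H z).map H.subtype ∈ F)
    (t : Induced H Z) : MulAction.stabilizer G t ∈ F := by
  obtain ⟨g, z, rfl⟩ := t.exists_mk
  exact F.subgroup_mem _ _ (F.conj_mem g _ (hF z)) (stabilizer_le g z)

variable [TopologicalSpace Z]

theorem continuous_mk (g : G) : Continuous (mk H g : Z → Induced H Z) :=
  continuous_iff_isClosed.2 fun _ hA => isClosed_iff.1 hA g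

theorem isLocallyConstant_coset : IsLocallyConstant (coset : Induced H Z → G ⧸ H) := by
  intro S
  refine isClosed_compl_iff.1 (isClosed_iff.2 fun g => ?_)
  by_cases hg : (g : G ⧸ H) ∈ S
  · convert isClosed_empty
    exact eq_empty_of_forall_notMem fun z hz => hz hg
  · convert isClosed_univ
    exact eq_univ_of_forall fun z hz => hg hz

theorem isOpenEmbedding_mk [ContinuousConstSMul H Z] (g : G) :
    IsOpenEmbedding (mk H g : Z → Induced H Z) := by
  refine ⟨isEmbedding_mk g, ?_⟩
  convert isLocallyConstant_coset (H := H) (Z := Z) {(g : G ⧸ H)} using 1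
  ext t
  constructor
  · rintro ⟨z, rfl⟩
    rfl
  · exact fun h => exists_mk_of_coset_eq h

/-- The `G`-map on `G ×_H Z` given by an `H`-map on `Z`. -/
def lift {E : Type u} [TopologicalSpace E] [MulAction G E] [ContinuousConstSMul G E]
    (f : GMap H Z E) : GMap G (Induced H Z) E where
  toFun := Quotient.lift (s := inducedSetoid H Z) (fun p => p.1 • f p.2) (by
    rintro p q ⟨h, h₁, h₂⟩
    rw [h₁, h₂, f.map_smul, mul_smul]
    rfl)
  continuous_toFun := continuous_iff_isClosed.2 fun A hA => isClosed_iff.2 fun g =>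
    hA.preimage ((continuous_const_smul g).comp f.continuous)
  map_smul g t := by
    obtain ⟨g', z, rfl⟩ := t.exists_mk
    exact mul_smul g g' (f z)

theorem lift_mk {E : Type u} [TopologicalSpace E] [MulAction G E] [ContinuousConstSMul G E]
    (f : GMap H Z E) (g : G) (z : Z) : lift f (mk H g z) = g • f z := rfl

theorem isGCWComplex [CWStructure Z] [ContinuousConstSMul H Z] (h : IsGCWComplex H Z) :
    IsGCWComplex G (Induced H Z) where
  t2 := by
    have := h.t2
    refine ⟨fun t t' hne => ?_⟩
    by_cases hc : t.coset = t'.coset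
    · obtain ⟨g, z, rfl⟩ := t.exists_mk
      obtain ⟨z', rfl⟩ := exists_mk_of_coset_eq (g := g) hc.symm
      have hz : z ≠ z' := fun h' => hne (congrArg _ h')
      obtain ⟨U, U', hU, hU', hzU, hzU', hd⟩ := t2_separation hz
      exact ⟨_, _, (isOpenEmbedding_mk g).isOpenMap _ hU, (isOpenEmbedding_mk g).isOpenMap _ hU',
        ⟨z, hzU, rfl⟩, ⟨z', hzU', rfl⟩, disjoint_image_of_injective (mk_injective g) hd⟩
    · exact ⟨coset ⁻¹' {t.coset}, coset ⁻¹' {t'.coset}, isLocallyConstant_coset _,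
        isLocallyConstant_coset _, rfl, rfl, (disjoint_singleton.2 hc).preimage coset⟩
  continuous_smul := ⟨fun g => continuous_iff_isClosed.2 fun A hA => isClosed_iff.2 fun g' =>
    isClosed_iff.1 hA (g * g')⟩
  exists_smul_cell g n e := by
    obtain ⟨q, e⟩ := e
    -- The representative chosen for the translated coset is `g * q.out * k`; the correction `k` is
    -- absorbed by translating the cell of `Z` by `k⁻¹`.
    obtain ⟨k, hk⟩ := QuotientGroup.mk_out_eq_mul H (g * q.out)
    refine ⟨⟨((g * q.out : G) : G ⧸ H), smulCell k⁻¹ e⟩, fun x hx => ?_⟩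
    change mk H ((g * q.out : G) : G ⧸ H).out (RelCWComplex.map n (smulCell k⁻¹ e) x) =
      mk H (g * q.out) (RelCWComplex.map n e x)
    rw [map_smulCell _ _ hx, hk, smul_mk_eq_of_mem, smul_inv_smul]

end Induced

/-! ### Classifying spaces -/

/-- A `G`-map from `G ×_H pt`, that is `G/H`, is the same as a point fixed by `H`. -/
theorem IsClassifyingSpace.exists_fixed {F : Family G} {E : Type u} [TopologicalSpace E]
    [MulAction G E] [CWStructure E] (hE : IsClassifyingSpace F E) {H : Subgroup G} (hH : H ∈ F) :
    ∃ x : E, ∀ h : H, h • x = x := by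
  let _ : MulAction H PUnit.{u + 1} := trivialAction _ _
  have : ContinuousConstSMul H PUnit.{u + 1} := ⟨fun _ => continuous_id⟩
  have hP : IsGCWComplex H PUnit.{u + 1} :=
    ⟨inferInstance, inferInstance, fun _ _ e => ⟨e, fun _ _ => rfl⟩⟩
  have : IsGCWComplex G (Induced H PUnit.{u + 1}) := Induced.isGCWComplex hP
  obtain ⟨f⟩ := hE.exists_map (Induced H PUnit.{u + 1}) (Induced.stabilizer_mem F fun z =>
    F.subgroup_mem _ _ hH (Subgroup.map_subtype_le _))
  refine ⟨f (Induced.mk H 1 PUnit.unit), fun h => ?_⟩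
  change (h : G) • f _ = _
  rw [← f.map_smul, Induced.smul_mk, mul_one]
  congr 1
  exact Induced.mk_eq_iff.2 ⟨h, by simp, rfl⟩

/-- The identity and the constant `H`-map of `E` are adjoint to two `G`-maps on `G ×_H E`, whose
isotropy lies in `F`. By uniqueness these are `G`-homotopic; the homotopy is restricted to the
points `[1, y]`. -/
theorem IsClassifyingSpace.isGContractible {F : Family G} {E : Type u} [TopologicalSpace E]
    [MulAction G E] [CWStructure E] (hE : IsClassifyingSpace F E) {H : Subgroup G} (hH : H ∈ F) :
    IsGContractible H E := by
  obtain ⟨x, hx⟩ := hE.exists_fixed hH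
  have hHE : IsGCWComplex H E := hE.isGCWComplex.restrict H
  have := hHE.continuous_smul
  have := hE.isGCWComplex.continuous_smul
  have : IsGCWComplex G (Induced H E) := Induced.isGCWComplex hHE
  obtain ⟨γ, hγ, h0, h1, hG⟩ := (hE.homotopic (Induced H E) (Induced.stabilizer_mem F fun z =>
    F.subgroup_mem _ _ hH (Subgroup.map_subtype_le _)) (Induced.lift (GMap.id H E))
    (Induced.lift (GMap.const E x hx))).exists_path
  refine ⟨x, hx, gHomotopic_of_path (fun y => γ (Induced.mk H 1 y))
    (hγ.comp (Induced.continuous_mk 1)) (fun y => ?_) (fun y => ?_) fun h y t => ?_⟩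
  · rw [h0, Induced.lift_mk, one_smul]
  · rw [h1, Induced.lift_mk, one_smul]
  · change _ = (h : G) • γ _ t
    rw [← hG, Induced.smul_mk, mul_one, ← Induced.smul_mk_eq_of_mem, one_mul]

theorem IsClassifyingSpace.fillable {F : Family G} {E : Type u} [TopologicalSpace E]
    [MulAction G E] [CWStructure E] (hE : IsClassifyingSpace F E) {H : Subgroup G} (hH : H ∈ F) :
    Fillable (fixedSet H E) :=
  (hE.isGContractible hH).fillable_fixedSet

theorem isGContractible_of_fillable {E : Type u} [TopologicalSpace E] [MulAction G E]
    [CWStructure E] [IsGCWComplex G E] (h : ∀ H : Subgroup G, Fillable (fixedSet H E)) :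
    IsGContractible G E := by
  have : ContinuousConstSMul G E := IsGCWComplex.continuous_smul
  obtain ⟨x, hx⟩ := (h ⊤).nonempty
  exact ⟨x, fun g => hx g trivial, gHomotopic_of_fillable _ _ fun y => h _⟩

theorem fixedSet_map_subtype {H : Subgroup G} (K : Subgroup H) (X : Type*) [MulAction G X] :
    fixedSet (K.map H.subtype) X = fixedSet K X := by
  ext x
  constructor
  · exact fun hx h hh => hx h ⟨h, hh, rfl⟩
  · rintro hx _ ⟨h, hh, rfl⟩
    exact hx h hh

end Induced

/-! ### Fixed sets of the pushout. -/

section Pushout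

variable {G : Type u} [Group G] {A B E X : Type u} [TopologicalSpace A] [MulAction G A]
  [CWStructure A] [IsGCWComplex G A] [TopologicalSpace B] [MulAction G B] [CWStructure B]
  [IsGCWComplex G B] [TopologicalSpace E] [MulAction G E] [CWStructure E] [IsGCWComplex G E]
  [TopologicalSpace X] [MulAction G X] [ContinuousConstSMul G X]

/-- A pushout of `G`-CW-complexes along the inclusion of a subcomplex that is a classifying space,
by inspection of the fixed sets. -/
theorem IsGPushout.exists_isClassifyingSpace {i : GMap G A E} {f : GMap G A B} {j : GMap G E X}
    {k : GMap G B X} (h : IsGPushout i f j k) (hi : IsCWInclusion i) (hf : IsCellular f)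
    (ℱ 𝒢 : Family G) (hℱ𝒢 : ∀ H ∈ ℱ, H ∈ 𝒢) (hBstab : ∀ b : B, MulAction.stabilizer G b ∈ 𝒢)
    (hEstab : ∀ e : E, MulAction.stabilizer G e ∈ ℱ) {J : Type*} [MulAction G J] (π : B → J)
    (hπ : IsLocallyConstant π) (hπG : ∀ (g : G) b, π (g • b) = g • π b)
    (hE : ∀ H ∈ ℱ, Fillable (fixedSet H E))
    (hA : ∀ H ∈ ℱ, ∀ z : J, (∀ g ∈ H, g • z = z) → Fillable (fixedSet H A ∩ {a | π (f a) = z}))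
    (hB : ∀ H ∈ ℱ, ∀ z : J, (∀ g ∈ H, g • z = z) → Fillable (fixedSet H B ∩ {b | π b = z}))
    (hB' : ∀ H ∈ 𝒢, H ∉ ℱ → Fillable (fixedSet H B)) :
    ∃ _ : CWStructure X, IsCellular j ∧ IsCellular k ∧ IsClassifyingSpace 𝒢 X := by
  have : T2Space A := IsGCWComplex.t2Space G A
  have : T2Space B := IsGCWComplex.t2Space G B
  have : T2Space E := IsGCWComplex.t2Space G E
  have : ContinuousConstSMul G B := IsGCWComplex.continuous_smul
  have : ContinuousConstSMul G E := IsGCWComplex.continuous_smul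
  have hX : IsAdjunctionSpace i f j k := h.isAdjunctionSpace hi.isClosedEmbedding.injective
  refine ⟨hX.cwStructure hi hf f.continuous, hX.isCellular_left hi hf f.continuous,
    hX.isCellular_right hi hf f.continuous, ?_⟩
  let _ := hX.cwStructure hi hf f.continuous
  refine isClassifyingSpace_of_fillable (hX.isGCWComplex hi hf) (fun x => ?_) fun H hH => ?_
  · rcases hX.exists_eq' x with ⟨e, he, rfl⟩ | ⟨b, rfl⟩
    · refine 𝒢.subgroup_mem _ _ (hℱ𝒢 _ (hEstab e)) fun g hg => ?_
      have h1 : g • j e = j e := hg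
      rw [← j.map_smul] at h1
      exact (hX.eq_of_left e (g • e) he h1.symm).symm
    · refine 𝒢.subgroup_mem _ _ (hBstab b) fun g hg => ?_
      have h1 : g • k b = k b := hg
      rw [← k.map_smul] at h1
      exact hX.injective_right h1
  · by_cases hHℱ : H ∈ ℱ
    -- For `H ∈ ℱ` all actions are restricted to `H`; every subgroup of `H` is again in `ℱ`, so the
    -- pushout is `H`-contractible.
    · have hK : ∀ K : Subgroup H, K.map H.subtype ∈ ℱ := fun K =>
        ℱ.subgroup_mem _ _ hHℱ (Subgroup.map_subtype_le K)
      have := IsGCWComplex.restrict (G := G) (Y := A) inferInstance H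
      have := IsGCWComplex.restrict (G := G) (Y := B) inferInstance H
      have := IsGCWComplex.restrict (G := G) (Y := E) inferInstance H
      have : ContinuousConstSMul H X := ⟨fun g => continuous_const_smul (g : G)⟩
      have hz : ∀ (K : Subgroup H) (z : J), (∀ g ∈ K, g • z = z) →
          ∀ g ∈ K.map H.subtype, g • z = z := by
        rintro K z hz _ ⟨g, hg, rfl⟩
        exact hz g hg
      have hX' : IsAdjunctionSpace (i.restrict H) (f.restrict H) (j.restrict H) (k.restrict H) := hX
      refine IsGContractible.fillable_fixedSet (hX'.isGContractible hi
        (isGContractible_of_fillable fun K => ?_) π hπ (fun g b => hπG g b) (fun K z hz' => ?_)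
        fun K z hz' => ?_)
      · rw [← fixedSet_map_subtype]
        exact hE _ (hK K)
      · rw [← fixedSet_map_subtype]
        exact hA _ (hK K) z (hz K z hz')
      · rw [← fixedSet_map_subtype]
        exact hB _ (hK K) z (hz K z hz')
    -- Now `H` fixes no point of `E`, as isotropy there lies in `ℱ`, so its fixed set in `X` is the
    -- image of its fixed set in `B`.
    · have hk := hX.isClosedEmbedding_right hi.isClosedEmbedding f.continuous
      convert (hB' H hH hHℱ).image hk.isEmbedding using 1
      ext x
      constructor
      · intro hx
        rcases hX.exists_eq' x with ⟨e, he, rfl⟩ | ⟨b, rfl⟩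
        · refine (hHℱ (ℱ.subgroup_mem _ _ (hEstab e) fun g hg => ?_)).elim
          have h1 : g • j e = j e := hx g hg
          rw [← j.map_smul] at h1
          exact (hX.eq_of_left e (g • e) he h1.symm).symm
        · refine ⟨b, fun g hg => ?_, rfl⟩
          have h1 : g • k b = k b := hx g hg
          rw [← k.map_smul] at h1
          exact hX.injective_right h1
      · rintro ⟨b, hb, rfl⟩ g hg
        have h1 : g • k b = k (g • b) := (k.map_smul g b).symm
        exact h1.trans (congrArg k (hb g hg))

end Pushout

/-! ### Coproducts of induced spaces -/

section Conj

variable {G : Type u} [Group G]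

theorem mem_conjSubgroup {g x : G} {H : Subgroup G} :
    x ∈ conjSubgroup g H ↔ g⁻¹ * x * g ∈ H := by
  constructor
  · rintro ⟨h, hh, rfl⟩
    change g⁻¹ * (g * h * g⁻¹) * g ∈ H
    simpa [mul_assoc] using hh
  · intro hx
    refine ⟨_, hx, ?_⟩
    change g * (g⁻¹ * x * g) * g⁻¹ = x
    simp [mul_assoc]

theorem conjSubgroup_le_iff {g : G} {H K : Subgroup G} :
    conjSubgroup g⁻¹ H ≤ K ↔ H ≤ conjSubgroup g K := by
  constructor
  · intro h x hx
    refine mem_conjSubgroup.2 (h (mem_conjSubgroup.2 ?_))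
    simpa [mul_assoc] using hx
  · intro h x hx
    have := mem_conjSubgroup.1 (h (mem_conjSubgroup.1 hx))
    simpa [mul_assoc] using this

theorem conjSubgroup_mul (g h : G) (H : Subgroup G) :
    conjSubgroup (g * h) H = conjSubgroup g (conjSubgroup h H) := by
  ext x
  simp only [mem_conjSubgroup, mul_inv_rev, mul_assoc]

theorem conjSubgroup_one (H : Subgroup G) : conjSubgroup 1 H = H := by
  ext x
  simp [mem_conjSubgroup]

theorem Family.conj_mem_iff (F : Family G) {g : G} {H : Subgroup G} :
    conjSubgroup g H ∈ F ↔ H ∈ F := by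
  refine ⟨fun h => ?_, F.conj_mem g H⟩
  have := F.conj_mem g⁻¹ _ h
  rwa [← conjSubgroup_mul, inv_mul_cancel, conjSubgroup_one] at this

theorem IsMaximalIn.conjSubgroup {ℱ 𝒢 : Family G} {M : Subgroup G} (h : IsMaximalIn ℱ 𝒢 M) (g : G) :
    IsMaximalIn ℱ 𝒢 (conjSubgroup g M) := by
  refine ⟨⟨𝒢.conj_mem g M h.1.1, fun h' => h.1.2 (ℱ.conj_mem_iff.1 h')⟩, fun K hK hMK => ?_⟩
  have h1 : M ≤ EquivariantCW.conjSubgroup g⁻¹ K := by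
    rw [← conjSubgroup_le_iff, inv_inv]
    exact hMK
  rw [← conjSubgroup_le_iff]
  exact h.2 ⟨𝒢.conj_mem _ _ hK.1, fun h' => hK.2 (ℱ.conj_mem_iff.1 h')⟩ h1

theorem mem_normalizer_of_conjSubgroup_eq {g : G} {H : Subgroup G} (h : conjSubgroup g H = H) :
    g ∈ NG H := by
  rw [Subgroup.mem_normalizer_iff]
  intro x
  nth_rw 2 [← h]
  rw [mem_conjSubgroup]
  simp [mul_assoc]

theorem conjSubgroup_inv_le_of_smul_eq {H N : Subgroup G} {g : G}
    (h : ∀ x ∈ H, x • (g : G ⧸ N) = g) : conjSubgroup g⁻¹ H ≤ N := by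
  intro x hx
  have h1 : ((g * x * g⁻¹ * g : G) : G ⧸ N) = g := h _ (by simpa [mem_conjSubgroup] using hx)
  have h2 := QuotientGroup.eq.1 h1.symm
  simpa [mul_assoc] using h2

end Conj

section Coproduct

variable {G : Type u} [Group G] {ℳ : Set (Subgroup G)} {Z : ℳ → Type u}
  [∀ V : ℳ, MulAction (NG V.1) (Z V)]

/-- The projection of a coproduct of induced spaces to the set of cosets. -/
def sigmaCoset (t : Σ V : ℳ, Induced (NG V.1) (Z V)) : Σ V : ℳ, G ⧸ NG V.1 := ⟨t.1, t.2.coset⟩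

theorem sigmaCoset_smul (g : G) (t : Σ V : ℳ, Induced (NG V.1) (Z V)) :
    sigmaCoset (g • t) = g • sigmaCoset t :=
  congrArg (Sigma.mk t.1) (Induced.coset_smul g t.2)

/-- The map `x ↦ [g, x]` identifies `Z V` with the fibre over the coset of `g` and turns the action
of `n` into that of `g n g⁻¹`. -/
theorem fixedSet_inter_sigmaCoset {H : Subgroup G} {V : ℳ} {g : G}
    (hH : conjSubgroup g⁻¹ H ≤ NG V.1) :
    fixedSet H (Σ V : ℳ, Induced (NG V.1) (Z V)) ∩ {t | sigmaCoset t = ⟨V, (g : G ⧸ NG V.1)⟩} =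
      (fun x : Z V => (⟨V, Induced.mk (NG V.1) g x⟩ : Σ V : ℳ, Induced (NG V.1) (Z V))) ''
        fixedSet ((conjSubgroup g⁻¹ H).subgroupOf (NG V.1)) (Z V) := by
  have key : ∀ (n : NG V.1) (x : Z V),
      (g * n * g⁻¹ : G) • (⟨V, Induced.mk (NG V.1) g x⟩ : Σ V : ℳ, Induced (NG V.1) (Z V)) =
        ⟨V, Induced.mk (NG V.1) g (n • x)⟩ := by
    intro n x
    refine congrArg (Sigma.mk V) ?_
    change (g * n * g⁻¹ : G) • Induced.mk (NG V.1) g x = _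
    rw [Induced.smul_mk, inv_mul_cancel_right, Induced.smul_mk_eq_of_mem]
  ext t
  constructor
  · rintro ⟨ht, htc⟩
    obtain ⟨V', t⟩ := t
    obtain rfl : V' = V := congrArg Sigma.fst htc
    have htc' : t.coset = (g : G ⧸ NG V'.1) := eq_of_heq (Sigma.mk.inj htc).2
    obtain ⟨x, rfl⟩ := Induced.exists_mk_of_coset_eq htc'
    refine ⟨x, fun n hn => ?_, rfl⟩
    have hn' : (g * n * g⁻¹ : G) ∈ H := by
      have := mem_conjSubgroup.1 (Subgroup.mem_subgroupOf.1 hn)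
      simpa using this
    have h1 := ht _ hn'
    rw [key] at h1
    exact Induced.mk_injective g (eq_of_heq (Sigma.mk.inj h1).2)
  · rintro ⟨x, hx, rfl⟩
    refine ⟨fun h hh => ?_, rfl⟩
    have hn : g⁻¹ * h * g ∈ conjSubgroup g⁻¹ H := by
      rw [mem_conjSubgroup]
      simpa [mul_assoc] using hh
    have h1 := key ⟨_, hH hn⟩ x
    rw [hx _ (Subgroup.mem_subgroupOf.2 hn)] at h1
    simpa [mul_assoc] using h1

variable [∀ V : ℳ, TopologicalSpace (Z V)]

theorem isLocallyConstant_sigmaCoset :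
    IsLocallyConstant (sigmaCoset : (Σ V : ℳ, Induced (NG V.1) (Z V)) → _) := fun S =>
  isOpen_sigma_iff.2 fun V => Induced.isLocallyConstant_coset
    ((fun q : G ⧸ NG V.1 => (⟨V, q⟩ : Σ V : ℳ, G ⧸ NG V.1)) ⁻¹' S)

theorem fillable_fixedSet_inter_sigmaCoset [∀ V : ℳ, ContinuousConstSMul (NG V.1) (Z V)]
    {H : Subgroup G} {V : ℳ} {g : G} (hH : conjSubgroup g⁻¹ H ≤ NG V.1)
    (h : Fillable (fixedSet ((conjSubgroup g⁻¹ H).subgroupOf (NG V.1)) (Z V))) :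
    Fillable (fixedSet H (Σ V : ℳ, Induced (NG V.1) (Z V)) ∩
      {t | sigmaCoset t = ⟨V, (g : G ⧸ NG V.1)⟩}) := by
  rw [fixedSet_inter_sigmaCoset hH]
  exact h.image (IsEmbedding.sigmaMk.comp (Induced.isEmbedding_mk g))

end Coproduct

/-! ### The normalizer acting on a classifying space of the free actions of `W_GV`. -/

section Weyl

variable {G : Type u} [Group G] {V : Subgroup G} {EW : Type u} [TopologicalSpace EW]
  [MulAction (WG V) EW] [CWStructure EW]

/-- The quotient `W_GV` acts freely, so isotropy in the normalizer is exactly `V`, at every point.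
-/
theorem smul_restrict_eq_iff (hEW : IsClassifyingSpace (trivialFamily (WG V)) EW) (n : NG V)
    (x : Restrict (projWG V) EW) : n • x = x ↔ (n : G) ∈ V := by
  have h1 : @MulAction.stabilizer (WG V) EW _ _ x = ⊥ := hEW.stabilizer_mem x
  have h2 : n • x = x ↔ projWG V n ∈ @MulAction.stabilizer (WG V) EW _ _ x := Iff.rfl
  rw [h2, h1, Subgroup.mem_bot]
  exact QuotientGroup.eq_one_iff n

theorem fillable_restrict_of_le (hEW : IsClassifyingSpace (trivialFamily (WG V)) EW)
    {L : Subgroup (NG V)} (hL : ∀ n ∈ L, (n : G) ∈ V) :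
    Fillable (fixedSet L (Restrict (projWG V) EW)) := by
  have h1 : Fillable (fixedSet (⊥ : Subgroup (WG V)) EW) := hEW.fillable rfl
  have h2 : fixedSet (⊥ : Subgroup (WG V)) EW = univ := eq_univ_of_forall fun x g hg => by
    rw [Subgroup.mem_bot.1 hg, one_smul]
  have h3 : fixedSet L (Restrict (projWG V) EW) = univ := eq_univ_of_forall fun x n hn =>
    (smul_restrict_eq_iff hEW n x).2 (hL n hn)
  rw [h2] at h1
  rw [h3]
  exact h1

/-- The image of a fixed point under `f` is fixed, and freeness turns one fixed point into `L ≤ V`;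
then `L` acts trivially and the fixed set is everything. -/
theorem fillable_restrict_of_gMap (hEW : IsClassifyingSpace (trivialFamily (WG V)) EW)
    {EN : Type u} [TopologicalSpace EN] [MulAction (NG V) EN]
    (f : GMap (NG V) EN (Restrict (projWG V) EW)) {L : Subgroup (NG V)}
    (hL : (fixedSet L EN).Nonempty) : Fillable (fixedSet L (Restrict (projWG V) EW)) := by
  obtain ⟨x, hx⟩ := hL
  refine fillable_restrict_of_le hEW fun n hn => ?_
  rw [← smul_restrict_eq_iff hEW n (f x), ← f.map_smul, hx n hn]

end Weyl

/-! ### Condition (M) and the fixed sets of the two left corners. -/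

section Main

variable {G : Type u} [Group G] {ℱ 𝒢 : Family G} {P : Subgroup G → Prop} {ℳ : Set (Subgroup G)}

/-- A subgroup in `𝒢` but not in `ℱ` is subconjugate to an element of `ℳ`. -/
theorem exists_conjSubgroup_le (hM : ConditionM ℱ 𝒢) (hℳ : IsConjugacySystem P ℳ)
    (hP : ∀ K, IsMaximalIn ℱ 𝒢 K ↔ P K ∧ K ∉ ℱ) {H : Subgroup G} (hH : H ∈ 𝒢) (hHℱ : H ∉ ℱ) :
    ∃ (V : ℳ) (g : G), conjSubgroup g⁻¹ H ≤ V := by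
  obtain ⟨M, ⟨hHM, hMmax⟩, -⟩ := hM H hH hHℱ
  obtain ⟨V, ⟨hV, g, rfl⟩, -⟩ := hℳ.2 M ((hP M).1 hMmax).1
  refine ⟨⟨_, hV⟩, g⁻¹, ?_⟩
  rw [conjSubgroup_le_iff, ← conjSubgroup_mul, inv_mul_cancel, conjSubgroup_one]
  exact hHM

/-- Both `gVg⁻¹` and `g'V'g'⁻¹` are maximal subgroups containing `H`, hence equal. Since `ℳ` has one
member per conjugacy class, `V = V'`, and `g'⁻¹g` normalizes it. -/
theorem sigma_eq_of_conjSubgroup_le (hM : ConditionM ℱ 𝒢) (hℳ : IsConjugacySystem P ℳ)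
    (hP : ∀ K, IsMaximalIn ℱ 𝒢 K ↔ P K ∧ K ∉ ℱ) {H : Subgroup G} (hH : H ∈ 𝒢) (hHℱ : H ∉ ℱ)
    {V V' : ℳ} {g g' : G} (h : conjSubgroup g⁻¹ H ≤ V) (h' : conjSubgroup g'⁻¹ H ≤ V') :
    (⟨V, (g : G ⧸ NG V.1)⟩ : Σ V : ℳ, G ⧸ NG V.1) = ⟨V', (g' : G ⧸ NG V'.1)⟩ := by
  have hmax : ∀ (V : ℳ) (g : G), conjSubgroup g⁻¹ H ≤ V → IsMaximalIn ℱ 𝒢 V.1 := fun V g h =>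
    (hP V).2 ⟨hℳ.1 _ V.2, fun hV => hHℱ (ℱ.conj_mem_iff.1 (ℱ.subgroup_mem _ _ hV h))⟩
  have heq : conjSubgroup g V = conjSubgroup g' V' := (hM H hH hHℱ).unique
    ⟨conjSubgroup_le_iff.1 h, (hmax V g h).conjSubgroup g⟩
    ⟨conjSubgroup_le_iff.1 h', (hmax V' g' h').conjSubgroup g'⟩
  have heq' : conjSubgroup (g'⁻¹ * g) V = V'.1 := by
    rw [conjSubgroup_mul, heq, ← conjSubgroup_mul, inv_mul_cancel, conjSubgroup_one]
  obtain rfl : V = V' := Subtype.ext ((hℳ.2 V.1 (hℳ.1 _ V.2)).unique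
    ⟨V.2, 1, conjSubgroup_one _⟩ ⟨V'.2, _, heq'⟩)
  congr 1
  exact (QuotientGroup.eq.2 (mem_normalizer_of_conjSubgroup_eq heq')).symm

variable (ℱN : ∀ V : ℳ, Family (NG V.1))
  (hℱN : ∀ (V : ℳ) (L : Subgroup (NG V.1)), L ∈ ℱN V ↔ L.map (NG V.1).subtype ∈ ℱ)
  {EN : ℳ → Type u} [∀ V : ℳ, TopologicalSpace (EN V)] [∀ V : ℳ, MulAction (NG V.1) (EN V)]
  [∀ V : ℳ, ContinuousConstSMul (NG V.1) (EN V)] [∀ V : ℳ, CWStructure (EN V)]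
  (hEN : ∀ V : ℳ, IsClassifyingSpace (ℱN V) (EN V))
  {EW : ℳ → Type u} [∀ V : ℳ, TopologicalSpace (EW V)] [∀ V : ℳ, MulAction (WG V.1) (EW V)]
  [∀ V : ℳ, ContinuousConstSMul (WG V.1) (EW V)] [∀ V : ℳ, CWStructure (EW V)]
  (hEW : ∀ V : ℳ, IsClassifyingSpace (trivialFamily (WG V.1)) (EW V))
  (f : ∀ V : ℳ, GMap (NG V.1) (EN V) (Restrict (projWG V.1) (EW V)))

include hℱN in
theorem subgroupOf_conj_mem {H : Subgroup G} (hH : H ∈ ℱ) (V : ℳ) (g : G) :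
    (conjSubgroup g⁻¹ H).subgroupOf (NG V.1) ∈ ℱN V :=
  (hℱN V _).2 (ℱ.subgroup_mem _ _ (ℱ.conj_mem g⁻¹ H hH) (by
    rw [Subgroup.subgroupOf_map_subtype]
    exact inf_le_left))

omit [∀ V : ℳ, ContinuousConstSMul (WG V.1) (EW V)]
  [∀ V : ℳ, CWStructure (EW V)] in
include hℱN hEN in
theorem fillable_sigmaMap_fiber {H : Subgroup G} (hH : H ∈ ℱ) (z : Σ V : ℳ, G ⧸ NG V.1)
    (hz : ∀ g ∈ H, g • z = z) :
    Fillable (fixedSet H (Σ V : ℳ, Induced (NG V.1) (EN V)) ∩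
      {a | sigmaCoset (sigmaMap (fun V => Induced.map (f V)) a) = z}) := by
  obtain ⟨V, q⟩ := z
  obtain ⟨g, rfl⟩ := QuotientGroup.mk_surjective q
  have hg : conjSubgroup g⁻¹ H ≤ NG V.1 := conjSubgroup_inv_le_of_smul_eq fun x hx =>
    eq_of_heq (Sigma.mk.inj (hz x hx)).2
  have h1 := fillable_fixedSet_inter_sigmaCoset (Z := EN) hg
    ((hEN V).fillable (subgroupOf_conj_mem ℱN hℱN hH V g))
  convert h1 using 3
  ext ⟨V', t⟩
  obtain ⟨g', x, rfl⟩ := t.exists_mk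
  rfl

omit [∀ V : ℳ, ContinuousConstSMul (NG V.1) (EN V)] in
include hℱN hEN hEW f in
theorem fillable_sigmaCoset_fiber {H : Subgroup G} (hH : H ∈ ℱ) (z : Σ V : ℳ, G ⧸ NG V.1)
    (hz : ∀ g ∈ H, g • z = z) :
    Fillable (fixedSet H (Σ V : ℳ, Induced (NG V.1) (Restrict (projWG V.1) (EW V))) ∩
      {b | sigmaCoset b = z}) := by
  obtain ⟨V, q⟩ := z
  obtain ⟨g, rfl⟩ := QuotientGroup.mk_surjective q
  have hg : conjSubgroup g⁻¹ H ≤ NG V.1 := conjSubgroup_inv_le_of_smul_eq fun x hx =>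
    eq_of_heq (Sigma.mk.inj (hz x hx)).2
  exact fillable_fixedSet_inter_sigmaCoset hg (fillable_restrict_of_gMap (hEW V) (f V)
    ((hEN V).fillable (subgroupOf_conj_mem ℱN hℱN hH V g)).nonempty)

include hEW in
-- All points fixed by `H` lie over one coset, by uniqueness in (M), and there the conjugate of `H`
-- lies in `V`, so the fixed set is a whole copy of `EW V`.
theorem fillable_fixedSet_sigma (hM : ConditionM ℱ 𝒢) (hℳ : IsConjugacySystem P ℳ)
    (hP : ∀ K, IsMaximalIn ℱ 𝒢 K ↔ P K ∧ K ∉ ℱ) {H : Subgroup G} (hH : H ∈ 𝒢) (hHℱ : H ∉ ℱ) :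
    Fillable (fixedSet H (Σ V : ℳ, Induced (NG V.1) (Restrict (projWG V.1) (EW V)))) := by
  obtain ⟨V, g, hg⟩ := exists_conjSubgroup_le hM hℳ hP hH hHℱ
  have h1 := fillable_fixedSet_inter_sigmaCoset
    (Z := fun V : ℳ => Restrict (projWG V.1) (EW V)) (hg.trans Subgroup.le_normalizer)
    (fillable_restrict_of_le (hEW V) fun n hn => hg (Subgroup.mem_subgroupOf.1 hn))
  rwa [inter_eq_left.2] at h1
  rintro ⟨V', t⟩ ht
  obtain ⟨g', x, rfl⟩ := t.exists_mk
  refine sigma_eq_of_conjSubgroup_le hM hℳ hP hH hHℱ (V := V') (V' := V) (g := g') (fun y hy => ?_)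
    hg
  have h2 := ht (g' * y * g'⁻¹) (by simpa [mem_conjSubgroup] using hy)
  have h3 : Induced.mk (NG V'.1) (g' * y * g'⁻¹ * g') x = Induced.mk (NG V'.1) g' x :=
    eq_of_heq (Sigma.mk.inj h2).2
  obtain ⟨n, hn, hnx⟩ := Induced.mk_eq_iff.1 h3
  have hny : (n : G) = y := by simpa [mul_assoc] using hn.symm
  rw [← hny]
  exact (smul_restrict_eq_iff (hEW V') n x).1 hnx.symm

include hEN in
theorem isGCWComplex_sigma_induced :
    IsGCWComplex G (Σ V : ℳ, Induced (NG V.1) (EN V)) :=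
  IsGCWComplex.sigma fun V => Induced.isGCWComplex (hEN V).isGCWComplex

include hEW in
theorem isGCWComplex_sigma_induced_restrict :
    IsGCWComplex G (Σ V : ℳ, Induced (NG V.1) (Restrict (projWG V.1) (EW V))) :=
  IsGCWComplex.sigma fun V => Induced.isGCWComplex ((hEW V).isGCWComplex.restrictHom (projWG V.1))

omit [∀ V : ℳ, ContinuousConstSMul (WG V.1) (EW V)] in
include hEW in
theorem stabilizer_sigma_mem (hP𝒢 : ∀ V ∈ ℳ, V ∈ 𝒢)
    (b : Σ V : ℳ, Induced (NG V.1) (Restrict (projWG V.1) (EW V))) :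
    MulAction.stabilizer G b ∈ 𝒢 := by
  obtain ⟨V, t⟩ := b
  refine 𝒢.subgroup_mem _ _ (Induced.stabilizer_mem 𝒢 (fun x => ?_) t) fun g hg =>
    eq_of_heq (Sigma.mk.inj hg).2
  refine 𝒢.subgroup_mem _ _ (hP𝒢 _ V.2) ?_
  rintro _ ⟨n, hn, rfl⟩
  exact (smul_restrict_eq_iff (hEW V) n x).1 hn

variable {E : Type u} [TopologicalSpace E] [MulAction G E] [CWStructure E]
  {X : Type u} [TopologicalSpace X] [MulAction G X] [ContinuousConstSMul G X]
  {f} {i : GMap G (Σ V : ℳ, Induced (NG V.1) (EN V)) E} {j : GMap G E X}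
  {k : GMap G (Σ V : ℳ, Induced (NG V.1) (Restrict (projWG V.1) (EW V))) X}

include hℱN hEN hEW in
/-- The pushout is a classifying space if the upper map is the inclusion of a subcomplex. -/
theorem exists_isClassifyingSpace_of_inclusion_top (hℱ𝒢 : ∀ H ∈ ℱ, H ∈ 𝒢) (hM : ConditionM ℱ 𝒢)
    (hℳ : IsConjugacySystem P ℳ) (hP : ∀ K, IsMaximalIn ℱ 𝒢 K ↔ P K ∧ K ∉ ℱ)
    (hP𝒢 : ∀ K, P K → K ∈ 𝒢) (hE : IsClassifyingSpace ℱ E)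
    (h : IsGPushout i (sigmaMap fun V => Induced.map (f V)) j k)
    (hf : IsCellular (sigmaMap fun V => Induced.map (f V))) (hi : IsCWInclusion i) :
    ∃ _ : CWStructure X, IsCellular j ∧ IsCellular k ∧ IsClassifyingSpace 𝒢 X := by
  have := isGCWComplex_sigma_induced ℱN hEN
  have := isGCWComplex_sigma_induced_restrict hEW
  have := hE.isGCWComplex
  exact h.exists_isClassifyingSpace hi hf ℱ 𝒢 hℱ𝒢
    (stabilizer_sigma_mem hEW fun V hV => hP𝒢 V (hℳ.1 V hV)) hE.stabilizer_mem sigmaCoset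
    isLocallyConstant_sigmaCoset sigmaCoset_smul (fun H hH => hE.fillable hH)
    (fun H hH z hz => fillable_sigmaMap_fiber ℱN hℱN hEN f hH z hz)
    (fun H hH z hz => fillable_sigmaCoset_fiber ℱN hℱN hEN hEW f hH z hz)
    fun H hH hHℱ => fillable_fixedSet_sigma hEW hM hℳ hP hH hHℱ

omit [∀ V : ℳ, ContinuousConstSMul (NG V.1) (EN V)]
  [∀ V : ℳ, ContinuousConstSMul (WG V.1) (EW V)] in
include hℱN hEN hEW in
/-- If the left map is injective then the elements of `ℳ` belong to the smaller family. -/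
theorem mem_of_injective_left (hbot : ⊥ ∈ ℱ)
    (hf : Function.Injective (sigmaMap fun V : ℳ => Induced.map (f V))) (V : ℳ) : V.1 ∈ ℱ := by
  have hbotN : ⊥ ∈ ℱN V := (hℱN V _).2 (by rwa [Subgroup.map_bot])
  obtain ⟨x, -⟩ := ((hEN V).fillable hbotN).nonempty
  have hfV : ∀ y z : EN V, f V y = f V z → y = z := fun y z hyz => by
    have h1 := @hf ⟨V, Induced.mk (NG V.1) 1 y⟩ ⟨V, Induced.mk (NG V.1) 1 z⟩
      (congrArg (fun w => (⟨V, Induced.mk (NG V.1) 1 w⟩ :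
        Σ V : ℳ, Induced (NG V.1) (Restrict (projWG V.1) (EW V)))) hyz)
    exact Induced.mk_injective 1 (eq_of_heq (Sigma.mk.inj h1).2)
  have h2 : V.1.subgroupOf (NG V.1) ∈ ℱN V := (ℱN V).subgroup_mem _ _ ((hEN V).stabilizer_mem x)
    fun n hn => hfV _ _ (by
      rw [(f V).map_smul]
      exact (smul_restrict_eq_iff (hEW V) n (f V x)).2 hn)
  have h3 := (hℱN V _).1 h2
  rwa [Subgroup.subgroupOf_map_subtype, inf_eq_left.2 Subgroup.le_normalizer] at h3

include hEN hEW in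
/-- The pushout is a classifying space if the left map is the inclusion of a subcomplex and the
families coincide. -/
theorem exists_isClassifyingSpace_of_inclusion_left
    (hℱN : ∀ (V : ℳ) (L : Subgroup (NG V.1)), L ∈ ℱN V ↔ L.map (NG V.1).subtype ∈ ℱ)
    [Subsingleton (Σ V : ℳ, G ⧸ NG V.1)] (z₀ : Σ V : ℳ, G ⧸ NG V.1) (hℳ : ∀ V ∈ ℳ, V ∈ ℱ)
    (hE : IsClassifyingSpace ℱ E)
    (h : IsGPushout i (sigmaMap fun V => Induced.map (f V)) j k)
    (hf : IsCWInclusion (sigmaMap fun V => Induced.map (f V))) (hi : IsCellular i) :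
    ∃ _ : CWStructure X, IsCellular j ∧ IsCellular k ∧ IsClassifyingSpace ℱ X := by
  have := isGCWComplex_sigma_induced ℱN hEN
  have := isGCWComplex_sigma_induced_restrict hEW
  have := hE.isGCWComplex
  -- The square is transposed: the lower left corner is now the ambient complex and `E` is glued to
  -- it, all over a one-point set.
  obtain ⟨hX, hk, hj, hcl⟩ := h.symm.exists_isClassifyingSpace hf hi ℱ ℱ (fun _ hH => hH)
    hE.stabilizer_mem (stabilizer_sigma_mem hEW hℳ) (fun _ => z₀) (IsLocallyConstant.const z₀)
    (fun _ _ => Subsingleton.elim _ _)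
    (fun H hH => by
      have h1 := fillable_sigmaCoset_fiber ℱN hℱN hEN hEW f hH z₀ fun _ _ => Subsingleton.elim _ _
      simpa only [eq_iff_true_of_subsingleton, ofPred_true, inter_univ] using h1)
    (fun H hH z hz => by
      have h1 := fillable_sigmaMap_fiber ℱN hℱN hEN f hH z hz
      simpa only [eq_iff_true_of_subsingleton, ofPred_true, inter_univ] using h1)
    (fun H hH z hz => by
      simpa only [eq_iff_true_of_subsingleton, ofPred_true, inter_univ] using hE.fillable hH)
    (fun H hH hH' => absurd hH hH')
  exact ⟨hX, hj, hk, hcl⟩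

end Main

theorem IsCWInclusion.of_isEmpty {A E : Type u} [TopologicalSpace A] [CWStructure A] [IsEmpty A]
    [TopologicalSpace E] [CWStructure E] (i : A → E) : IsCWInclusion i where
  isClosedEmbedding := .of_continuous_injective_isClosedMap
    (continuous_of_const fun x => isEmptyElim x) (fun x => isEmptyElim x) fun s _ => by
      rw [eq_empty_of_isEmpty s, image_empty]
      exact isClosed_empty
  exists_cell n e := isEmptyElim (RelCWComplex.map n e 0)

/-! ### Comparison of the trivial, finite and virtually cyclic families. -/

section Families

variable {G : Type u} [Group G]

theorem finFamily_of_trivialFamily (H : Subgroup G) (h : H ∈ trivialFamily G) :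
    H ∈ finFamily G := by
  obtain rfl : H = ⊥ := h
  exact (inferInstance : Finite (⊥ : Subgroup G))

theorem vcyFamily_of_finFamily (H : Subgroup G) (h : H ∈ finFamily G) : H ∈ vcyFamily G := by
  have : Finite H := h
  exact ⟨⊥, inferInstance, inferInstance⟩

theorem mem_trivialFamily_iff_map {N : Subgroup G} (L : Subgroup N) :
    L ∈ trivialFamily N ↔ L.map N.subtype ∈ trivialFamily G :=
  (Subgroup.map_eq_bot_iff_of_injective L N.subtype_injective).symm

theorem mem_finFamily_iff_map {N : Subgroup G} (L : Subgroup N) :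
    L ∈ finFamily N ↔ L.map N.subtype ∈ finFamily G :=
  (L.equivMapOfInjective N.subtype N.subtype_injective).toEquiv.finite_iff

/-- Reconciles two notions of maximal finite subgroup. They differ only for the trivial subgroup,
which is maximal finite when `G` is torsion-free. -/
theorem isMaximalIn_trivialFamily_iff (K : Subgroup G) :
    IsMaximalIn (trivialFamily G) (finFamily G) K ↔
      Maximal (fun K : Subgroup G => K ∈ finFamily G) K ∧ K ∉ trivialFamily G := by
  refine ⟨fun h => ⟨⟨h.1.1, fun L hL hKL => h.2 ⟨hL, fun hL' => ?_⟩ hKL⟩, h.1.2⟩,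
    fun h => ⟨⟨h.1.1, h.2⟩, fun L hL hKL => h.1.2 hL.1 hKL⟩⟩
  exact h.1.2 ((trivialFamily G).subgroup_mem _ _ hL' hKL)

/-- If all elements of `ℳ` are trivial then so are all finite subgroups of `G`. -/
theorem finFamily_eq_trivialFamily (hM : ConditionM (trivialFamily G) (finFamily G))
    {ℳ : Set (Subgroup G)}
    (hℳ : IsConjugacySystem (Maximal fun K : Subgroup G => K ∈ finFamily G) ℳ)
    (h : ∀ V ∈ ℳ, V ∈ trivialFamily G) : finFamily G = trivialFamily G := by
  have h1 : ∀ H, H ∈ finFamily G ↔ H ∈ trivialFamily G := fun H => by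
    refine ⟨fun hH => ?_, finFamily_of_trivialFamily H⟩
    by_contra hH'
    obtain ⟨V, g, hg⟩ := exists_conjSubgroup_le hM hℳ isMaximalIn_trivialFamily_iff hH hH'
    exact hH' ((trivialFamily G).conj_mem_iff.1 ((trivialFamily G).subgroup_mem _ _ (h _ V.2) hg))
  have h2 : (finFamily G).carrier = (trivialFamily G).carrier := Set.ext h1
  generalize finFamily G = F at h2 ⊢
  generalize trivialFamily G = F' at h2 ⊢
  cases F
  cases F'
  cases h2
  rfl

end Families

end

end EquivariantCW

theorem mainTheorem4 (G : Type u) [Group G] :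
    (ConditionM (trivialFamily G) (finFamily G) →
      ∀ (ℳ : Set (Subgroup G)),
        IsConjugacySystem (Maximal fun K : Subgroup G => K ∈ finFamily G) ℳ →
      ∀ (E : Type u) [TopologicalSpace E] [MulAction G E] [CWStructure E],
        IsClassifyingSpace (trivialFamily G) E →
      ∀ (EN : ℳ → Type u) [∀ F : ℳ, TopologicalSpace (EN F)] [∀ F : ℳ, MulAction (NG F.1) (EN F)]
        [∀ F : ℳ, ContinuousConstSMul (NG F.1) (EN F)] [∀ F : ℳ, CWStructure (EN F)],
        (∀ F : ℳ, IsClassifyingSpace (trivialFamily (NG F.1)) (EN F)) →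
      ∀ (EW : ℳ → Type u) [∀ F : ℳ, TopologicalSpace (EW F)] [∀ F : ℳ, MulAction (WG F.1) (EW F)]
        [∀ F : ℳ, ContinuousConstSMul (WG F.1) (EW F)] [∀ F : ℳ, CWStructure (EW F)],
        (∀ F : ℳ, IsClassifyingSpace (trivialFamily (WG F.1)) (EW F)) →
      ∀ (X : Type u) [TopologicalSpace X] [MulAction G X] [ContinuousConstSMul G X]
        (f : ∀ F : ℳ, GMap (NG F.1) (EN F) (Restrict (projWG F.1) (EW F)))
        (i : GMap G (Σ F : ℳ, Induced (NG F.1) (EN F)) E)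
        (j : GMap G E X)
        (k : GMap G (Σ F : ℳ, Induced (NG F.1) (Restrict (projWG F.1) (EW F))) X),
        IsCellularGPushout i (sigmaMap fun F => Induced.map (f F)) j k →
      ∃ _ : CWStructure X, IsCellular j ∧ IsCellular k ∧ IsClassifyingSpace (finFamily G) X) ∧
    (ConditionM (finFamily G) (vcyFamily G) →
      ∀ (ℳ : Set (Subgroup G)),
        IsConjugacySystem (IsMaximalIn (finFamily G) (vcyFamily G)) ℳ →
      ∀ (E : Type u) [TopologicalSpace E] [MulAction G E] [CWStructure E],
        IsClassifyingSpace (finFamily G) E →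
      ∀ (EN : ℳ → Type u) [∀ V : ℳ, TopologicalSpace (EN V)] [∀ V : ℳ, MulAction (NG V.1) (EN V)]
        [∀ V : ℳ, ContinuousConstSMul (NG V.1) (EN V)] [∀ V : ℳ, CWStructure (EN V)],
        (∀ V : ℳ, IsClassifyingSpace (finFamily (NG V.1)) (EN V)) →
      ∀ (EW : ℳ → Type u) [∀ V : ℳ, TopologicalSpace (EW V)] [∀ V : ℳ, MulAction (WG V.1) (EW V)]
        [∀ V : ℳ, ContinuousConstSMul (WG V.1) (EW V)] [∀ V : ℳ, CWStructure (EW V)],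
        (∀ V : ℳ, IsClassifyingSpace (trivialFamily (WG V.1)) (EW V)) →
      ∀ (Y : Type u) [TopologicalSpace Y] [MulAction G Y] [ContinuousConstSMul G Y]
        (f : ∀ V : ℳ, GMap (NG V.1) (EN V) (Restrict (projWG V.1) (EW V)))
        (i : GMap G (Σ V : ℳ, Induced (NG V.1) (EN V)) E)
        (j : GMap G E Y)
        (k : GMap G (Σ V : ℳ, Induced (NG V.1) (Restrict (projWG V.1) (EW V))) Y),
        IsCellularGPushout i (sigmaMap fun V => Induced.map (f V)) j k →
      ∃ _ : CWStructure Y, IsCellular j ∧ IsCellular k ∧ IsClassifyingSpace (vcyFamily G) Y) := by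
  refine ⟨?_, ?_⟩
  · intro hM ℳ hℳ E _ _ _ hE EN _ _ _ _ hEN EW _ _ _ _ hEW X _ _ _ f i j k h
    have hℱN : ∀ (V : ℳ) (L : Subgroup (NG V.1)), L ∈ trivialFamily (NG V.1) ↔
      L.map (NG V.1).subtype ∈ trivialFamily G := fun _ => mem_trivialFamily_iff_map
    rcases h.inclusion with hi | hf
    · exact exists_isClassifyingSpace_of_inclusion_top _ hℱN hEN hEW finFamily_of_trivialFamily hM
        hℳ isMaximalIn_trivialFamily_iff (fun _ hK => hK.1) hE h.toIsGPushout h.cellular_left hi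
    · have hV := mem_of_injective_left _ hℱN hEN hEW rfl hf.isClosedEmbedding.injective
      have hfin := finFamily_eq_trivialFamily hM hℳ fun V hV' => hV ⟨V, hV'⟩
      -- In the torsion-free case the trivial subgroup is maximal finite, so `ℳ` is not empty; with
      -- normalizer `G` the indexing set of cosets is a single point.
      have hbot : Maximal (fun K : Subgroup G => K ∈ finFamily G) ⊥ := by
        rw [hfin]
        exact ⟨rfl, fun K hK _ => le_of_eq hK⟩
      obtain ⟨V, ⟨hV₀, -⟩, -⟩ := hℳ.2 ⊥ hbot
      have hNG : ∀ V : ℳ, NG V.1 = ⊤ := fun V => by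
        rw [show V.1 = ⊥ from hV V]
        exact Subgroup.normalizer_eq_top _
      have : Subsingleton (Σ V : ℳ, G ⧸ NG V.1) := ⟨by
        rintro ⟨V, q⟩ ⟨V', q'⟩
        obtain rfl : V = V' := Subtype.ext ((hV V : V.1 = ⊥).trans (hV V' : V'.1 = ⊥).symm)
        have := QuotientGroup.subsingleton_quotient_top (G := G)
        rw [← hNG V] at this
        rw [Subsingleton.elim q q']⟩
      rw [hfin]
      exact exists_isClassifyingSpace_of_inclusion_left _ hEN hEW hℱN ⟨⟨V, hV₀⟩, (1 : G)⟩
        (fun V hV' => hV ⟨V, hV'⟩) hE h.toIsGPushout hf h.cellular_top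
  · intro hM ℳ hℳ E _ _ _ hE EN _ _ _ _ hEN EW _ _ _ _ hEW Y _ _ _ f i j k h
    have hℱN : ∀ (V : ℳ) (L : Subgroup (NG V.1)), L ∈ finFamily (NG V.1) ↔
      L.map (NG V.1).subtype ∈ finFamily G := fun _ => mem_finFamily_iff_map
    -- An injective left map would make every `V ∈ ℳ` finite, although these are infinite; so `ℳ` is
    -- empty, the left corners are empty, and `i` is an inclusion vacuously.
    have hi : IsCWInclusion i := h.inclusion.elim id fun hf => by
      have hV := mem_of_injective_left _ hℱN hEN hEW (finFamily_of_trivialFamily _ rfl)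
        hf.isClosedEmbedding.injective
      have : IsEmpty ℳ := ⟨fun V => (hℳ.1 _ V.2).1.2 (hV V)⟩
      exact .of_isEmpty i
    exact exists_isClassifyingSpace_of_inclusion_top _ hℱN hEN hEW vcyFamily_of_finFamily hM hℳ
      (fun _ => ⟨fun h => ⟨h, h.1.2⟩, And.left⟩) (fun _ hK => hK.1.1) hE h.toIsGPushout
      h.cellular_left hi
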